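/- **Setting.** Let $d\ge 2$, $\theta^*\in\mathbb R^d$, $S_*=\|\theta^*\|_2$, $\sigma_*\ge 0$, and let $\mathcal A_1,\mathcal A_2,\dots\subset\mathbb R^d$ be fixed nonempty finite arm sets. In round $t$ the learner plays $A_t\in\mathcal A_t$ and observes $Y_t=\langle\theta^*,A_t\rangle+\eta_t$, where $\mathbb E[e^{u\eta_t}\mid A_{1:t},Y_{1:t-1}]\le e^{u^2\sigma_*^2/2}$ almost surely for all $u\in\mathbb R$. Let $\Delta_{a,t}=\max_{a'\in\mathcal A_t}\langle\theta^*,a'\rangle-\langle\theta^*,a\rangle$, and assume $\|a\|_2\le 1$ and $\Delta_{a,t}\le B$ for all $t$ and $a\in\mathcal A_t$. Put $\mathrm{Reg}_n=\sum_{t=1}^n\Delta_{A_t,t}$, and let $\Delta$ be the smallest positive value of $\Delta_{a,t}$ over $t\le n$, $a\in\mathcal A_t$ (if there is none, $\mathrm{Reg}_n=0$ and $1/\Delta$ is read as $0$). **Design oracle.** A function $\mathrm{ApproxDesign}$ maps each nonempty finite $\mathcal B\subset\mathbb R^d$ to a probability distribution $q$ on $\mathcal B$ such that $\|b\|^2_{V(q)^{-1}}\le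 C_{\mathrm{opt}}\,d\log d$ for all $b\in\mathcal B$, where $V(q)=\sum_{b\in\mathcal B}q_b\,bb^\top$ (for singular $V(q)$: $b=V(q)y$ for some $y$ with $\langle b,y\rangle\le C_{\mathrm{opt}}\,d\log d$), and $|\mathrm{supp}(q)|=\tilde O(d)$. **Algorithm.** LinMED has as inputs $\lambda>0$, guesses $\sigma>0$ and $S>0$ of $\sigma_*$ and $S_*$, and fractions $\alpha_{\mathrm{opt}},\alpha_{\mathrm{emp}}>0$ with $\alpha_{\mathrm{opt}}+\alpha_{\mathrm{emp}}\le1$. Let $V_t=\lambda I+\sum_{s\le t}A_sA_s^\top$, $\hat\theta_t=V_t^{-1}\sum_{s\le t}A_sY_s$, $\delta_t=\frac1{t+1}$, $$\beta_t=\Big(\sigma\sqrt{\log\tfrac{\det V_t}{\det V_0}+2\log\tfrac1{\delta_t}}+\sqrt\lambda S\Big)^2,\qquad \beta^*_t=\Big(\sigma_*\sqrt{\log\tfrac{\det V_t}{\det V_0}+2\log\tfrac1{\delta_t}}+\sqrt\lambda S_*\Big)^2 .$$ In round $t$, with any $\hat a_t\in\arg\max_{a\in\mathcal A_t}\langle\hat\theta_{t-1},a\rangle$,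 put $$f_t(a)=\exp\Big(-\frac{\langle\hat\theta_{t-1},\hat a_t-a\rangle^2}{\beta_{t-1}\|\hat a_t-a\|^2_{V_{t-1}^{-1}}}\Big)\quad(0/0=0).$$ Let $q_t^{\mathrm{opt}}$ be a distribution on $\mathcal A_t$ whose image under $a\mapsto\sqrt{f_t(a)}\,a$ is $\mathrm{ApproxDesign}(\{\sqrt{f_t(a)}\,a:a\in\mathcal A_t\})$, and $$q_t(a)=\alpha_{\mathrm{opt}}q_t^{\mathrm{opt}}(a)+\alpha_{\mathrm{emp}}\mathbf 1\{a=\hat a_t\}+\frac{1-\alpha_{\mathrm{opt}}-\alpha_{\mathrm{emp}}}{|\mathcal A_t|},\qquad p'_t(a)=\frac{q_t(a)f_t(a)}{\sum_{b\in\mathcal A_t}q_t(b)f_t(b)} .$$ If some arm of $\mathcal A_t$ has $\|a\|^2_{V_{t-1}^{-1}}>1$, let $B_t$ be any such arm and $p_t(a)=\frac12p'_t(a)+\frac12\mathbf 1\{a=B_t\}$; otherwise $p_t=p'_t$. Given the past, $A_t$ is drawn from $p_t$. The choices left open may depend measurably on the past in any way. **Theorem.** Let $H_{\max}=\max_{1\le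 t\le n}\exp(\beta^*_{t-1}/\beta_{t-1})$. There are constants $K$ and $k$ that depend only on $\alpha_{\mathrm{opt}},\alpha_{\mathrm{emp}},C_{\mathrm{opt}}$ such that for all $n\ge1$, with $\Lambda=\log\big(3+d+\frac1\lambda+\frac1\Delta+\sigma+S+\sigma_*+S_*\big)$, $$\mathbb E\,\mathrm{Reg}_n\le K\Lambda^k\bigg(\frac{d\log n}{\Delta}\Big(\big(\sigma^2d\log n+\lambda S^2\big)\log\log n+\big(\sigma_*^2d\log n+\lambda S_*^2\big)\,\mathbb E[H_{\max}]\Big)+dB\bigg),$$ where $\log\log n$ is read as $0$ for $n\le2$. No relation between $\sigma,S$ and $\sigma_*,S_*$ is assumed. -/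

import Mathlib

open MeasureTheory

namespace LinMED

/-- Column vectors in `ℝ^d`; the inner product is the dot product `a ⬝ᵥ b`. -/
abbrev Vec (d : ℕ) : Type := Fin d → ℝ

/-- The Euclidean norm. -/
noncomputable def euclNorm {d : ℕ} (a : Vec d) : ℝ :=
  ‖(WithLp.toLp 2 a : EuclideanSpace ℝ (Fin d))‖

/-- `‖a‖²_{V⁻¹} = aᵀ V⁻¹ a`. -/
noncomputable def invNormSq {d : ℕ} (V : Matrix (Fin d) (Fin d) ℝ) (a : Vec d) : ℝ :=
  a ⬝ᵥ (Matrix.mulVec V⁻¹ a)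

/-! ### Experimental designs -/

/-- `V(q) = ∑_{b ∈ 𝓑} q_b b bᵀ`. -/
noncomputable def designMatrix {d : ℕ} (𝓑 : Finset (Vec d)) (q : Vec d → ℝ) :
    Matrix (Fin d) (Fin d) ℝ :=
  ∑ b ∈ 𝓑, q b • Matrix.vecMulVec b b

/-- `‖b‖²_{V⁻¹} ≤ c`, meaningful for singular positive semidefinite `V` as well: `b = V y` for
some `y` (that is, `y = V⁻¹ b`), and `bᵀ y ≤ c`. For invertible `V` it is literally
`bᵀ V⁻¹ b ≤ c`, see `invNormSqLe_iff`; for singular `V` it is the usual convention that uses the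
pseudo-inverse (designs on sets that do not span `ℝ^d`). -/
def InvNormSqLe {d : ℕ} (V : Matrix (Fin d) (Fin d) ℝ) (b : Vec d) (c : ℝ) : Prop :=
  ∃ y : Vec d, Matrix.mulVec V y = b ∧ b ⬝ᵥ y ≤ c

theorem invNormSqLe_iff {d : ℕ} (V : Matrix (Fin d) (Fin d) ℝ) (hV : IsUnit V.det)
    (b : Vec d) (c : ℝ) : InvNormSqLe V b c ↔ invNormSq V b ≤ c := by
  constructor
  · rintro ⟨y, rfl, h⟩
    simpa [invNormSq, Matrix.mulVec_mulVec, Matrix.nonsing_inv_mul V hV] using h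
  · intro h
    exact ⟨Matrix.mulVec V⁻¹ b, by simp [Matrix.mulVec_mulVec, Matrix.mul_nonsing_inv V hV], h⟩

open scoped Classical in
/-- `design` maps every nonempty finite set `𝓑 ⊂ ℝ^d` to a probability distribution on `𝓑` that is
`Copt`-optimal, `‖b‖²_{V(q)⁻¹} ≤ Copt d log d` on `𝓑`, and has support of size `Õ(d)`. -/
structure IsDesignOracle {d : ℕ} (Copt csupp : ℝ) (ksupp : ℕ)
    (design : Finset (Vec d) → Vec d → ℝ) : Prop where
  nonneg : ∀ 𝓑 : Finset (Vec d), 𝓑.Nonempty → ∀ b ∈ 𝓑, 0 ≤ design 𝓑 b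
  sum_eq_one : ∀ 𝓑 : Finset (Vec d), 𝓑.Nonempty → ∑ b ∈ 𝓑, design 𝓑 b = 1
  optimal : ∀ 𝓑 : Finset (Vec d), 𝓑.Nonempty → ∀ b ∈ 𝓑,
    InvNormSqLe (designMatrix 𝓑 (design 𝓑)) b (Copt * d * Real.log d)
  small_support : ∀ 𝓑 : Finset (Vec d), 𝓑.Nonempty →
    ((𝓑.filter fun b => design 𝓑 b ≠ 0).card : ℝ) ≤ csupp * d * (1 + Real.log d) ^ ksupp

/-! ### Quantities computed from a trajectory

Rounds are numbered `0, 1, 2, …`: the arm sets `arms t`, the played arm `A t` and the reward `Y t`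
belong to the `(t+1)`-st round. Quantities such as `gram`, `ridge`, `radius` with index `t` use the
first `t` rounds. -/

/-- `V_t = λ I + ∑ A_s A_sᵀ`, the sum over the first `t` rounds. -/
noncomputable def gram {d : ℕ} (lam : ℝ) (A : ℕ → Vec d) (t : ℕ) : Matrix (Fin d) (Fin d) ℝ :=
  lam • (1 : Matrix (Fin d) (Fin d) ℝ) + ∑ s ∈ Finset.range t, Matrix.vecMulVec (A s) (A s)

/-- The ridge estimator `θ̂_t = V_t⁻¹ ∑ Y_s A_s` (so `θ̂_0 = 0`). -/
noncomputable def ridge {d : ℕ} (lam : ℝ) (A : ℕ → Vec d) (Y : ℕ → ℝ) (t : ℕ) : Vec d :=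
  Matrix.mulVec (gram lam A t)⁻¹ (∑ s ∈ Finset.range t, Y s • A s)

/-- `δ_t = 1/(t+1)`. -/
noncomputable def failureRate (t : ℕ) : ℝ := 1 / ((t : ℝ) + 1)

/-- The confidence radius
`(σ √(log (det V_t / det V_0) + 2 log (1/δ_t)) + √λ S)²` for noise level `σ` and norm `S`. -/
noncomputable def radius {d : ℕ} (lam σ S : ℝ) (A : ℕ → Vec d) (t : ℕ) : ℝ :=
  (σ * Real.sqrt (Real.log ((gram lam A t).det / (gram lam A 0).det)
      + 2 * Real.log (1 / failureRate t)) + Real.sqrt lam * S) ^ 2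

/-- The exponential weight of the arm `a` in the `(t+1)`-st round, with empirical best arm `ahat`.
At `a = ahat` the exponent is `0/0 = 0`. -/
noncomputable def weight {d : ℕ} (lam σ S : ℝ) (A : ℕ → Vec d) (Y : ℕ → ℝ) (t : ℕ)
    (ahat a : Vec d) : ℝ :=
  Real.exp (-((ridge lam A Y t ⬝ᵥ (ahat - a)) ^ 2
    / (radius lam σ S A t * invNormSq (gram lam A t) (ahat - a))))

/-- The rescaled arm `√(f_t(a)) a`. -/
noncomputable def rescaled {d : ℕ} (lam σ S : ℝ) (A : ℕ → Vec d) (Y : ℕ → ℝ) (t : ℕ)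
    (ahat a : Vec d) : Vec d :=
  Real.sqrt (weight lam σ S A Y t ahat a) • a

open scoped Classical in
/-- `q_t(a) = α_opt q^opt_t(a) + α_emp 1{a = â_t} + (1 - α_opt - α_emp) / |𝓐_t|`. -/
noncomputable def mixture {d : ℕ} (αopt αemp : ℝ) (arms : Finset (Vec d)) (qopt : Vec d → ℝ)
    (ahat a : Vec d) : ℝ :=
  αopt * qopt a + αemp * (if a = ahat then 1 else 0) + (1 - αopt - αemp) * (1 / (arms.card : ℝ))

/-- `p'_t(a) = q_t(a) f_t(a) / ∑_b q_t(b) f_t(b)`, for given weights `q`, `f`. -/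
noncomputable def tilted {d : ℕ} (arms : Finset (Vec d)) (q f : Vec d → ℝ) (a : Vec d) : ℝ :=
  q a * f a / ∑ b ∈ arms, q b * f b

/-- Arms with `‖a‖²_{V_t⁻¹} > 1`. -/
def underexplored {d : ℕ} (arms : Finset (Vec d)) (V : Matrix (Fin d) (Fin d) ℝ) : Set (Vec d) :=
  {a | a ∈ arms ∧ 1 < invNormSq V a}

open scoped Classical in
/-- The sampling probability `p_t(a)`: half of the mass goes to `bsel` whenever there is an
underexplored arm. -/
noncomputable def samplingProb {d : ℕ} (lam σ S αopt αemp : ℝ) (arms : Finset (Vec d))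
    (A : ℕ → Vec d) (Y : ℕ → ℝ) (t : ℕ) (ahat : Vec d) (qopt : Vec d → ℝ) (bsel a : Vec d) : ℝ :=
  let p' := tilted arms (mixture αopt αemp arms qopt ahat) (weight lam σ S A Y t ahat) a
  if (underexplored arms (gram lam A t)).Nonempty then
    (1 / 2) * p' + (1 / 2) * (if a = bsel then 1 else 0)
  else p'

/-! ### The interaction of the algorithm and the environment -/

section Interaction

variable {d : ℕ} {Ω : Type*} [MeasurableSpace Ω]

/-- The σ-algebra generated by the arms and the rewards of the first `t` rounds. -/
abbrev history (A : ℕ → Ω → Vec d) (Y : ℕ → Ω → ℝ) (t : ℕ) : MeasurableSpace Ω :=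
  ⨆ s ∈ Finset.range t,
    (MeasurableSpace.comap (A s) inferInstance ⊔ MeasurableSpace.comap (Y s) inferInstance)

/-- The σ-algebra generated by the first `t` rounds and by the arm played in the next one. -/
abbrev historyArm (A : ℕ → Ω → Vec d) (Y : ℕ → Ω → ℝ) (t : ℕ) : MeasurableSpace Ω :=
  history A Y t ⊔ MeasurableSpace.comap (A t) inferInstance

/-- Linear rewards `Y_t = ⟨θ, A_t⟩ + η_t`, with noise `η_t` that is `σ²`-sub-Gaussian conditionally
on the past arms and rewards and on the current arm. -/
structure IsLinearReward (P : Measure Ω) (θ : Vec d) (σ : ℝ)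
    (A : ℕ → Ω → Vec d) (Y : ℕ → Ω → ℝ) : Prop where
  measurable_reward : ∀ t, Measurable (Y t)
  integrable_exp : ∀ t, ∀ u : ℝ,
    Integrable (fun ω => Real.exp (u * (Y t ω - θ ⬝ᵥ A t ω))) P
  subgaussian : ∀ t, ∀ u : ℝ,
    condExp (historyArm A Y t) P (fun ω => Real.exp (u * (Y t ω - θ ⬝ᵥ A t ω)))
      ≤ᵐ[P] fun _ => Real.exp (u ^ 2 * σ ^ 2 / 2)

open scoped Classical in
/-- The arms `A` are played by LinMED (version with rescaled arms, `δ_t = 1/(t+1)`) with ridge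
parameter `lam`, guesses `σ`, `S`, fractions `αopt`, `αemp` and oracle `design`. All choices that
the algorithm leaves open are arbitrary, but depend (measurably) on the past only: the maximizer
`ahat`, the underexplored arm `bsel`, and, when distinct arms are rescaled to the same vector, how
`qopt` splits the mass that the design gives to this vector. -/
structure IsLinMED (P : Measure Ω) (lam σ S αopt αemp : ℝ)
    (design : Finset (Vec d) → Vec d → ℝ) (arms : ℕ → Finset (Vec d))
    (A : ℕ → Ω → Vec d) (Y : ℕ → Ω → ℝ) (ahat : ℕ → Ω → Vec d)
    (qopt : ℕ → Ω → Vec d → ℝ) (bsel : ℕ → Ω → Vec d) : Prop where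
  measurable_arm : ∀ t, Measurable (A t)
  measurable_ahat : ∀ t, Measurable[history A Y t] (ahat t)
  measurable_qopt : ∀ t a, Measurable[history A Y t] (fun ω => qopt t ω a)
  measurable_bsel : ∀ t, Measurable[history A Y t] (bsel t)
  ahat_mem : ∀ t ω, ahat t ω ∈ arms t
  ahat_max : ∀ t ω, ∀ a ∈ arms t,
    ridge lam (fun s => A s ω) (fun s => Y s ω) t ⬝ᵥ a
      ≤ ridge lam (fun s => A s ω) (fun s => Y s ω) t ⬝ᵥ ahat t ω
  qopt_nonneg : ∀ t ω, ∀ a ∈ arms t, 0 ≤ qopt t ω a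
  qopt_design : ∀ t ω,
    let φ : Vec d → Vec d := rescaled lam σ S (fun s => A s ω) (fun s => Y s ω) t (ahat t ω)
    ∀ b ∈ (arms t).image φ,
      ∑ a ∈ (arms t).filter (fun a => φ a = b), qopt t ω a = design ((arms t).image φ) b
  bsel_mem : ∀ t ω, (underexplored (arms t) (gram lam (fun s => A s ω) t)).Nonempty →
    bsel t ω ∈ underexplored (arms t) (gram lam (fun s => A s ω) t)
  arm_mem : ∀ t, ∀ᵐ ω ∂P, A t ω ∈ arms t
  arm_law : ∀ t, ∀ a ∈ arms t,
    condExp (history A Y t) P (Set.indicator {ω | A t ω = a} fun _ => (1 : ℝ))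
      =ᵐ[P] fun ω => samplingProb lam σ S αopt αemp (arms t) (fun s => A s ω) (fun s => Y s ω) t
        (ahat t ω) (qopt t ω) (bsel t ω) a

end Interaction

/-! ### Gaps, regret, and the quantities in the bound -/

/-- `Δ_{a,t} = max_{a' ∈ 𝓐_t} ⟨θ, a'⟩ - ⟨θ, a⟩`. -/
noncomputable def gap {d : ℕ} (arms : ℕ → Finset (Vec d)) (θ : Vec d) (t : ℕ) (a : Vec d) : ℝ :=
  sSup ((fun a' => θ ⬝ᵥ a') '' (arms t : Set (Vec d))) - θ ⬝ᵥ a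

/-- The smallest positive gap in the first `n` rounds (`0` if there is none, and then `1/Δ = 0`,
consistently with the vanishing regret). -/
noncomputable def minGap {d : ℕ} (arms : ℕ → Finset (Vec d)) (θ : Vec d) (n : ℕ) : ℝ :=
  sInf {x : ℝ | ∃ t < n, ∃ a ∈ arms t, 0 < gap arms θ t a ∧ x = gap arms θ t a}

/-- The cumulative pseudo-regret of the first `n` rounds along a trajectory. -/
noncomputable def regret {d : ℕ} (arms : ℕ → Finset (Vec d)) (θ : Vec d) (n : ℕ)
    (A : ℕ → Vec d) : ℝ :=
  ∑ t ∈ Finset.range n, gap arms θ t (A t)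

/-- `H_max = max_{0 ≤ t < n} exp (β*_t / β_t)` along a trajectory. -/
noncomputable def Hmax {d : ℕ} (lam σ S σs : ℝ) (θ : Vec d) (n : ℕ) (A : ℕ → Vec d) : ℝ :=
  ⨆ t : Fin n, Real.exp (radius lam σs (euclNorm θ) A t / radius lam σ S A t)

/-- The logarithm that the bound hides; it involves `n` only through the smallest gap `gapn`. -/
noncomputable def hiddenLog (d : ℕ) (lam gapn σ S σs Ss : ℝ) : ℝ :=
  Real.log (3 + d + 1 / lam + 1 / gapn + σ + S + σs + Ss)

/-- `(d log n / Δ) ((σ² d log n + λ S²) log log n + (σ*² d log n + λ S*²) H)`. The value of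
`log log n` is replaced by `0` for `n ≤ 2`, where it is negative (or undefined). -/
noncomputable def mainTerm (d n : ℕ) (lam gapn σ S σs Ss H : ℝ) : ℝ :=
  (1 / gapn) * d * Real.log n *
    ((σ ^ 2 * d * Real.log n + lam * S ^ 2) * max (Real.log (Real.log n)) 0
      + (σs ^ 2 * d * Real.log n + lam * Ss ^ 2) * H)

end LinMED

/-!
The expected regret of a round is bounded by the expectation of functions of the played arm alone,
and each of these is summed over the rounds by a potential argument. Write `v_t = ‖A_t‖²_{V_t⁻¹}`
for the leverage, `e_t(a) = ⟨θ - θ̂_t, a⟩` for the prediction error, `U_t = ‖θ̂_t - θ‖²_{V_t}` for the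
error of the estimator, and `f_t` for the weights.

* Underexplored arms. If there is one, such an arm is sampled with probability at least `1/2`
  (`half_le_sum_samplingProb`), and the number of rounds with `v_t > 1` is `O(d log (1 + d/λ))`,
  whatever the horizon, because each of these rounds adds at least a constant to the potential of
  these rounds alone (`sum_large_potential_le`). This gives the summand `d B`. From here on all
  arms satisfy `‖a‖²_{V_t⁻¹} ≤ 1`.

* A gap `g ≥ Δ` is at most a multiple of `(empirical gap)² / Δ`, or else of
  `(e_t(a*)² + e_t(a)²) / Δ` (`gap_le_sq`).

* Empirical gaps. With a deterministic bound `β` for `β_t`, the squared empirical gap is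
  `β ‖â - a‖² x` with `f_t(a) ≤ e^{-x}`, and `x e^{-x} ≤ log n / n` as soon as `x ≥ log n`.
  If `x ≤ log n`, a gap of at least `Δ / 2` forces
  `‖â - a‖²`, hence the norm of `â` or of `a`, to be at least of order `ε = Δ² / (β log n)`
  (`mul_sq_empGap_le`); `â` is itself played with probability at least `α_emp`. The potential
  restricted to the rounds with `v_t ≥ ε` is `O(d log (1 + d / (ε λ)))`, and the horizon enters only
  as `log (1 / ε)`, that is, as `log log n` up to the hidden logarithms.

* Estimation errors inside the confidence ellipsoid of radius `β*_t`. The optimal arm has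
  `f_t(a*) ≥ exp (-β*_t / β_t)` (`inv_weight_best_le`), and the design on the rescaled arms bounds
  `f_t(a*) e_t(a*)²` by `C d log d` times the mean of `e_t(A_t)²` under the sampling distribution
  (`IsRoundDesign.weight_mul_sq_le`). It remains to sum `exp (β*_t / β_t) e_t(A_t)²`. One step of the
  recursion `estError_succ` decreases `U` by `e_t² / (1 + v_t)`, up to a centred term and a term
  `η_t² v_t / (1 + v_t)` whose sum is a potential. The weights are replaced by their running maximum
  `runningH`, which depends on the past and increases, so that Abel summation against the truncated
  potential `min (U_t) b`, with `b` a deterministic upper bound for `β*`, costs only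
  `b · E[H_max]`, besides the noise term `σ*² d log (1 + n/λ) · E[H_max]`
  (`sum_integral_sq_predError_le`). The truncation is what makes the bound linear in
  `E[H_max]`, without moments of `U` weighted by `H_max`.

* Estimation errors outside of the ellipsoid. There `U_t` is at most `δ_t` times a logarithmic factor
  times the self-normalized exponential `selfNormExp` (`estError_le_of_radius_lt`), which has
  expectation at most `1` (`lintegral_selfNormExp_le`), and the sum of the `δ_t` is at most
  `1 + log n`. In the supermartingale step the square of the noise is linearized by a
  one-dimensional Gaussian mixture (`IsCondSubgaussian.lintegral_exp_quadratic_le`).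

For `n ≥ 16` one has `log log n ≥ 1` and the four contributions are collected in
`regret_bound_le_mainTerm`; for smaller `n` the regret is at most `15 B`.
-/

namespace LinMED

variable {d : ℕ}

/-! ### Positive definite matrices and rank-one updates -/

theorem euclNorm_sq (a : Vec d) : euclNorm a ^ 2 = a ⬝ᵥ a := by
  rw [euclNorm, EuclideanSpace.norm_sq_eq]
  simp [dotProduct, sq]

theorem euclNorm_nonneg (a : Vec d) : 0 ≤ euclNorm a := norm_nonneg _

/-- A rank-one update acts on vectors by `x ↦ V x + (a ⬝ x) a`. -/
theorem add_vecMulVec_mulVec (V : Matrix (Fin d) (Fin d) ℝ) (a x : Vec d) :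
    Matrix.mulVec (V + Matrix.vecMulVec a a) x = Matrix.mulVec V x + (a ⬝ᵥ x) • a := by
  rw [Matrix.add_mulVec, Matrix.vecMulVec_mulVec]
  simp

theorem posDef_add_vecMulVec {V : Matrix (Fin d) (Fin d) ℝ} (hV : V.PosDef) (a : Vec d) :
    (V + Matrix.vecMulVec a a).PosDef := by
  have := Matrix.posSemidef_vecMulVec_self_star a
  exact hV.add_posSemidef (by simpa using this)

section PosDef

variable {V : Matrix (Fin d) (Fin d) ℝ} (hV : V.PosDef)
include hV

theorem posDef_mulVec_inv (a : Vec d) : Matrix.mulVec V (Matrix.mulVec V⁻¹ a) = a := by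
  have := (Matrix.isUnit_iff_isUnit_det _).1 hV.isUnit
  simp [Matrix.mulVec_mulVec, Matrix.mul_nonsing_inv V this]

theorem posDef_inv_mulVec (a : Vec d) : Matrix.mulVec V⁻¹ (Matrix.mulVec V a) = a := by
  have := (Matrix.isUnit_iff_isUnit_det _).1 hV.isUnit
  simp [Matrix.mulVec_mulVec, Matrix.nonsing_inv_mul V this]

theorem posDef_dotProduct_mulVec_comm (x y : Vec d) :
    x ⬝ᵥ Matrix.mulVec V y = y ⬝ᵥ Matrix.mulVec V x := by
  have h : V.transpose = V := by simpa using hV.isHermitian.eq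
  rw [Matrix.dotProduct_mulVec, ← Matrix.mulVec_transpose, h, dotProduct_comm]

theorem posDef_quadForm_nonneg (x : Vec d) : 0 ≤ x ⬝ᵥ Matrix.mulVec V x := by
  simpa using hV.posSemidef.dotProduct_mulVec_nonneg x

/-- Cauchy–Schwarz for the inner product of a positive definite matrix. -/
theorem posDef_cauchySchwarz (x y : Vec d) :
    (x ⬝ᵥ Matrix.mulVec V y) ^ 2 ≤ (x ⬝ᵥ Matrix.mulVec V x) * (y ⬝ᵥ Matrix.mulVec V y) := by
  have h : ∀ s : ℝ, 0 ≤ (y ⬝ᵥ Matrix.mulVec V y) * (s * s) + (2 * (x ⬝ᵥ Matrix.mulVec V y)) * s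
      + (x ⬝ᵥ Matrix.mulVec V x) := by
    intro s
    have := posDef_quadForm_nonneg hV (x + s • y)
    simp only [Matrix.mulVec_add, Matrix.mulVec_smul, dotProduct_add, add_dotProduct,
      smul_dotProduct, dotProduct_smul, smul_eq_mul] at this
    rw [posDef_dotProduct_mulVec_comm hV y x] at this
    linarith
  have := discrim_le_zero h
  unfold discrim at this
  nlinarith

theorem invNormSq_nonneg (a : Vec d) : 0 ≤ invNormSq V a :=
  posDef_quadForm_nonneg hV.inv a

theorem invNormSq_pos {a : Vec d} (ha : a ≠ 0) : 0 < invNormSq V a := by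
  simpa [invNormSq] using hV.inv.dotProduct_mulVec_pos ha

theorem inv_cauchySchwarz (x y : Vec d) :
    (x ⬝ᵥ Matrix.mulVec V⁻¹ y) ^ 2 ≤ invNormSq V x * invNormSq V y :=
  posDef_cauchySchwarz hV.inv x y

theorem invNormSq_sub_le (x y : Vec d) :
    invNormSq V (x - y) ≤ 2 * (invNormSq V x + invNormSq V y) := by
  have h := invNormSq_nonneg hV (x + y)
  unfold invNormSq at *
  simp only [Matrix.mulVec_add, Matrix.mulVec_sub, dotProduct_add, add_dotProduct,
    dotProduct_sub, sub_dotProduct] at *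
  linarith

/-- Triangle inequality for the norm of `V⁻¹`. -/
theorem sqrt_invNormSq_sub_le (x y : Vec d) :
    Real.sqrt (invNormSq V (x - y)) ≤ Real.sqrt (invNormSq V x) + Real.sqrt (invNormSq V y) := by
  have hx := invNormSq_nonneg hV x
  have hy := invNormSq_nonneg hV y
  rw [Real.sqrt_le_left (by positivity)]
  have hc := inv_cauchySchwarz hV x y
  have hc' : -(x ⬝ᵥ Matrix.mulVec V⁻¹ y)
      ≤ Real.sqrt (invNormSq V x) * Real.sqrt (invNormSq V y) := by
    rw [← Real.sqrt_mul hx]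
    apply Real.le_sqrt_of_sq_le
    simpa using hc
  have hs := posDef_dotProduct_mulVec_comm hV.inv y x
  have e : invNormSq V (x - y)
      = invNormSq V x + invNormSq V y - 2 * (x ⬝ᵥ Matrix.mulVec V⁻¹ y) := by
    unfold invNormSq
    simp only [Matrix.mulVec_sub, dotProduct_sub, sub_dotProduct]
    linarith
  rw [e, add_sq, Real.sq_sqrt hx, Real.sq_sqrt hy]
  linarith

/-- `V ↦ V⁻¹` is antitone; here `V` dominates `W`. -/
theorem invNormSq_antitone {W : Matrix (Fin d) (Fin d) ℝ} (hW : W.PosDef)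
    (h : ∀ x : Vec d, x ⬝ᵥ Matrix.mulVec W x ≤ x ⬝ᵥ Matrix.mulVec V x) (a : Vec d) :
    invNormSq V a ≤ invNormSq W a := by
  set y := Matrix.mulVec V⁻¹ a with hy
  set z := Matrix.mulVec W⁻¹ a with hz
  have hWz : Matrix.mulVec W z = a := posDef_mulVec_inv hW a
  have hVy : Matrix.mulVec V y = a := posDef_mulVec_inv hV a
  have h0 : 0 ≤ a ⬝ᵥ y := invNormSq_nonneg hV a
  have h0' : 0 ≤ a ⬝ᵥ z := invNormSq_nonneg hW a
  have hcs := posDef_cauchySchwarz hW y z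
  have hyy := h y
  rw [hWz, dotProduct_comm y a, dotProduct_comm z a] at hcs
  rw [hVy, dotProduct_comm y a] at hyy
  have h1 : (a ⬝ᵥ y) ^ 2 ≤ (a ⬝ᵥ y) * (a ⬝ᵥ z) :=
    hcs.trans (mul_le_mul_of_nonneg_right hyy h0')
  change a ⬝ᵥ y ≤ a ⬝ᵥ z
  rcases h0.eq_or_lt with h2 | h2
  · rw [← h2]; exact h0'
  · nlinarith

/-- Effect of a rank-one update on the norm of `V⁻¹` (Sherman–Morrison). -/
theorem invNormSq_update (a z : Vec d) (η : ℝ) :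
    invNormSq (V + Matrix.vecMulVec a a) (z + η • a)
      = invNormSq V z - (a ⬝ᵥ Matrix.mulVec V⁻¹ z) ^ 2 / (1 + invNormSq V a)
        + 2 * η * (a ⬝ᵥ Matrix.mulVec V⁻¹ z) / (1 + invNormSq V a)
        + η ^ 2 * invNormSq V a / (1 + invNormSq V a) := by
  have hv := invNormSq_nonneg hV a
  set v := invNormSq V a with hvdef
  set u := a ⬝ᵥ Matrix.mulVec V⁻¹ z with hu
  set κ := (η - u) / (1 + v) with hκ
  set w := Matrix.mulVec V⁻¹ z + κ • Matrix.mulVec V⁻¹ a with hw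
  have hau : z ⬝ᵥ Matrix.mulVec V⁻¹ a = u := posDef_dotProduct_mulVec_comm hV.inv z a
  have hav : a ⬝ᵥ Matrix.mulVec V⁻¹ a = v := rfl
  have key : Matrix.mulVec (V + Matrix.vecMulVec a a) w = z + η • a := by
    rw [add_vecMulVec_mulVec, hw, Matrix.mulVec_add, Matrix.mulVec_smul, posDef_mulVec_inv hV,
      posDef_mulVec_inv hV, dotProduct_add, dotProduct_smul, ← hu, hav, add_assoc, ← add_smul]
    congr 2
    rw [hκ, smul_eq_mul]; field_simp; ring
  have hw' : Matrix.mulVec (V + Matrix.vecMulVec a a)⁻¹ (z + η • a) = w := by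
    rw [← key, posDef_inv_mulVec (posDef_add_vecMulVec hV a)]
  rw [invNormSq, hw', hw]
  simp only [add_dotProduct, dotProduct_add, smul_dotProduct, dotProduct_smul, smul_eq_mul, hau,
    hav, ← hu]
  rw [show z ⬝ᵥ Matrix.mulVec V⁻¹ z = invNormSq V z from rfl, hκ]
  field_simp
  ring

/-- Matrix determinant lemma for a rank-one update. -/
theorem det_update (a : Vec d) :
    (V + Matrix.vecMulVec a a).det = V.det * (1 + invNormSq V a) := by
  have h := Matrix.det_add_replicateCol_mul_replicateRow (ι := Unit)
    ((Matrix.isUnit_iff_isUnit_det _).1 hV.isUnit) a a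
  have e : Matrix.replicateCol Unit a * Matrix.replicateRow Unit a = Matrix.vecMulVec a a := by
    rw [Matrix.vecMulVec_eq Unit]
  rw [e] at h
  rw [h]
  congr 1
  simp [Matrix.det_unique, Matrix.mul_apply, invNormSq, dotProduct, Matrix.mulVec,
    Finset.mul_sum, Finset.sum_mul]
  rw [Finset.sum_comm]
  refine Finset.sum_congr rfl fun i _ => Finset.sum_congr rfl fun j _ => ?_
  ring

end PosDef

/-! ### The Gram matrix -/

section Gram

variable {lam : ℝ} (hlam : 0 < lam) (A : ℕ → Vec d)

theorem gram_zero : gram lam A 0 = lam • (1 : Matrix (Fin d) (Fin d) ℝ) := by simp [gram]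

theorem gram_succ (t : ℕ) :
    gram lam A (t + 1) = gram lam A t + Matrix.vecMulVec (A t) (A t) := by
  simp [gram, Finset.sum_range_succ, add_assoc]

theorem gram_quadForm (t : ℕ) (x : Vec d) :
    x ⬝ᵥ Matrix.mulVec (gram lam A t) x
      = lam * (x ⬝ᵥ x) + ∑ s ∈ Finset.range t, (A s ⬝ᵥ x) ^ 2 := by
  induction t with
  | zero => simp [gram_zero, Matrix.smul_mulVec]
  | succ t ih =>
    rw [gram_succ, add_vecMulVec_mulVec, dotProduct_add, ih, Finset.sum_range_succ,
      dotProduct_smul, dotProduct_comm x (A t), smul_eq_mul]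
    ring

theorem gram_det_zero : (gram lam A 0).det = lam ^ d := by
  simp [gram_zero]

include hlam

theorem gram_posDef (t : ℕ) : (gram lam A t).PosDef := by
  induction t with
  | zero =>
    rw [gram_zero]
    exact Matrix.PosDef.one.smul hlam
  | succ t ih => rw [gram_succ]; exact posDef_add_vecMulVec ih _

theorem invNormSq_gram_le (t : ℕ) (a : Vec d) :
    invNormSq (gram lam A t) a ≤ euclNorm a ^ 2 / lam := by
  have h := invNormSq_antitone (gram_posDef hlam A t) (gram_posDef hlam A 0)
    (fun x => by
      rw [gram_quadForm, gram_quadForm]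
      have := Finset.sum_nonneg (s := Finset.range t) fun s _ => sq_nonneg (A s ⬝ᵥ x)
      simpa using this) a
  refine h.trans (le_of_eq ?_)
  have h1 : Matrix.mulVec (gram lam A 0)⁻¹ a = lam⁻¹ • a := by
    have : Matrix.mulVec (gram lam A 0) (lam⁻¹ • a) = a := by
      rw [gram_zero, Matrix.smul_mulVec, Matrix.one_mulVec, smul_smul,
        mul_inv_cancel₀ hlam.ne', one_smul]
    conv_lhs => rw [← this]
    exact posDef_inv_mulVec (gram_posDef hlam A 0) _
  rw [invNormSq, h1, dotProduct_smul, euclNorm_sq, smul_eq_mul]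
  field_simp

theorem gram_det_pos (t : ℕ) : 0 < (gram lam A t).det := (gram_posDef hlam A t).det_pos

theorem gram_det_succ (t : ℕ) :
    (gram lam A (t + 1)).det = (gram lam A t).det * (1 + invNormSq (gram lam A t) (A t)) := by
  rw [gram_succ, det_update (gram_posDef hlam A t)]

theorem log_gram_det_ratio (t : ℕ) :
    Real.log ((gram lam A t).det / (gram lam A 0).det)
      = ∑ s ∈ Finset.range t, Real.log (1 + invNormSq (gram lam A s) (A s)) := by
  induction t with
  | zero => simp [(gram_det_pos hlam A 0).ne']
  | succ t ih =>
    have hv := invNormSq_nonneg (gram_posDef hlam A t) (A t)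
    rw [Finset.sum_range_succ, ← ih, gram_det_succ hlam, mul_div_right_comm,
      Real.log_mul (div_pos (gram_det_pos hlam A t) (gram_det_pos hlam A 0)).ne' (by positivity)]

theorem log_gram_det_ratio_nonneg (t : ℕ) :
    0 ≤ Real.log ((gram lam A t).det / (gram lam A 0).det) := by
  rw [log_gram_det_ratio hlam]
  refine Finset.sum_nonneg fun s _ => Real.log_nonneg ?_
  linarith [invNormSq_nonneg (gram_posDef hlam A s) (A s)]

/-- The determinant is bounded through the trace (concavity of the logarithm of the eigenvalues);
`N` bounds the sum of the squared norms of the arms. The sharp form of the right-hand side is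
`d log (1 + N / (d λ))`. -/
theorem log_gram_det_ratio_le (hd : 0 < d) (t : ℕ) {N : ℝ} (hN : 0 ≤ N)
    (h : ∑ s ∈ Finset.range t, euclNorm (A s) ^ 2 ≤ N) :
    Real.log ((gram lam A t).det / (gram lam A 0).det) ≤ d * Real.log (1 + N / lam) := by
  have hP := gram_posDef hlam A t
  have hdet : (gram lam A t).det = ∏ i, hP.isHermitian.eigenvalues i := by
    simpa using hP.isHermitian.det_eq_prod_eigenvalues
  have htr : (gram lam A t).trace = ∑ i, hP.isHermitian.eigenvalues i := by
    simpa using hP.isHermitian.trace_eq_sum_eigenvalues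
  have htr' : (gram lam A t).trace ≤ d * lam + N := by
    have e : (gram lam A t).trace = d * lam + ∑ s ∈ Finset.range t, euclNorm (A s) ^ 2 := by
      simp [gram, Matrix.trace_add, Matrix.trace_sum, Matrix.trace_vecMulVec, euclNorm_sq,
        mul_comm]
    linarith
  have hpos : ∀ i, 0 < hP.isHermitian.eigenvalues i := fun i => hP.eigenvalues_pos i
  set c := lam + N with hc
  have hcpos : 0 < c := by positivity
  have hlog : ∀ i, Real.log (hP.isHermitian.eigenvalues i)
      ≤ hP.isHermitian.eigenvalues i / c - 1 + Real.log c := by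
    intro i
    have := Real.log_le_sub_one_of_pos (div_pos (hpos i) hcpos)
    rw [Real.log_div (hpos i).ne' hcpos.ne'] at this
    linarith
  have hsum : Real.log (gram lam A t).det ≤ d * Real.log c := by
    rw [hdet, Real.log_prod (fun i _ => (hpos i).ne')]
    refine (Finset.sum_le_sum fun i _ => hlog i).trans ?_
    rw [Finset.sum_add_distrib, Finset.sum_sub_distrib, ← Finset.sum_div, ← htr]
    have hd1 : (1 : ℝ) ≤ d := by exact_mod_cast hd
    have : (gram lam A t).trace / c ≤ d := by
      rw [div_le_iff₀ hcpos, hc]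
      nlinarith
    simp
    linarith
  rw [Real.log_div (gram_det_pos hlam A t).ne' (gram_det_pos hlam A 0).ne', gram_det_zero,
    Real.log_pow]
  have : Real.log (1 + N / lam) = Real.log c - Real.log lam := by
    rw [← Real.log_div hcpos.ne' hlam.ne', hc]
    congr 1; field_simp
  rw [this]
  linarith

end Gram

/-! ### Elliptical potentials -/

theorem min_one_div_two_le_log {v : ℝ} (hv : 0 ≤ v) : min 1 v / 2 ≤ Real.log (1 + v) := by
  have h := Real.one_sub_inv_le_log_of_pos (show 0 < 1 + v by linarith)
  refine le_trans ?_ h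
  have e : 1 - (1 + v)⁻¹ = v / (1 + v) := by field_simp; ring
  rw [e, le_div_iff₀ (by linarith)]
  rcases le_total v 1 with h1 | h1
  · rw [min_eq_right h1]; nlinarith
  · rw [min_eq_left h1]; linarith

theorem div_one_add_le_log {v : ℝ} (hv : 0 ≤ v) : v / (1 + v) ≤ Real.log (1 + v) := by
  have h := Real.one_sub_inv_le_log_of_pos (show 0 < 1 + v by linarith)
  refine le_trans (le_of_eq ?_) h
  field_simp; ring

theorem log_one_add_le_two_sqrt {z : ℝ} (hz : 0 ≤ z) : Real.log (1 + z) ≤ 2 * Real.sqrt z := by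
  have hs := Real.sqrt_nonneg z
  have h2 := Real.sq_sqrt hz
  have h1 : Real.log (1 + z) ≤ Real.log ((1 + Real.sqrt z) ^ 2) :=
    Real.log_le_log (by linarith) (by nlinarith)
  rw [Real.log_pow] at h1
  have h3 := Real.log_le_sub_one_of_pos (show 0 < 1 + Real.sqrt z by linarith)
  push_cast at h1
  linarith

section

variable {lam : ℝ} (hlam : 0 < lam) (A : ℕ → Vec d)
include hlam

theorem sum_div_one_add_le (n : ℕ) :
    ∑ s ∈ Finset.range n, invNormSq (gram lam A s) (A s) / (1 + invNormSq (gram lam A s) (A s))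
      ≤ Real.log ((gram lam A n).det / (gram lam A 0).det) := by
  rw [log_gram_det_ratio hlam]
  exact Finset.sum_le_sum fun s _ =>
    div_one_add_le_log (invNormSq_nonneg (gram_posDef hlam A s) (A s))

/-- The rounds in which the played arm has squared norm at least `ε` contribute to the elliptical
potential an amount that does not depend on the horizon: it is at most `2 d log (1 + N / λ)`, where
`N` is the number of these rounds, and since each of them contributes at least `ε`, this also
bounds `N`. -/
theorem sum_large_potential_le (hd : 0 < d) (hA : ∀ s, euclNorm (A s) ≤ 1) {ε : ℝ} (hε : 0 < ε)
    (hε1 : ε ≤ 1) (n : ℕ) :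
    ∑ s ∈ Finset.range n, (if ε ≤ invNormSq (gram lam A s) (A s)
        then min 1 (invNormSq (gram lam A s) (A s)) else 0)
      ≤ 4 * d * Real.log (1 + 4 * d / (ε * lam)) := by
  classical
  set v : ℕ → ℝ := fun s => invNormSq (gram lam A s) (A s) with hv
  -- the trajectory of the large rounds only; its Gram matrices are dominated by those of `A`
  set b : ℕ → Vec d := fun s => if ε ≤ v s then A s else 0 with hb
  set N : ℝ := ∑ s ∈ Finset.range n, (if ε ≤ v s then (1 : ℝ) else 0) with hN
  have hN0 : 0 ≤ N := Finset.sum_nonneg fun s _ => by split_ifs <;> norm_num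
  have hv0 : ∀ s, 0 ≤ v s := fun s => invNormSq_nonneg (gram_posDef hlam A s) (A s)
  have hdom : ∀ s (x : Vec d), x ⬝ᵥ Matrix.mulVec (gram lam b s) x
      ≤ x ⬝ᵥ Matrix.mulVec (gram lam A s) x := by
    intro s x
    rw [gram_quadForm, gram_quadForm]
    refine add_le_add le_rfl (Finset.sum_le_sum fun r _ => ?_)
    by_cases h : ε ≤ v r
    · simp [hb, h]
    · simpa [hb, h] using sq_nonneg (A r ⬝ᵥ x)
  have hterm : ∀ s, (if ε ≤ v s then min 1 (v s) else 0) / 2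
      ≤ Real.log (1 + invNormSq (gram lam b s) (b s)) := by
    intro s
    by_cases h : ε ≤ v s
    · have hbs : b s = A s := by simp [hb, h]
      rw [if_pos h, hbs]
      refine (min_one_div_two_le_log (hv0 s)).trans (Real.log_le_log (by linarith [hv0 s]) ?_)
      have := invNormSq_antitone (gram_posDef hlam A s) (gram_posDef hlam b s) (hdom s) (A s)
      linarith
    · rw [if_neg h, zero_div]
      exact Real.log_nonneg (by linarith [invNormSq_nonneg (gram_posDef hlam b s) (b s)])
  have hdet : Real.log ((gram lam b n).det / (gram lam b 0).det) ≤ d * Real.log (1 + N / lam) := by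
    refine log_gram_det_ratio_le hlam b hd n hN0 (Finset.sum_le_sum fun s _ => ?_)
    by_cases h : ε ≤ v s
    · simp only [hb, h, if_true]
      have := hA s
      have := euclNorm_nonneg (A s)
      nlinarith
    · simp [hb, h, euclNorm]
  have hsum : ∑ s ∈ Finset.range n, (if ε ≤ v s then min 1 (v s) else 0)
      ≤ 2 * (d * Real.log (1 + N / lam)) := by
    rw [log_gram_det_ratio hlam] at hdet
    have := (Finset.sum_le_sum fun s (_ : s ∈ Finset.range n) => hterm s).trans hdet
    rw [← Finset.sum_div] at this
    linarith
  have hcount : ε * N ≤ ∑ s ∈ Finset.range n, (if ε ≤ v s then min 1 (v s) else 0) := by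
    rw [hN, Finset.mul_sum]
    refine Finset.sum_le_sum fun s _ => ?_
    split_ifs with h
    · rw [mul_one]; exact le_min hε1 h
    · simp
  have hd' : (0 : ℝ) < d := by exact_mod_cast hd
  -- `ε N ≤ 2 d log (1 + N / λ) ≤ 4 d √(N / λ)` is solved for `N`
  have hNle : N / lam ≤ (4 * d / (ε * lam)) ^ 2 := by
    have h1 : ε * N ≤ 4 * d * Real.sqrt (N / lam) := by
      have := log_one_add_le_two_sqrt (div_nonneg hN0 hlam.le)
      have h2 := hcount.trans hsum
      nlinarith
    set r := Real.sqrt (N / lam) with hr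
    have hr0 : 0 ≤ r := Real.sqrt_nonneg _
    have hr2 : r ^ 2 = N / lam := Real.sq_sqrt (div_nonneg hN0 hlam.le)
    have hN' : N = lam * r ^ 2 := by rw [hr2]; field_simp
    rw [← hr2]
    have h3 : r ≤ 4 * d / (ε * lam) := by
      rw [le_div_iff₀ (by positivity)]
      rcases hr0.eq_or_lt with h0 | h0
      · rw [← h0]; simp
      · rw [hN'] at h1
        have : (r * (ε * lam)) * r ≤ (4 * d) * r := by nlinarith
        exact le_of_mul_le_mul_right this h0
    gcongr
  have hlog : Real.log (1 + N / lam) ≤ 2 * Real.log (1 + 4 * d / (ε * lam)) := by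
    have hz : 0 ≤ 4 * d / (ε * lam) := by positivity
    have : Real.log (1 + N / lam) ≤ Real.log ((1 + 4 * d / (ε * lam)) ^ 2) :=
      Real.log_le_log (by have := div_nonneg hN0 hlam.le; linarith) (by nlinarith)
    rw [Real.log_pow] at this
    exact_mod_cast this
  refine hsum.trans ?_
  nlinarith

end

/-! ### The sampling distribution -/

section Tilted

variable {arms : Finset (Vec d)} {q f : Vec d → ℝ} {α : ℝ} {ahat : Vec d}

/-- The normalization of the tilted distribution lies in `[α, 1]`, where `α` is the mass of the
empirical best arm. -/
theorem tilted_denominator_mem (hq : ∀ a ∈ arms, 0 ≤ q a) (hq1 : ∑ a ∈ arms, q a = 1)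
    (hf : ∀ a, 0 < f a) (hf1 : ∀ a, f a ≤ 1) (hmem : ahat ∈ arms) (hα : α ≤ q ahat)
    (hfa : f ahat = 1) :
    α ≤ ∑ b ∈ arms, q b * f b ∧ ∑ b ∈ arms, q b * f b ≤ 1 := by
  constructor
  · calc α ≤ q ahat * f ahat := by rw [hfa, mul_one]; exact hα
      _ ≤ _ := Finset.single_le_sum (f := fun b => q b * f b)
          (fun b hb => mul_nonneg (hq b hb) (hf b).le) hmem
  · rw [← hq1]
    exact Finset.sum_le_sum fun b hb => mul_le_of_le_one_right (hq b hb) (hf1 b)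

theorem mul_le_tilted (hq : ∀ a ∈ arms, 0 ≤ q a) (hf : ∀ a, 0 < f a) (hα0 : 0 < α)
    (h : α ≤ ∑ b ∈ arms, q b * f b ∧ ∑ b ∈ arms, q b * f b ≤ 1) {a : Vec d} (ha : a ∈ arms) :
    q a * f a ≤ tilted arms q f a := by
  rw [tilted, le_div_iff₀ (hα0.trans_le h.1)]
  exact mul_le_of_le_one_right (mul_nonneg (hq a ha) (hf a).le) h.2

theorem tilted_le_div (hq : ∀ a ∈ arms, 0 ≤ q a) (hf : ∀ a, 0 < f a) (hα0 : 0 < α)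
    (h : α ≤ ∑ b ∈ arms, q b * f b ∧ ∑ b ∈ arms, q b * f b ≤ 1) {a : Vec d} (ha : a ∈ arms) :
    tilted arms q f a ≤ q a * f a / α := by
  rw [tilted]
  exact div_le_div_of_nonneg_left (mul_nonneg (hq a ha) (hf a).le) hα0 h.1

theorem sum_tilted (hα0 : 0 < α)
    (h : α ≤ ∑ b ∈ arms, q b * f b ∧ ∑ b ∈ arms, q b * f b ≤ 1) :
    ∑ a ∈ arms, tilted arms q f a = 1 := by
  unfold tilted
  rw [← Finset.sum_div, div_self (hα0.trans_le h.1).ne']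

end Tilted

theorem sum_mixture {αopt αemp : ℝ} {arms : Finset (Vec d)} {qopt : Vec d → ℝ} {ahat : Vec d}
    (hmem : ahat ∈ arms) (hq1 : ∑ a ∈ arms, qopt a = 1) :
    ∑ a ∈ arms, mixture αopt αemp arms qopt ahat a = 1 := by
  classical
  have hc : (arms.card : ℝ) ≠ 0 := by
    simpa using Finset.ne_empty_of_mem hmem
  simp only [mixture, Finset.sum_add_distrib, ← Finset.mul_sum, hq1]
  rw [Finset.sum_ite_eq' arms ahat]
  simp only [hmem, if_true, Finset.sum_const, nsmul_eq_mul]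
  field_simp
  ring

theorem mixture_ge {αopt αemp : ℝ} (hαo : 0 ≤ αopt) (hαe : 0 ≤ αemp) (hα : αopt + αemp ≤ 1)
    {arms : Finset (Vec d)} {qopt : Vec d → ℝ} (ahat : Vec d) {a : Vec d} (hq : 0 ≤ qopt a) :
    αopt * qopt a ≤ mixture αopt αemp arms qopt ahat a ∧
      (a = ahat → αemp ≤ mixture αopt αemp arms qopt ahat a) := by
  have h3 : 0 ≤ (1 - αopt - αemp) * (1 / (arms.card : ℝ)) := by
    have : 0 ≤ 1 - αopt - αemp := by linarith
    positivity
  have h1 := mul_nonneg hαo hq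
  unfold mixture
  constructor
  · split_ifs <;> linarith
  · intro h
    rw [if_pos h]; linarith

/-! ### The weights -/

section Weight

variable {lam σ S : ℝ} {A : ℕ → Vec d} {Y : ℕ → ℝ} {t : ℕ}

theorem weight_pos (ahat a : Vec d) : 0 < weight lam σ S A Y t ahat a := Real.exp_pos _

theorem weight_self (ahat : Vec d) : weight lam σ S A Y t ahat ahat = 1 := by
  simp [weight]

theorem radius_nonneg : 0 ≤ radius lam σ S A t := sq_nonneg _

theorem weight_le_one (hlam : 0 < lam) (ahat a : Vec d) : weight lam σ S A Y t ahat a ≤ 1 := by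
  rw [weight, Real.exp_le_one_iff, neg_nonpos]
  have := invNormSq_nonneg (gram_posDef hlam A t) (ahat - a)
  have := radius_nonneg (lam := lam) (σ := σ) (S := S) (A := A) (t := t)
  positivity

theorem log_inv_failureRate_nonneg (t : ℕ) : 0 ≤ Real.log (1 / failureRate t) := by
  rw [failureRate, one_div_one_div]
  exact Real.log_nonneg (by have : (0 : ℝ) ≤ t := t.cast_nonneg; linarith)

theorem mul_sq_le_radius (hlam : 0 ≤ lam) (hσ : 0 ≤ σ) (hS : 0 ≤ S) :
    lam * S ^ 2 ≤ radius lam σ S A t := by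
  have h1 : 0 ≤ Real.sqrt lam * S := by positivity
  have h2 : lam * S ^ 2 = (Real.sqrt lam * S) ^ 2 := by rw [mul_pow, Real.sq_sqrt hlam]
  rw [h2, radius]
  gcongr
  have : 0 ≤ σ * Real.sqrt (Real.log ((gram lam A t).det / (gram lam A 0).det)
      + 2 * Real.log (1 / failureRate t)) := by positivity
  linarith

theorem radius_pos (hlam : 0 < lam) (hσ : 0 ≤ σ) (hS : 0 < S) : 0 < radius lam σ S A t :=
  lt_of_lt_of_le (by positivity) (mul_sq_le_radius hlam.le hσ hS.le)

end Weight

/-! ### The error of the ridge estimator -/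

/-- The noise-weighted sum of the first `t` played arms, `∑ η_s A_s`. -/
noncomputable def noiseSum (θ : Vec d) (A : ℕ → Vec d) (Y : ℕ → ℝ) (t : ℕ) : Vec d :=
  ∑ s ∈ Finset.range t, (Y s - θ ⬝ᵥ A s) • A s

/-- The squared error `‖θ̂_t - θ‖²_{V_t}`, written as `‖∑ η_s A_s - λ θ‖²_{V_t⁻¹}`. -/
noncomputable def estError (lam : ℝ) (θ : Vec d) (A : ℕ → Vec d) (Y : ℕ → ℝ) (t : ℕ) : ℝ :=
  invNormSq (gram lam A t) (noiseSum θ A Y t - lam • θ)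

section Ridge

variable {lam : ℝ} (hlam : 0 < lam) (θ : Vec d) (A : ℕ → Vec d) (Y : ℕ → ℝ) (t : ℕ)

theorem gram_mulVec (x : Vec d) :
    Matrix.mulVec (gram lam A t) x = lam • x + ∑ s ∈ Finset.range t, (A s ⬝ᵥ x) • A s := by
  induction t with
  | zero => simp [gram_zero, Matrix.smul_mulVec]
  | succ t ih => rw [gram_succ, add_vecMulVec_mulVec, ih, Finset.sum_range_succ, add_assoc]

include hlam

theorem ridge_sub_eq :
    ridge lam A Y t - θ = Matrix.mulVec (gram lam A t)⁻¹ (noiseSum θ A Y t - lam • θ) := by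
  have hP := gram_posDef hlam A t
  have e : noiseSum θ A Y t - lam • θ
      = (∑ s ∈ Finset.range t, Y s • A s) - Matrix.mulVec (gram lam A t) θ := by
    rw [gram_mulVec, noiseSum]
    simp only [sub_smul, Finset.sum_sub_distrib, dotProduct_comm θ]
    abel
  rw [e, Matrix.mulVec_sub, posDef_inv_mulVec hP, ridge]

theorem estError_nonneg : 0 ≤ estError lam θ A Y t := invNormSq_nonneg (gram_posDef hlam A t) _

theorem sq_predError_le (a : Vec d) :
    ((θ - ridge lam A Y t) ⬝ᵥ a) ^ 2 ≤ estError lam θ A Y t * invNormSq (gram lam A t) a := by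
  have h := inv_cauchySchwarz (gram_posDef hlam A t) a (noiseSum θ A Y t - lam • θ)
  rw [← ridge_sub_eq hlam] at h
  have e : ((θ - ridge lam A Y t) ⬝ᵥ a) ^ 2 = (a ⬝ᵥ (ridge lam A Y t - θ)) ^ 2 := by
    rw [dotProduct_comm, ← neg_sub θ, dotProduct_neg, neg_sq]
  rw [e, mul_comm]
  exact h

/-- One step of the recursion for the error: with the prediction error `e = ⟨θ - θ̂_t, A_t⟩`, the
noise `η` and the leverage `v = ‖A_t‖²_{V_t⁻¹}`, the error changes by
`(-e² - 2 η e + η² v) / (1 + v)`. -/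
theorem estError_succ :
    estError lam θ A Y (t + 1) = estError lam θ A Y t
      - ((θ - ridge lam A Y t) ⬝ᵥ A t) ^ 2 / (1 + invNormSq (gram lam A t) (A t))
      - 2 * (Y t - θ ⬝ᵥ A t) * ((θ - ridge lam A Y t) ⬝ᵥ A t)
          / (1 + invNormSq (gram lam A t) (A t))
      + (Y t - θ ⬝ᵥ A t) ^ 2 * invNormSq (gram lam A t) (A t)
          / (1 + invNormSq (gram lam A t) (A t)) := by
  have hP := gram_posDef hlam A t
  have e : noiseSum θ A Y (t + 1) - lam • θ
      = (noiseSum θ A Y t - lam • θ) + (Y t - θ ⬝ᵥ A t) • A t := by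
    rw [noiseSum, Finset.sum_range_succ, ← noiseSum]; abel
  have h2 : A t ⬝ᵥ Matrix.mulVec (gram lam A t)⁻¹ (noiseSum θ A Y t - lam • θ)
      = -((θ - ridge lam A Y t) ⬝ᵥ A t) := by
    rw [← ridge_sub_eq hlam, dotProduct_comm, ← neg_sub θ, neg_dotProduct]
  rw [estError, gram_succ, e, invNormSq_update hP, h2, ← estError]
  ring

end Ridge

/-! ### Empirical gaps of the played arms -/

/-- `x ↦ x e^{-x}` decreases on `[1, ∞)`. -/
theorem mul_exp_neg_le {L x : ℝ} (hL : 1 ≤ L) (hx : L ≤ x) :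
    x * Real.exp (-x) ≤ L * Real.exp (-L) := by
  have h := Real.add_one_le_exp (x - L)
  have e : Real.exp (-L) = Real.exp (x - L) * Real.exp (-x) := by
    rw [← Real.exp_add]; congr 1; ring
  rw [e, ← mul_assoc]
  gcongr
  nlinarith [mul_nonneg (sub_nonneg.2 hL) (sub_nonneg.2 hx)]

/-- The part of the squared norm of an arm that counts only when it is at least `ε`. -/
noncomputable def largeNormSq (V : Matrix (Fin d) (Fin d) ℝ) (ε : ℝ) (a : Vec d) : ℝ :=
  if ε ≤ invNormSq V a then invNormSq V a else 0

theorem largeNormSq_nonneg {V : Matrix (Fin d) (Fin d) ℝ} (hV : V.PosDef) (ε : ℝ) (a : Vec d) :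
    0 ≤ largeNormSq V ε a := by
  unfold largeNormSq
  split_ifs
  · exact invNormSq_nonneg hV a
  · exact le_rfl

/-- An arm with empirical gap `g ≥ Δ/2` and weight `exp (-x)`, `x = g² / (β y)`, where
`y = ‖â - a‖²`. If `x > L`, the weight makes `g² e^{-x} = β y x e^{-x}` negligible; if `x ≤ L`, then
`g² ≤ β L y`, and `y` is at least `Δ² / (4 β L)`, so that `â` or `a` has a large norm. -/
theorem mul_sq_empGap_le {V : Matrix (Fin d) (Fin d) ℝ} (hV : V.PosDef) {ahat a : Vec d}
    {g β L Δ α p q : ℝ} (hβ : 0 < β) (hL : 1 ≤ L) (hΔ : 0 < Δ) (hα : 0 < α) (hp : 0 ≤ p)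
    (hq : 0 ≤ q) (hg : Δ / 2 ≤ g)
    (hpq : p ≤ q * Real.exp (-(g ^ 2 / (β * invNormSq V (ahat - a)))) / α)
    (hva : invNormSq V a ≤ 1) (hvh : invNormSq V ahat ≤ 1) (hne : ahat ≠ a) :
    p * g ^ 2 ≤ q * (4 * β * L * Real.exp (-L) / α)
      + 4 * β * L * (p * (largeNormSq V (Δ ^ 2 / (16 * β * L)) a
          + largeNormSq V (Δ ^ 2 / (16 * β * L)) ahat)) := by
  set ε := Δ ^ 2 / (16 * β * L) with hε
  set y := invNormSq V (ahat - a) with hy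
  have hy0 : 0 < y := invNormSq_pos hV (sub_ne_zero.2 hne)
  have hy2 : y ≤ 2 * (invNormSq V ahat + invNormSq V a) := invNormSq_sub_le hV _ _
  have hla := largeNormSq_nonneg hV ε a
  have hlh := largeNormSq_nonneg hV ε ahat
  have hL0 : 0 < L := by linarith
  set x := g ^ 2 / (β * y) with hx
  have hgx : g ^ 2 = β * y * x := by rw [hx]; field_simp
  rcases le_total L x with h | h
  · have h1 : p * g ^ 2 ≤ q * (4 * β * L * Real.exp (-L) / α) := by
      calc p * g ^ 2 ≤ (q * Real.exp (-x) / α) * g ^ 2 := by gcongr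
        _ = q * (β * y * (x * Real.exp (-x)) / α) := by rw [hgx]; ring
        _ ≤ q * (β * 4 * (L * Real.exp (-L)) / α) := by
            have := mul_exp_neg_le hL h
            have hx0 : 0 ≤ x := hL0.le.trans h
            gcongr
            linarith
        _ = _ := by ring
    have h2 : 0 ≤ 4 * β * L * (p * (largeNormSq V ε a + largeNormSq V ε ahat)) := by positivity
    linarith
  · have hgy : g ^ 2 ≤ β * y * L := by rw [hgx]; gcongr
    have hye : 4 * ε ≤ y := by
      have : Δ ^ 2 / 4 ≤ β * y * L := by nlinarith
      rw [hε, mul_div_assoc', div_le_iff₀ (by positivity)]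
      nlinarith
    have hyl : y ≤ 4 * (largeNormSq V ε a + largeNormSq V ε ahat) := by
      rcases le_total (invNormSq V a) (invNormSq V ahat) with h1 | h1
      · have : largeNormSq V ε ahat = invNormSq V ahat := by
          rw [largeNormSq, if_pos (by linarith)]
        linarith
      · have : largeNormSq V ε a = invNormSq V a := by
          rw [largeNormSq, if_pos (by linarith)]
        linarith
    have h1 : 0 ≤ q * (4 * β * L * Real.exp (-L) / α) := by positivity
    have h2 : p * g ^ 2 ≤ 4 * β * L * (p * (largeNormSq V ε a + largeNormSq V ε ahat)) := by
      calc p * g ^ 2 ≤ p * (β * y * L) := by gcongr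
        _ ≤ p * (β * (4 * (largeNormSq V ε a + largeNormSq V ε ahat)) * L) := by gcongr
        _ = _ := by ring
    linarith

/-! ### The regret of one round -/

section Round

variable {lam σ S αopt αemp Copt csupp : ℝ} {ksupp : ℕ} {design : Finset (Vec d) → Vec d → ℝ}
  {arms : Finset (Vec d)} {A : ℕ → Vec d} {Y : ℕ → ℝ} {t : ℕ} {ahat : Vec d} {qopt : Vec d → ℝ}

/-- Under the design, every squared prediction is controlled by the average squared prediction. -/
theorem sq_dotProduct_le_of_invNormSqLe {𝓑 : Finset (Vec d)} {q : Vec d → ℝ}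
    (hq : ∀ b ∈ 𝓑, 0 ≤ q b) {b : Vec d} {c : ℝ} (h : InvNormSqLe (designMatrix 𝓑 q) b c)
    (x : Vec d) : (b ⬝ᵥ x) ^ 2 ≤ c * ∑ b' ∈ 𝓑, q b' * (b' ⬝ᵥ x) ^ 2 := by
  obtain ⟨y, rfl, hy⟩ := h
  have hb : ∀ x, Matrix.mulVec (designMatrix 𝓑 q) y ⬝ᵥ x
      = ∑ b' ∈ 𝓑, q b' * ((b' ⬝ᵥ y) * (b' ⬝ᵥ x)) := by
    intro x
    rw [designMatrix, Matrix.sum_mulVec, sum_dotProduct]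
    refine Finset.sum_congr rfl fun b _ => ?_
    rw [Matrix.smul_mulVec, Matrix.vecMulVec_mulVec]
    simp only [op_smul_eq_smul, smul_dotProduct, smul_eq_mul]
  have hcs : (∑ b' ∈ 𝓑, q b' * ((b' ⬝ᵥ y) * (b' ⬝ᵥ x))) ^ 2
      ≤ (∑ b' ∈ 𝓑, q b' * (b' ⬝ᵥ y) ^ 2) * ∑ b' ∈ 𝓑, q b' * (b' ⬝ᵥ x) ^ 2 := by
    refine Finset.sum_sq_le_sum_mul_sum_of_sq_le_mul 𝓑
      (fun i hi => mul_nonneg (hq i hi) (sq_nonneg _))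
      (fun i hi => mul_nonneg (hq i hi) (sq_nonneg _)) (fun i _ => le_of_eq (by ring))
  rw [hb x]
  refine hcs.trans ?_
  rw [hb y] at hy
  refine mul_le_mul_of_nonneg_right ?_
    (Finset.sum_nonneg fun i hi => mul_nonneg (hq i hi) (sq_nonneg _))
  simpa [sq] using hy

open scoped Classical in
/-- The conditions on the design part of the sampling distribution in one round. -/
structure IsRoundDesign (lam σ S : ℝ) (design : Finset (Vec d) → Vec d → ℝ)
    (arms : Finset (Vec d)) (A : ℕ → Vec d) (Y : ℕ → ℝ) (t : ℕ) (ahat : Vec d)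
    (qopt : Vec d → ℝ) : Prop where
  nonneg : ∀ a ∈ arms, 0 ≤ qopt a
  eq_design : ∀ b ∈ arms.image (rescaled lam σ S A Y t ahat),
    ∑ a ∈ arms.filter (fun a => rescaled lam σ S A Y t ahat a = b), qopt a
      = design (arms.image (rescaled lam σ S A Y t ahat)) b

theorem IsRoundDesign.sum_eq_one (h : IsRoundDesign lam σ S design arms A Y t ahat qopt)
    (hD : IsDesignOracle Copt csupp ksupp design) (hne : arms.Nonempty) :
    ∑ a ∈ arms, qopt a = 1 := by
  classical
  rw [← hD.sum_eq_one _ (hne.image (rescaled lam σ S A Y t ahat)),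
    ← Finset.sum_fiberwise_of_maps_to (g := rescaled lam σ S A Y t ahat)
      (fun a ha => Finset.mem_image_of_mem _ ha)]
  exact Finset.sum_congr rfl fun b hb => h.eq_design b hb

/-- The optimality of the design on the rescaled arms, stated for the original arms. -/
theorem IsRoundDesign.weight_mul_sq_le (h : IsRoundDesign lam σ S design arms A Y t ahat qopt)
    (hD : IsDesignOracle Copt csupp ksupp design) {a : Vec d} (ha : a ∈ arms) (x : Vec d) :
    weight lam σ S A Y t ahat a * (x ⬝ᵥ a) ^ 2 ≤ (Copt * d * Real.log d)
      * ∑ b ∈ arms, qopt b * weight lam σ S A Y t ahat b * (x ⬝ᵥ b) ^ 2 := by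
  classical
  have hne : arms.Nonempty := ⟨a, ha⟩
  set φ := rescaled lam σ S A Y t ahat with hφ
  have hsq : ∀ b, (φ b ⬝ᵥ x) ^ 2 = weight lam σ S A Y t ahat b * (x ⬝ᵥ b) ^ 2 := by
    intro b
    rw [hφ, rescaled, smul_dotProduct, smul_eq_mul, mul_pow, Real.sq_sqrt (weight_pos _ _).le,
      dotProduct_comm]
  have h1 := sq_dotProduct_le_of_invNormSqLe (hD.nonneg _ (hne.image φ))
    (hD.optimal _ (hne.image φ) (φ a) (Finset.mem_image_of_mem _ ha)) x
  rw [hsq] at h1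
  refine h1.trans (le_of_eq ?_)
  congr 1
  rw [← Finset.sum_fiberwise_of_maps_to (s := arms) (t := arms.image φ) (g := φ)
      (fun a ha => Finset.mem_image_of_mem _ ha)]
  refine Finset.sum_congr rfl fun b hb => ?_
  rw [← h.eq_design b hb, Finset.sum_mul]
  refine Finset.sum_congr rfl fun c hc => ?_
  rw [← (Finset.mem_filter.1 hc).2, hsq]
  ring

/-- The weight of an optimal arm is small only if the estimator is far from `θ`. -/
theorem inv_weight_best_le (hlam : 0 < lam) (hσ : 0 ≤ σ) (hS : 0 < S) {θ astar : Vec d}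
    (hbest : θ ⬝ᵥ ahat ≤ θ ⬝ᵥ astar)
    (hmax : ridge lam A Y t ⬝ᵥ astar ≤ ridge lam A Y t ⬝ᵥ ahat) :
    1 ≤ Real.exp (estError lam θ A Y t / radius lam σ S A t)
      * weight lam σ S A Y t ahat astar := by
  have hr : 0 < radius lam σ S A t := radius_pos hlam hσ hS
  have hU := estError_nonneg hlam θ A Y t
  rw [weight, ← Real.exp_add, Real.one_le_exp_iff, ← sub_eq_add_neg, sub_nonneg]
  have hy := invNormSq_nonneg (gram_posDef hlam A t) (ahat - astar)
  rcases hy.eq_or_lt with h0 | h0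
  · rw [← h0, mul_zero, div_zero]; positivity
  rw [div_le_div_iff₀ (by positivity) hr]
  have h1 := sq_predError_le hlam θ A Y t (ahat - astar)
  have h2 : (ridge lam A Y t ⬝ᵥ (ahat - astar)) ^ 2
      ≤ ((θ - ridge lam A Y t) ⬝ᵥ (ahat - astar)) ^ 2 := by
    rw [sub_dotProduct]
    simp only [dotProduct_sub]
    nlinarith
  nlinarith

/-- A positive gap at least `Δ` is either at most twice the empirical gap, or it is explained by
the prediction errors of the arm and of the optimal arm. -/
theorem gap_le_sq {θ th ahat astar a : Vec d} {Δ : ℝ} (hΔ : 0 < Δ)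
    (hgap : Δ ≤ θ ⬝ᵥ astar - θ ⬝ᵥ a) (hmax : th ⬝ᵥ astar ≤ th ⬝ᵥ ahat) :
    (Δ / 2 ≤ th ⬝ᵥ (ahat - a) ∧
        θ ⬝ᵥ astar - θ ⬝ᵥ a ≤ 4 / Δ * (th ⬝ᵥ (ahat - a)) ^ 2) ∨
      θ ⬝ᵥ astar - θ ⬝ᵥ a
        ≤ 8 / Δ * (((θ - th) ⬝ᵥ astar) ^ 2 + ((θ - th) ⬝ᵥ a) ^ 2) := by
  simp only [dotProduct_sub, sub_dotProduct]
  set g := θ ⬝ᵥ astar - θ ⬝ᵥ a with hg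
  rcases le_total (g / 2) (th ⬝ᵥ ahat - th ⬝ᵥ a) with h | h
  · left
    refine ⟨by linarith, ?_⟩
    rw [div_mul_eq_mul_div, le_div_iff₀ hΔ]
    nlinarith
  · right
    rw [div_mul_eq_mul_div, le_div_iff₀ hΔ]
    have h1 : g ≤ 2 * ((θ ⬝ᵥ astar - th ⬝ᵥ astar) - (θ ⬝ᵥ a - th ⬝ᵥ a)) := by linarith
    nlinarith [sq_nonneg ((θ ⬝ᵥ astar - th ⬝ᵥ astar) + (θ ⬝ᵥ a - th ⬝ᵥ a))]

/-- Expected regret of a round without underexplored arms. The first summand comes from arms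
whose gap is visible in the estimates, the second one from estimation errors; the design controls
the error at the optimal arm by the average error of the sampled arm, unless the estimator is
outside of the confidence set. -/
theorem round_regret_le (hlam : 0 < lam) (hσ : 0 ≤ σ) (hS : 0 < S) (hαo : 0 < αopt)
    (hαe : 0 < αemp) (hα : αopt + αemp ≤ 1) (hD : IsDesignOracle Copt csupp ksupp design)
    (hq : IsRoundDesign lam σ S design arms A Y t ahat qopt) (hmem : ahat ∈ arms)
    (hmax : ∀ a ∈ arms, ridge lam A Y t ⬝ᵥ a ≤ ridge lam A Y t ⬝ᵥ ahat)
    (hv : ∀ a ∈ arms, invNormSq (gram lam A t) a ≤ 1) {θ astar : Vec d} (hstar : astar ∈ arms)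
    (hbest : ∀ a ∈ arms, θ ⬝ᵥ a ≤ θ ⬝ᵥ astar) {Δ : ℝ} (hΔ : 0 < Δ)
    (hgap : ∀ a ∈ arms, 0 < θ ⬝ᵥ astar - θ ⬝ᵥ a → Δ ≤ θ ⬝ᵥ astar - θ ⬝ᵥ a) {L : ℝ} (hL : 1 ≤ L)
    {β : ℝ} (hβ : radius lam σ S A t ≤ β) (r : ℝ) {p : Vec d → ℝ}
    (hp : p = tilted arms (mixture αopt αemp arms qopt ahat) (weight lam σ S A Y t ahat)) :
    ∑ a ∈ arms, p a * (θ ⬝ᵥ astar - θ ⬝ᵥ a)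
      ≤ 16 * β * L / (Δ * αemp) * (Real.exp (-L)
          + 2 * ∑ a ∈ arms, p a * largeNormSq (gram lam A t) (Δ ^ 2 / (16 * β * L)) a)
        + 8 / Δ * ((|Copt| * d * Real.log d / αopt + 1)
          * ∑ a ∈ arms, p a * (if estError lam θ A Y t ≤ r then
            Real.exp (r / radius lam σ S A t) * ((θ - ridge lam A Y t) ⬝ᵥ a) ^ 2 else 0))
        + 16 / Δ * (if estError lam θ A Y t ≤ r then 0 else estError lam θ A Y t) := by
  classical
  set V := gram lam A t with hVdef
  have hV : V.PosDef := gram_posDef hlam A t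
  set q := mixture αopt αemp arms qopt ahat with hqdef
  set f := weight lam σ S A Y t ahat with hfdef
  set th := ridge lam A Y t with hth
  set U := estError lam θ A Y t with hU
  set ε := Δ ^ 2 / (16 * β * L) with hε
  have hr0 : 0 < radius lam σ S A t := radius_pos hlam hσ hS
  have hβ0 : 0 < β := hr0.trans_le hβ
  have hL0 : 0 < L := by linarith
  have hαo' := hαo.le
  have hq_ge : ∀ a ∈ arms, αopt * qopt a ≤ q a := fun a ha =>
    (mixture_ge hαo.le hαe.le hα ahat (hq.nonneg a ha)).1
  have hq0 : ∀ a ∈ arms, 0 ≤ q a := fun a ha =>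
    (mul_nonneg hαo.le (hq.nonneg a ha)).trans (hq_ge a ha)
  have hq1 : ∑ a ∈ arms, q a = 1 := sum_mixture hmem (hq.sum_eq_one hD ⟨ahat, hmem⟩)
  have hqhat : αemp ≤ q ahat := (mixture_ge hαo.le hαe.le hα ahat (hq.nonneg _ hmem)).2 rfl
  have hden := tilted_denominator_mem hq0 hq1 (fun a => weight_pos (lam := lam) (σ := σ) (S := S)
    (A := A) (Y := Y) (t := t) ahat a) (fun a => weight_le_one hlam ahat a) hmem hqhat
    (weight_self ahat)
  have hf0 : ∀ a, 0 < f a := fun a => weight_pos ahat a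
  have hpge : ∀ a ∈ arms, q a * f a ≤ p a := fun a ha => by
    rw [hp]; exact mul_le_tilted hq0 hf0 hαe hden ha
  have hple : ∀ a ∈ arms, p a ≤ q a * f a / αemp := fun a ha => by
    rw [hp]; exact tilted_le_div hq0 hf0 hαe hden ha
  have hp0 : ∀ a ∈ arms, 0 ≤ p a := fun a ha =>
    (mul_nonneg (hq0 a ha) (hf0 a).le).trans (hpge a ha)
  have hp1 : ∑ a ∈ arms, p a = 1 := by rw [hp]; exact sum_tilted hαe hden
  have hphat : αemp ≤ p ahat := by
    have := hpge ahat hmem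
    rw [hfdef, weight_self, mul_one] at this
    linarith
  have hl0 : ∀ a, 0 ≤ largeNormSq V ε a := fun a => largeNormSq_nonneg hV ε a
  set W := ∑ a ∈ arms, p a * largeNormSq V ε a with hW
  -- the empirical best arm has mass at least `αemp`, so its norm is seen in the average `W`
  have hlhat : largeNormSq V ε ahat ≤ W / αemp := by
    rw [le_div_iff₀ hαe]
    calc largeNormSq V ε ahat * αemp ≤ largeNormSq V ε ahat * p ahat := by
          gcongr; exact hl0 _
      _ = p ahat * largeNormSq V ε ahat := mul_comm _ _
      _ ≤ W := Finset.single_le_sum (f := fun a => p a * largeNormSq V ε a)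
          (fun b hb => mul_nonneg (hp0 b hb) (hl0 b)) hmem
  set e : Vec d → ℝ := fun a => (θ - th) ⬝ᵥ a with he
  set Q := ∑ a ∈ arms, p a * e a ^ 2 with hQ
  have hQ0 : 0 ≤ Q := Finset.sum_nonneg fun a ha => mul_nonneg (hp0 a ha) (sq_nonneg _)
  have hterm : ∀ a ∈ arms, p a * (θ ⬝ᵥ astar - θ ⬝ᵥ a)
      ≤ 4 / Δ * (q a * (4 * β * L * Real.exp (-L) / αemp)
          + 4 * β * L * (p a * (largeNormSq V ε a + largeNormSq V ε ahat)))
        + 8 / Δ * (p a * (e astar ^ 2 + e a ^ 2)) := by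
    intro a ha
    have hA1 : 0 ≤ q a * (4 * β * L * Real.exp (-L) / αemp) := by
      have := hq0 a ha; positivity
    have hA2 : 0 ≤ 4 * β * L * (p a * (largeNormSq V ε a + largeNormSq V ε ahat)) := by
      have := hp0 a ha; have := hl0 a; have := hl0 ahat; positivity
    have hA3 : 0 ≤ p a * (e astar ^ 2 + e a ^ 2) := by have := hp0 a ha; positivity
    have hA12 : 0 ≤ 4 / Δ * (q a * (4 * β * L * Real.exp (-L) / αemp)
          + 4 * β * L * (p a * (largeNormSq V ε a + largeNormSq V ε ahat))) := by positivity
    have hA3' : 0 ≤ 8 / Δ * (p a * (e astar ^ 2 + e a ^ 2)) := by positivity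
    rcases (sub_nonneg.2 (hbest a ha)).eq_or_lt with h0 | h0
    · rw [← h0, mul_zero]; linarith
    rcases gap_le_sq hΔ (hgap a ha h0) (hmax astar hstar) with ⟨h1, h2⟩ | h1
    · have hne : ahat ≠ a := by
        rintro rfl
        simp only [sub_self, dotProduct_zero] at h1
        linarith
      have hple' : p a ≤ q a * Real.exp (-((th ⬝ᵥ (ahat - a)) ^ 2
          / (β * invNormSq V (ahat - a)))) / αemp := by
        refine (hple a ha).trans ?_
        have := hq0 a ha
        have hy := invNormSq_pos hV (sub_ne_zero.2 hne)
        rw [hfdef, weight]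
        gcongr
      have h3 := mul_sq_empGap_le hV hβ0 hL hΔ hαe (hp0 a ha) (hq0 a ha) h1 hple' (hv a ha)
        (hv _ hmem) hne
      have h4 : p a * (θ ⬝ᵥ astar - θ ⬝ᵥ a) ≤ 4 / Δ * (p a * (th ⬝ᵥ (ahat - a)) ^ 2) := by
        have := mul_le_mul_of_nonneg_left h2 (hp0 a ha)
        linarith
      have h5 := mul_le_mul_of_nonneg_left h3 (show 0 ≤ 4 / Δ by positivity)
      linarith
    · have := mul_le_mul_of_nonneg_left h1 (hp0 a ha)
      linarith
  have hsum : ∑ a ∈ arms, p a * (θ ⬝ᵥ astar - θ ⬝ᵥ a)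
      ≤ 4 / Δ * (4 * β * L * Real.exp (-L) / αemp + 4 * β * L * (W + largeNormSq V ε ahat))
        + 8 / Δ * (e astar ^ 2 + Q) := by
    refine (Finset.sum_le_sum hterm).trans (le_of_eq ?_)
    simp only [Finset.sum_add_distrib, ← Finset.mul_sum, ← Finset.sum_mul, mul_add, hq1, hp1]
    rw [hW, hQ]
    ring
  have hI : 4 / Δ * (4 * β * L * Real.exp (-L) / αemp + 4 * β * L * (W + largeNormSq V ε ahat))
      ≤ 16 * β * L / (Δ * αemp) * (Real.exp (-L) + 2 * W) := by
    have hW0 : 0 ≤ W := Finset.sum_nonneg fun b hb => mul_nonneg (hp0 b hb) (hl0 b)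
    have h1 : W + largeNormSq V ε ahat ≤ 2 * W / αemp := by
      have : W ≤ W / αemp := by
        rw [le_div_iff₀ hαe]; nlinarith
      have e2 : 2 * W / αemp = W / αemp + W / αemp := by ring
      linarith
    calc _ ≤ 4 / Δ * (4 * β * L * Real.exp (-L) / αemp + 4 * β * L * (2 * W / αemp)) := by gcongr
      _ = _ := by field_simp; ring
  have hII : 8 / Δ * (e astar ^ 2 + Q) ≤ 8 / Δ * ((|Copt| * d * Real.log d / αopt + 1)
          * ∑ a ∈ arms, p a * (if U ≤ r then
            Real.exp (r / radius lam σ S A t) * e a ^ 2 else 0))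
        + 16 / Δ * (if U ≤ r then 0 else U) := by
    by_cases hUr : U ≤ r
    · -- the design transfers the error at the optimal arm to the sampled arm
      simp only [hUr, if_true, mul_zero, add_zero]
      have e1 : ∑ a ∈ arms, p a * (Real.exp (r / radius lam σ S A t) * e a ^ 2)
          = Real.exp (r / radius lam σ S A t) * Q := by
        rw [hQ, Finset.mul_sum]
        exact Finset.sum_congr rfl fun a _ => by ring
      rw [e1]
      set E := Real.exp (r / radius lam σ S A t) with hE
      have hU0 : 0 ≤ U := estError_nonneg hlam θ A Y t
      have hE1 : 1 ≤ E := Real.one_le_exp (div_nonneg (hU0.trans hUr) hr0.le)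
      have hfs : 1 ≤ E * f astar := by
        refine (inv_weight_best_le hlam hσ hS (hbest ahat hmem) (hmax astar hstar)).trans ?_
        have := (hf0 astar).le
        rw [hE]
        gcongr
      have hdes : f astar * e astar ^ 2 ≤ |Copt| * d * Real.log d / αopt * Q := by
        have h1 := hq.weight_mul_sq_le hD hstar (θ - th)
        have hsum0 : ∀ b ∈ arms, 0 ≤ qopt b * f b * e b ^ 2 := fun b hb => by
          have := hq.nonneg b hb; have := (hf0 b).le; positivity
        have h2 : ∑ b ∈ arms, qopt b * f b * e b ^ 2 ≤ Q / αopt := by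
          rw [le_div_iff₀ hαo, Finset.sum_mul]
          refine Finset.sum_le_sum fun b hb => ?_
          have h3 := mul_le_mul_of_nonneg_right (hq_ge b hb) (hf0 b).le
          have h4 := mul_le_mul_of_nonneg_right (h3.trans (hpge b hb)) (sq_nonneg (e b))
          linarith
        have hlog : 0 ≤ Real.log d := Real.log_natCast_nonneg d
        calc f astar * e astar ^ 2
            ≤ (Copt * d * Real.log d) * ∑ b ∈ arms, qopt b * f b * e b ^ 2 := h1
          _ ≤ (|Copt| * d * Real.log d) * ∑ b ∈ arms, qopt b * f b * e b ^ 2 := by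
              have := Finset.sum_nonneg hsum0
              gcongr
              exact le_abs_self _
          _ ≤ (|Copt| * d * Real.log d) * (Q / αopt) := by gcongr
          _ = _ := by ring
      have h5 : e astar ^ 2 ≤ |Copt| * d * Real.log d / αopt * (E * Q) := by
        calc e astar ^ 2 ≤ (E * f astar) * e astar ^ 2 := le_mul_of_one_le_left (sq_nonneg _) hfs
          _ = E * (f astar * e astar ^ 2) := by ring
          _ ≤ E * (|Copt| * d * Real.log d / αopt * Q) := by gcongr
          _ = _ := by ring
      have h6 : Q ≤ E * Q := le_mul_of_one_le_left hQ0 hE1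
      have h7 : e astar ^ 2 + Q ≤ (|Copt| * d * Real.log d / αopt + 1) * (E * Q) := by linarith
      gcongr
    · -- the errors of all arms are at most `U`, because their norms are at most `1`
      simp only [hUr, if_false, mul_zero, Finset.sum_const_zero, zero_add]
      have hU0 : 0 ≤ U := estError_nonneg hlam θ A Y t
      have he2 : ∀ a ∈ arms, e a ^ 2 ≤ U := fun a ha =>
        (sq_predError_le hlam θ A Y t a).trans (mul_le_of_le_one_right hU0 (hv a ha))
      have hQU : Q ≤ U := by
        calc Q ≤ ∑ a ∈ arms, p a * U :=
              Finset.sum_le_sum fun a ha => mul_le_mul_of_nonneg_left (he2 a ha) (hp0 a ha)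
          _ = U := by rw [← Finset.sum_mul, hp1, one_mul]
      have h1 : e astar ^ 2 + Q ≤ 2 * U := by linarith [he2 astar hstar]
      calc 8 / Δ * (e astar ^ 2 + Q) ≤ 8 / Δ * (2 * U) := by gcongr
        _ = 16 / Δ * U := by ring
  linarith

end Round

/-! ### Conditionally sub-Gaussian noise -/

section Gaussian

/-- The Gaussian integral behind the method of mixtures: the average of `exp ((r g + b)² s / 2)` for
a standard Gaussian `g`. -/
theorem lintegral_exp_sq_gaussian {r b s : ℝ} (hs : r ^ 2 * s < 1) :
    ∫⁻ g, ENNReal.ofReal (Real.exp ((r * g + b) ^ 2 * s / 2)) ∂(ProbabilityTheory.gaussianReal 0 1)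
      = ENNReal.ofReal ((Real.sqrt (1 - r ^ 2 * s))⁻¹
          * Real.exp (b ^ 2 * s / (2 * (1 - r ^ 2 * s)))) := by
  set k := 1 - r ^ 2 * s with hk
  have hk0 : 0 < k := by linarith
  rw [ProbabilityTheory.gaussianReal_of_var_ne_zero 0 one_ne_zero,
    lintegral_withDensity_eq_lintegral_mul _ (ProbabilityTheory.measurable_gaussianPDF 0 1)
      (by fun_prop)]
  have e : ∀ g : ℝ, ((ProbabilityTheory.gaussianPDF 0 1)
      * fun g => ENNReal.ofReal (Real.exp ((r * g + b) ^ 2 * s / 2))) g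
      = ENNReal.ofReal ((Real.sqrt (2 * Real.pi))⁻¹ * Real.exp (b ^ 2 * s / (2 * k))
        * Real.exp (-(k / 2) * (g - r * s * b / k) ^ 2)) := by
    intro g
    rw [Pi.mul_apply, ProbabilityTheory.gaussianPDF, ProbabilityTheory.gaussianPDFReal,
      ← ENNReal.ofReal_mul (by positivity)]
    simp only [NNReal.coe_one, mul_one, sub_zero]
    rw [mul_assoc, mul_assoc, ← Real.exp_add, ← Real.exp_add]
    congr 3
    have hs' : r ^ 2 * s = 1 - k := by rw [hk]; ring
    field_simp
    linear_combination (k * g ^ 2 + s * b ^ 2) * hs'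
  simp only [e]
  have hint : Integrable (fun g : ℝ => Real.exp (-(k / 2) * (g - r * s * b / k) ^ 2)) :=
    (integrable_exp_neg_mul_sq (show 0 < k / 2 by positivity)).comp_sub_right (r * s * b / k)
  rw [← ofReal_integral_eq_lintegral_ofReal (hint.const_mul _)
    (Filter.Eventually.of_forall fun g => by positivity), integral_const_mul,
    integral_sub_right_eq_self (fun g : ℝ => Real.exp (-(k / 2) * g ^ 2)), integral_gaussian]
  congr 1
  have h2 : Real.pi / (k / 2) = (2 * Real.pi) / k := by field_simp
  rw [h2, Real.sqrt_div (by positivity)]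
  have : Real.sqrt (2 * Real.pi) ≠ 0 := by positivity
  field_simp

theorem lintegral_exp_mul_gaussian (x y : ℝ) :
    ∫⁻ g, ENNReal.ofReal (Real.exp ((x * g + y))) ∂(ProbabilityTheory.gaussianReal 0 1)
      = ENNReal.ofReal (Real.exp (x ^ 2 / 2 + y)) := by
  have hint := ProbabilityTheory.integrable_exp_mul_gaussianReal (μ := 0) (v := 1) x
  have hm : ∫ g, Real.exp (x * g) ∂(ProbabilityTheory.gaussianReal 0 1)
      = Real.exp (x ^ 2 / 2) := by
    have := congrFun (ProbabilityTheory.mgf_id_gaussianReal (μ := 0) (v := 1)) x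
    simpa [ProbabilityTheory.mgf] using this
  simp only [Real.exp_add]
  rw [← ofReal_integral_eq_lintegral_ofReal (hint.mul_const _)
    (Filter.Eventually.of_forall fun g => by positivity), integral_mul_const, hm]

end Gaussian

theorem two_add_sq_le_exp_add_exp_neg (x : ℝ) : 2 + x ^ 2 ≤ Real.exp x + Real.exp (-x) := by
  have h : (x / 2) ^ 2 ≤ Real.sinh (x / 2) ^ 2 := by
    rw [sq_le_sq]
    rcases le_total 0 (x / 2) with h0 | h0
    · rw [abs_of_nonneg h0, abs_of_nonneg (Real.sinh_nonneg_iff.2 h0)]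
      exact Real.self_le_sinh_iff.2 h0
    · rw [abs_of_nonpos h0, abs_of_nonpos (Real.sinh_nonpos_iff.2 h0), ← Real.sinh_neg]
      exact Real.self_le_sinh_iff.2 (by linarith)
  have e : Real.exp x + Real.exp (-x) = 2 + 4 * Real.sinh (x / 2) ^ 2 := by
    have h2 := Real.cosh_two_mul (x / 2)
    rw [Real.cosh_sq, mul_div_cancel₀ x two_ne_zero, Real.cosh_eq] at h2
    linarith
  rw [e]
  linarith [div_pow x 2 2]

section Subgaussian

variable {Ω : Type*} {m mΩ : MeasurableSpace Ω} {P : Measure Ω}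

/-- `η` is `σ²`-sub-Gaussian conditionally on `m`. -/
structure IsCondSubgaussian (m : MeasurableSpace Ω) {mΩ : MeasurableSpace Ω} (P : Measure Ω)
    (η : Ω → ℝ) (σ : ℝ) : Prop where
  measurable : Measurable η
  integrable_exp : ∀ u : ℝ, Integrable (fun ω => Real.exp (u * η ω)) P
  condExp_le : ∀ u : ℝ, condExp m P (fun ω => Real.exp (u * η ω))
    ≤ᵐ[P] fun _ => Real.exp (u ^ 2 * σ ^ 2 / 2)

variable {η : Ω → ℝ} {σ : ℝ}

theorem IsCondSubgaussian.memLp (h : IsCondSubgaussian m P η σ) (p : NNReal) :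
    MemLp η p P := by
  apply ProbabilityTheory.memLp_of_mem_interior_integrableExpSet
  have : ProbabilityTheory.integrableExpSet η P = Set.univ :=
    Set.eq_univ_of_forall fun u => h.integrable_exp u
  simp [this]

theorem IsCondSubgaussian.integrable_sq (h : IsCondSubgaussian m P η σ) :
    Integrable (fun ω => η ω ^ 2) P := by
  have := h.memLp 2
  exact this.integrable_sq

variable [IsProbabilityMeasure P]

theorem IsCondSubgaussian.setIntegral_exp_le (h : IsCondSubgaussian m P η σ) (hm : m ≤ mΩ)
    {s : Set Ω} (hs : MeasurableSet[m] s) (u : ℝ) :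
    ∫ ω in s, Real.exp (u * η ω) ∂P ≤ P.real s * Real.exp (u ^ 2 * σ ^ 2 / 2) := by
  rw [← setIntegral_condExp hm (h.integrable_exp u) hs]
  calc ∫ ω in s, condExp m P (fun ω => Real.exp (u * η ω)) ω ∂P
      ≤ ∫ ω in s, Real.exp (u ^ 2 * σ ^ 2 / 2) ∂P :=
        setIntegral_mono_ae integrable_condExp.integrableOn (by simp) (h.condExp_le u)
    _ = _ := by simp

theorem IsCondSubgaussian.integrable (h : IsCondSubgaussian m P η σ) : Integrable η P :=
  (h.memLp 1).integrable le_rfl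

/-- Comparison of the linear terms at `u = 0` of `E[1_s e^{u η}] ≤ P(s) e^{u² σ² / 2}`. -/
theorem IsCondSubgaussian.setIntegral_eq_zero (h : IsCondSubgaussian m P η σ) (hm : m ≤ mΩ)
    {s : Set Ω} (hs : MeasurableSet[m] s) : ∫ ω in s, η ω ∂P = 0 := by
  set x := ∫ ω in s, η ω ∂P with hx
  set F : ℝ → ℝ := fun u => P.real s * (Real.exp (u ^ 2 * (σ ^ 2 / 2)) - 1) - u * x with hF
  have hF0 : ∀ u, 0 ≤ F u := by
    intro u
    have h1 := h.setIntegral_exp_le hm hs u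
    have h2 : P.real s + u * x ≤ ∫ ω in s, Real.exp (u * η ω) ∂P := by
      calc P.real s + u * x = ∫ ω in s, (1 + u * η ω) ∂P := by
            rw [integral_add (by simp) (h.integrable.integrableOn.const_mul u), integral_const_mul]
            simp [hx]
        _ ≤ _ := by
            refine setIntegral_mono (((integrable_const (1 : ℝ)).integrableOn.add
              (h.integrable.integrableOn.const_mul u))) (h.integrable_exp u).integrableOn ?_
            intro ω
            have := Real.add_one_le_exp (u * η ω)
            simp only
            linarith
    have e : u ^ 2 * (σ ^ 2 / 2) = u ^ 2 * σ ^ 2 / 2 := by ring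
    simp only [hF]
    rw [e]
    linarith
  have hd : HasDerivAt F (P.real s * (Real.exp ((0:ℝ) ^ 2 * (σ ^ 2 / 2))
      * ((2 * (0:ℝ) ^ (2 - 1)) * (σ ^ 2 / 2))) - 1 * x) 0 := by
    have h1 : HasDerivAt (fun u : ℝ => u ^ 2 * (σ ^ 2 / 2))
        ((2 * (0:ℝ) ^ (2 - 1)) * (σ ^ 2 / 2)) 0 := by
      simpa using (hasDerivAt_pow 2 (0:ℝ)).mul_const (σ ^ 2 / 2)
    exact ((h1.exp.sub_const 1).const_mul (P.real s)).sub ((hasDerivAt_id (0:ℝ)).mul_const x)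
  have hmin : IsLocalMin F 0 := by
    refine Filter.Eventually.of_forall fun u => ?_
    have : F 0 = 0 := by simp [hF]
    rw [this]; exact hF0 u
  have := hmin.hasDerivAt_eq_zero hd
  simpa using this

/-- Comparison of the quadratic terms at `u = 0` of `E[1_s cosh (u η)] ≤ P(s) e^{u² σ² / 2}`. -/
theorem IsCondSubgaussian.setIntegral_sq_le (h : IsCondSubgaussian m P η σ) (hm : m ≤ mΩ)
    {s : Set Ω} (hs : MeasurableSet[m] s) : ∫ ω in s, η ω ^ 2 ∂P ≤ σ ^ 2 * P.real s := by
  set x := ∫ ω in s, η ω ^ 2 ∂P with hx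
  have hp : 0 ≤ P.real s := measureReal_nonneg
  have key : ∀ u : ℝ, u ≠ 0 → x ≤ P.real s * σ ^ 2 * Real.exp (u ^ 2 * σ ^ 2 / 2) := by
    intro u hu
    have h1 := h.setIntegral_exp_le hm hs u
    have h1' := h.setIntegral_exp_le hm hs (-u)
    have h2 : 2 * P.real s + u ^ 2 * x
        ≤ ∫ ω in s, (Real.exp (u * η ω) + Real.exp (-u * η ω)) ∂P := by
      calc 2 * P.real s + u ^ 2 * x = ∫ ω in s, (2 + u ^ 2 * η ω ^ 2) ∂P := by
            rw [integral_add (by simp) (h.integrable_sq.integrableOn.const_mul _),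
              integral_const_mul]
            simp [hx, mul_comm]
        _ ≤ _ := by
            refine setIntegral_mono (((integrable_const (2 : ℝ)).integrableOn.add
              (h.integrable_sq.integrableOn.const_mul _)))
              ((h.integrable_exp u).integrableOn.add (h.integrable_exp (-u)).integrableOn) ?_
            intro ω
            have h3 := two_add_sq_le_exp_add_exp_neg (u * η ω)
            simp only [neg_mul]
            linarith [mul_pow u (η ω) 2]
    rw [integral_add (h.integrable_exp u).integrableOn (h.integrable_exp (-u)).integrableOn] at h2
    rw [neg_sq] at h1'
    set w := u ^ 2 * σ ^ 2 / 2 with hw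
    have h4 : Real.exp w - 1 ≤ w * Real.exp w := by
      have := Real.add_one_le_exp (-w)
      have h5 : Real.exp (-w) * Real.exp w = 1 := by rw [← Real.exp_add]; simp
      nlinarith [Real.exp_pos w]
    have hu2 : 0 < u ^ 2 := by positivity
    have h6 : u ^ 2 * x ≤ u ^ 2 * (P.real s * σ ^ 2 * Real.exp w) := by
      have := mul_le_mul_of_nonneg_left h4 hp
      have e : u ^ 2 * (P.real s * σ ^ 2 * Real.exp w) = 2 * (P.real s * (w * Real.exp w)) := by
        rw [hw]; ring
      rw [e]; linarith
    exact le_of_mul_le_mul_left h6 hu2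
  have hlim : Filter.Tendsto (fun u : ℝ => P.real s * σ ^ 2 * Real.exp (u ^ 2 * σ ^ 2 / 2))
      (nhdsWithin 0 {0}ᶜ) (nhds (P.real s * σ ^ 2 * Real.exp ((0:ℝ) ^ 2 * σ ^ 2 / 2))) :=
    ((by fun_prop : Continuous fun u : ℝ =>
      P.real s * σ ^ 2 * Real.exp (u ^ 2 * σ ^ 2 / 2)).tendsto 0).mono_left nhdsWithin_le_nhds
  have := ge_of_tendsto hlim (by
    filter_upwards [self_mem_nhdsWithin] with u hu using key u hu)
  simp only [ne_eq, OfNat.ofNat_ne_zero, not_false_eq_true, zero_pow, zero_mul, zero_div,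
    Real.exp_zero, mul_one] at this
  linarith

theorem IsCondSubgaussian.integral_mul_eq_zero (h : IsCondSubgaussian m P η σ) (hm : m ≤ mΩ)
    {c : Ω → ℝ} (hc : Measurable[m] c) {C : ℝ} (hC : ∀ᵐ ω ∂P, |c ω| ≤ C) :
    ∫ ω, c ω * η ω ∂P = 0 := by
  have h0 : (fun _ => (0 : ℝ)) =ᵐ[P] condExp m P η :=
    ae_eq_condExp_of_forall_setIntegral_eq hm h.integrable (fun s _ _ => by simp)
      (fun s hs _ => by simp [h.setIntegral_eq_zero hm hs]) (by fun_prop)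
  have hpull := condExp_stronglyMeasurable_mul_of_bound hm hc.stronglyMeasurable h.integrable C
    (by simpa using hC)
  rw [← integral_condExp hm, ← integral_zero Ω ℝ (μ := P)]
  refine integral_congr_ae ?_
  filter_upwards [hpull, h0] with ω h1 h2
  have h3 : (fun ω => c ω * η ω) = c * η := rfl
  rw [h3, h1, Pi.mul_apply, ← h2, mul_zero]

theorem IsCondSubgaussian.integral_mul_sq_le (h : IsCondSubgaussian m P η σ) (hm : m ≤ mΩ)
    {c : Ω → ℝ} (hc : Measurable[m] c) (hc0 : ∀ᵐ ω ∂P, 0 ≤ c ω) {C : ℝ}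
    (hC : ∀ᵐ ω ∂P, |c ω| ≤ C) :
    ∫ ω, c ω * η ω ^ 2 ∂P ≤ σ ^ 2 * ∫ ω, c ω ∂P := by
  have h0 : condExp m P (fun ω => η ω ^ 2) ≤ᵐ[P] fun _ => σ ^ 2 := by
    refine ae_le_of_ae_le_trim (hm := hm) ?_
    refine ae_le_of_forall_setIntegral_le (integrable_condExp.trim hm stronglyMeasurable_condExp)
      (integrable_const _) fun s hs _ => ?_
    rw [← setIntegral_trim hm stronglyMeasurable_condExp hs,
      setIntegral_condExp hm h.integrable_sq hs]
    refine (h.setIntegral_sq_le hm hs).trans (le_of_eq ?_)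
    simp only [integral_const, smul_eq_mul, measureReal_restrict_apply MeasurableSet.univ,
      Set.univ_inter]
    rw [mul_comm, measureReal_def, measureReal_def, trim_measurableSet_eq hm hs]
  have hpull := condExp_stronglyMeasurable_mul_of_bound hm hc.stronglyMeasurable h.integrable_sq C
    (by simpa using hC)
  have hci : Integrable c P :=
    Integrable.of_bound (hc.mono hm le_rfl).aestronglyMeasurable C (by simpa using hC)
  rw [← integral_condExp hm, ← integral_const_mul]
  refine integral_mono_ae integrable_condExp (hci.const_mul _) ?_
  filter_upwards [hpull, h0, hc0] with ω h1 h2 h4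
  have h3 : (fun ω => c ω * η ω ^ 2) = c * fun ω => η ω ^ 2 := rfl
  rw [h3, h1, Pi.mul_apply]
  nlinarith

/-- The sub-Gaussian bound, tested against nonnegative functions of the past. -/
theorem IsCondSubgaussian.lintegral_mul_exp_const_le (h : IsCondSubgaussian m P η σ) (hm : m ≤ mΩ)
    {X : Ω → ENNReal} (hX : Measurable[m] X) (u : ℝ) :
    ∫⁻ ω, X ω * ENNReal.ofReal (Real.exp (u * η ω)) ∂P
      ≤ ∫⁻ ω, X ω * ENNReal.ofReal (Real.exp (u ^ 2 * σ ^ 2 / 2)) ∂P := by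
  have hη := h.measurable
  set c := ENNReal.ofReal (Real.exp (u ^ 2 * σ ^ 2 / 2)) with hc
  set f : Ω → ENNReal := fun ω => ENNReal.ofReal (Real.exp (u * η ω)) with hf
  have hfm : Measurable f := by fun_prop
  have hle : (P.withDensity f).trim hm ≤ c • P.trim hm := by
    refine Measure.le_iff.2 fun s hs => ?_
    rw [trim_measurableSet_eq hm hs, Measure.smul_apply, trim_measurableSet_eq hm hs,
      withDensity_apply _ (hm s hs), hf,
      ← ofReal_integral_eq_lintegral_ofReal (h.integrable_exp u).integrableOn
        (Filter.Eventually.of_forall fun ω => by positivity)]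
    refine (ENNReal.ofReal_le_ofReal (h.setIntegral_exp_le hm hs u)).trans (le_of_eq ?_)
    rw [mul_comm, ENNReal.ofReal_mul (by positivity), ofReal_measureReal, smul_eq_mul]
  have e1 : ∫⁻ ω, X ω * f ω ∂P = ∫⁻ ω, X ω ∂((P.withDensity f).trim hm) := by
    rw [lintegral_trim hm hX, lintegral_withDensity_eq_lintegral_mul _ hfm (hX.mono hm le_rfl)]
    simp only [Pi.mul_apply, mul_comm]
  have e2 : ∫⁻ ω, X ω * c ∂P = ∫⁻ ω, X ω ∂(c • P.trim hm) := by
    rw [lintegral_smul_measure, lintegral_trim hm hX, lintegral_mul_const _ (hX.mono hm le_rfl),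
      smul_eq_mul, mul_comm]
  rw [e1, e2]
  exact lintegral_mono' hle le_rfl

/-- The integer `j` such that `j / (k + 1)` is the rounding of `w` towards `0` to a multiple of
`1 / (k + 1)`. Rounding towards `0` does not increase `w²`, hence not the sub-Gaussian bound
`exp (w² σ² / 2)` either. -/
noncomputable def roundToZero (k : ℕ) (w : ℝ) : ℤ :=
  if 0 ≤ w then ⌊w * (k + 1)⌋ else ⌈w * (k + 1)⌉

theorem measurable_roundToZero (k : ℕ) : Measurable (roundToZero k) := by
  unfold roundToZero
  refine Measurable.ite measurableSet_Ici ?_ ?_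
  · exact Int.measurable_floor.comp (by fun_prop)
  · exact Int.measurable_ceil.comp (by fun_prop)

theorem sq_roundToZero_le (k : ℕ) (w : ℝ) : ((roundToZero k w : ℝ) / (k + 1)) ^ 2 ≤ w ^ 2 := by
  have hk : (0 : ℝ) < k + 1 := by positivity
  rw [sq_le_sq, abs_div, abs_of_pos hk, div_le_iff₀ hk]
  unfold roundToZero
  split_ifs with h
  · have h1 := Int.floor_le (w * (k + 1))
    have h2 : (0 : ℝ) ≤ ⌊w * (k + 1)⌋ := by exact_mod_cast Int.floor_nonneg.2 (by positivity)
    rw [abs_of_nonneg h2, abs_of_nonneg h]; exact h1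
  · have hw : w < 0 := not_le.1 h
    have h1 := Int.le_ceil (w * (k + 1))
    have h2 : (⌈w * (k + 1)⌉ : ℝ) ≤ 0 := by
      exact_mod_cast Int.ceil_le.2 (by push_cast; nlinarith)
    rw [abs_of_nonpos h2, abs_of_neg hw]; linarith

theorem tendsto_roundToZero (w : ℝ) :
    Filter.Tendsto (fun k : ℕ => (roundToZero k w : ℝ) / (k + 1)) Filter.atTop (nhds w) := by
  rw [tendsto_iff_dist_tendsto_zero]
  refine squeeze_zero (fun _ => dist_nonneg) (fun k => ?_) tendsto_one_div_add_atTop_nhds_zero_nat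
  have hk : (0 : ℝ) < k + 1 := by positivity
  have e : (roundToZero k w : ℝ) / (k + 1) - w = (roundToZero k w - w * (k + 1)) / (k + 1) := by
    field_simp
  rw [Real.dist_eq, e, abs_div, abs_of_pos hk]
  gcongr
  unfold roundToZero
  rw [abs_le]
  split_ifs
  · constructor <;> linarith [Int.floor_le (w * (k + 1)), Int.lt_floor_add_one (w * (k + 1))]
  · constructor <;> linarith [Int.le_ceil (w * (k + 1)), Int.ceil_lt_add_one (w * (k + 1))]

/-- The sub-Gaussian bound for a random parameter `W` that depends on the past: on each event where
the rounding of `W` takes a given value the parameter is constant, and the roundings converge. -/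
theorem IsCondSubgaussian.lintegral_mul_exp_le (h : IsCondSubgaussian m P η σ) (hm : m ≤ mΩ)
    {X : Ω → ENNReal} (hX : Measurable[m] X) {W : Ω → ℝ} (hW : Measurable[m] W) :
    ∫⁻ ω, X ω * ENNReal.ofReal (Real.exp (W ω * η ω)) ∂P
      ≤ ∫⁻ ω, X ω * ENNReal.ofReal (Real.exp (W ω ^ 2 * σ ^ 2 / 2)) ∂P := by
  have hη := h.measurable
  have hW' : Measurable W := hW.mono hm le_rfl
  have hX' : Measurable X := hX.mono hm le_rfl
  set N : ℕ → Ω → ℤ := fun k ω => roundToZero k (W ω) with hN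
  have hNm : ∀ k, Measurable[m] (N k) := fun k => (measurable_roundToZero k).comp hW
  have hNm' : ∀ k, Measurable (N k) := fun k => (hNm k).mono hm le_rfl
  have hNr : ∀ k, Measurable fun ω => ((N k ω : ℤ) : ℝ) := fun k =>
    (measurable_from_top (f := fun z : ℤ => (z : ℝ))).comp (hNm' k)
  have hstep : ∀ k : ℕ,
      ∫⁻ ω, X ω * ENNReal.ofReal (Real.exp ((N k ω : ℝ) / (k + 1) * η ω)) ∂P
        ≤ ∫⁻ ω, X ω * ENNReal.ofReal (Real.exp (W ω ^ 2 * σ ^ 2 / 2)) ∂P := by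
    intro k
    have hpart : ∀ F : Ω → ENNReal, ∫⁻ ω, F ω ∂P = ∑' z : ℤ, ∫⁻ ω in N k ⁻¹' {z}, F ω ∂P := by
      intro F
      rw [← lintegral_iUnion (fun z => hNm' k (measurableSet_singleton z)), ← Set.preimage_iUnion,
        Set.iUnion_of_singleton, Set.preimage_univ, Measure.restrict_univ]
      intro z w hzw
      exact Disjoint.preimage _ (by simpa using hzw)
    calc ∫⁻ ω, X ω * ENNReal.ofReal (Real.exp ((N k ω : ℝ) / (k + 1) * η ω)) ∂P
        ≤ ∫⁻ ω, X ω * ENNReal.ofReal (Real.exp (((N k ω : ℝ) / (k + 1)) ^ 2 * σ ^ 2 / 2)) ∂P := by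
          rw [hpart, hpart]
          refine ENNReal.tsum_le_tsum fun z => ?_
          have hsm : MeasurableSet[m] (N k ⁻¹' {z}) := hNm k (measurableSet_singleton z)
          have hs : MeasurableSet (N k ⁻¹' {z}) := hm _ hsm
          have h1 := h.lintegral_mul_exp_const_le hm (hX.indicator hsm) ((z : ℝ) / (k + 1))
          have hind : ∀ F : Ω → ENNReal, ∫⁻ ω, (N k ⁻¹' {z}).indicator X ω * F ω ∂P
              = ∫⁻ ω in N k ⁻¹' {z}, X ω * F ω ∂P := fun F => by
            rw [← lintegral_indicator hs]
            exact lintegral_congr fun ω => (Set.indicator_mul_left _ _ _).symm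
          rw [hind, hind] at h1
          have e1 : ∫⁻ ω in N k ⁻¹' {z},
              X ω * ENNReal.ofReal (Real.exp ((N k ω : ℝ) / (k + 1) * η ω)) ∂P
              = ∫⁻ ω in N k ⁻¹' {z},
              X ω * ENNReal.ofReal (Real.exp ((z : ℝ) / (k + 1) * η ω)) ∂P :=
            setLIntegral_congr_fun hs fun ω hω => by
              have : N k ω = z := hω
              simp only [this]
          have e2 : ∫⁻ ω in N k ⁻¹' {z},
              X ω * ENNReal.ofReal (Real.exp (((N k ω : ℝ) / (k + 1)) ^ 2 * σ ^ 2 / 2)) ∂P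
              = ∫⁻ ω in N k ⁻¹' {z},
              X ω * ENNReal.ofReal (Real.exp (((z : ℝ) / (k + 1)) ^ 2 * σ ^ 2 / 2)) ∂P :=
            setLIntegral_congr_fun hs fun ω hω => by
              have : N k ω = z := hω
              simp only [this]
          rw [e1, e2]
          exact h1
      _ ≤ _ := by
          refine lintegral_mono fun ω => ?_
          have := sq_roundToZero_le k (W ω)
          gcongr
  have hlim : ∀ ω, Filter.Tendsto
      (fun k : ℕ => X ω * ENNReal.ofReal (Real.exp ((N k ω : ℝ) / (k + 1) * η ω))) Filter.atTop
      (nhds (X ω * ENNReal.ofReal (Real.exp (W ω * η ω)))) := by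
    intro ω
    refine ENNReal.Tendsto.const_mul (ENNReal.tendsto_ofReal ?_)
      (Or.inl (by simpa using Real.exp_pos _))
    exact (Real.continuous_exp.tendsto _).comp ((tendsto_roundToZero (W ω)).mul_const _)
  calc ∫⁻ ω, X ω * ENNReal.ofReal (Real.exp (W ω * η ω)) ∂P
      = ∫⁻ ω, Filter.liminf (fun k : ℕ =>
          X ω * ENNReal.ofReal (Real.exp ((N k ω : ℝ) / (k + 1) * η ω))) Filter.atTop ∂P :=
        lintegral_congr fun ω => (hlim ω).liminf_eq.symm
    _ ≤ Filter.liminf (fun k : ℕ => ∫⁻ ω,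
          X ω * ENNReal.ofReal (Real.exp ((N k ω : ℝ) / (k + 1) * η ω)) ∂P) Filter.atTop :=
        lintegral_liminf_le fun k => by have := hNr k; fun_prop
    _ ≤ _ := by
        refine Filter.liminf_le_of_le (by isBoundedDefault) fun b hb => ?_
        obtain ⟨k, hk⟩ := hb.exists
        exact hk.trans (hstep k)

/-- Exponential moments of quadratic functions of the noise, with coefficients that depend on the
past. The square is linearized by a Gaussian variable `g`:
`exp (c η² / 2) = E_g exp (√c g η)`. -/
theorem IsCondSubgaussian.lintegral_exp_quadratic_le (h : IsCondSubgaussian m P η σ) (hm : m ≤ mΩ)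
    {X : Ω → ENNReal} (hX : Measurable[m] X) {b c : Ω → ℝ} (hb : Measurable[m] b)
    (hc : Measurable[m] c) (hc0 : ∀ ω, 0 ≤ c ω) (hcσ : ∀ ω, c ω * σ ^ 2 < 1) :
    ∫⁻ ω, X ω * ENNReal.ofReal (Real.exp (b ω * η ω + c ω * η ω ^ 2 / 2)) ∂P
      ≤ ∫⁻ ω, X ω * ENNReal.ofReal ((Real.sqrt (1 - c ω * σ ^ 2))⁻¹
          * Real.exp (b ω ^ 2 * σ ^ 2 / (2 * (1 - c ω * σ ^ 2)))) ∂P := by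
  have hη := h.measurable
  have hX' : Measurable X := hX.mono hm le_rfl
  have hb' : Measurable b := hb.mono hm le_rfl
  have hc' : Measurable c := hc.mono hm le_rfl
  set γ := ProbabilityTheory.gaussianReal 0 1 with hγ
  have hsq : ∀ ω, Real.sqrt (c ω) ^ 2 = c ω := fun ω => Real.sq_sqrt (hc0 ω)
  calc ∫⁻ ω, X ω * ENNReal.ofReal (Real.exp (b ω * η ω + c ω * η ω ^ 2 / 2)) ∂P
      = ∫⁻ ω, ∫⁻ g, X ω * ENNReal.ofReal (Real.exp ((Real.sqrt (c ω) * g + b ω) * η ω)) ∂γ ∂P := by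
        refine lintegral_congr fun ω => ?_
        rw [lintegral_const_mul _ (by fun_prop)]
        congr 1
        have := lintegral_exp_mul_gaussian (Real.sqrt (c ω) * η ω) (b ω * η ω)
        rw [mul_pow, hsq] at this
        rw [hγ]
        convert! this.symm using 1
        · congr 2; ring
        · refine lintegral_congr fun g => ?_
          congr 2; ring
    _ = ∫⁻ g, ∫⁻ ω, X ω * ENNReal.ofReal (Real.exp ((Real.sqrt (c ω) * g + b ω) * η ω)) ∂P ∂γ := by
        refine lintegral_lintegral_swap (Measurable.aemeasurable ?_)
        simp only [Function.uncurry_def]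
        fun_prop
    _ ≤ ∫⁻ g, ∫⁻ ω, X ω
          * ENNReal.ofReal (Real.exp ((Real.sqrt (c ω) * g + b ω) ^ 2 * σ ^ 2 / 2)) ∂P ∂γ := by
        refine lintegral_mono fun g => ?_
        exact h.lintegral_mul_exp_le hm hX (W := fun ω => Real.sqrt (c ω) * g + b ω)
          ((hc.sqrt.mul_const g).add hb)
    _ = ∫⁻ ω, ∫⁻ g, X ω
          * ENNReal.ofReal (Real.exp ((Real.sqrt (c ω) * g + b ω) ^ 2 * σ ^ 2 / 2)) ∂γ ∂P := by
        refine (lintegral_lintegral_swap (Measurable.aemeasurable ?_)).symm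
        simp only [Function.uncurry_def]
        fun_prop
    _ = _ := by
        refine lintegral_congr fun ω => ?_
        rw [lintegral_const_mul _ (by fun_prop), hγ,
          lintegral_exp_sq_gaussian (by rw [hsq]; exact hcσ ω), hsq]

end Subgaussian

/-! ### Measurability of the quantities computed from a trajectory -/

section Measurability

variable {Ω : Type*} {m : MeasurableSpace Ω}

theorem measurable_dotProduct {x y : Ω → Vec d} (hx : Measurable x) (hy : Measurable y) :
    Measurable fun ω => x ω ⬝ᵥ y ω := by
  unfold dotProduct
  fun_prop

theorem measurable_det {M : Ω → Matrix (Fin d) (Fin d) ℝ}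
    (hM : ∀ i j, Measurable fun ω => M ω i j) : Measurable fun ω => (M ω).det := by
  simp only [Matrix.det_apply]
  refine Finset.measurable_fun_sum _ fun σ _ => ?_
  exact (Finset.measurable_fun_prod _ fun i _ => hM _ _).const_smul _

theorem measurable_inv_apply {M : Ω → Matrix (Fin d) (Fin d) ℝ}
    (hM : ∀ i j, Measurable fun ω => M ω i j) (i j : Fin d) :
    Measurable fun ω => (M ω)⁻¹ i j := by
  simp only [Matrix.inv_def, Ring.inverse_eq_inv', Matrix.smul_apply, smul_eq_mul,
    Matrix.adjugate_apply]
  refine (measurable_det hM).inv.mul (measurable_det fun k l => ?_)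
  by_cases h : k = j
  · subst h; simp
  · simpa [Matrix.updateRow_ne h] using hM k l

theorem measurable_mulVec {M : Ω → Matrix (Fin d) (Fin d) ℝ}
    (hM : ∀ i j, Measurable fun ω => M ω i j) {x : Ω → Vec d} (hx : Measurable x) :
    Measurable fun ω => Matrix.mulVec (M ω) (x ω) := by
  refine measurable_pi_lambda _ fun i => ?_
  simp only [Matrix.mulVec, dotProduct]
  refine Finset.measurable_fun_sum _ fun j _ => (hM i j).mul ?_
  fun_prop

theorem measurable_invNormSq {M : Ω → Matrix (Fin d) (Fin d) ℝ}
    (hM : ∀ i j, Measurable fun ω => M ω i j) {x : Ω → Vec d} (hx : Measurable x) :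
    Measurable fun ω => invNormSq (M ω) (x ω) :=
  measurable_dotProduct hx (measurable_mulVec (fun i j => measurable_inv_apply hM i j) hx)

variable {A : ℕ → Ω → Vec d} {Y : ℕ → Ω → ℝ} {t : ℕ}

theorem measurable_gram_apply (lam : ℝ) (hA : ∀ s < t, Measurable (A s)) (i j : Fin d) :
    Measurable fun ω => gram lam (fun s => A s ω) t i j := by
  simp only [gram, Matrix.add_apply, Matrix.sum_apply, Matrix.vecMulVec_apply]
  refine measurable_const.add (Finset.measurable_fun_sum _ fun s hs => ?_)
  have := hA s (Finset.mem_range.1 hs)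
  fun_prop

theorem measurable_ridge (lam : ℝ) (hA : ∀ s < t, Measurable (A s))
    (hY : ∀ s < t, Measurable (Y s)) :
    Measurable fun ω => ridge lam (fun s => A s ω) (fun s => Y s ω) t := by
  refine measurable_mulVec (fun i j => measurable_inv_apply (measurable_gram_apply lam hA) i j)
    (Finset.measurable_fun_sum _ fun s hs => ?_)
  have := hA s (Finset.mem_range.1 hs)
  have := hY s (Finset.mem_range.1 hs)
  fun_prop

theorem measurable_radius (lam σ S : ℝ) (hA : ∀ s < t, Measurable (A s)) :
    Measurable fun ω => radius lam σ S (fun s => A s ω) t := by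
  have h1 := measurable_det (measurable_gram_apply (t := t) lam hA)
  have h2 := measurable_det (measurable_gram_apply (m := m) (A := A) (t := 0) lam (by simp))
  unfold radius
  fun_prop

theorem measurable_noiseSum (θ : Vec d) (hA : ∀ s < t, Measurable (A s))
    (hY : ∀ s < t, Measurable (Y s)) :
    Measurable fun ω => noiseSum θ (fun s => A s ω) (fun s => Y s ω) t := by
  refine Finset.measurable_fun_sum _ fun s hs => ?_
  have h1 := hA s (Finset.mem_range.1 hs)
  have h2 := hY s (Finset.mem_range.1 hs)
  exact (h2.sub (measurable_dotProduct measurable_const h1)).smul h1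

theorem measurable_estError (lam : ℝ) (θ : Vec d) (hA : ∀ s < t, Measurable (A s))
    (hY : ∀ s < t, Measurable (Y s)) :
    Measurable fun ω => estError lam θ (fun s => A s ω) (fun s => Y s ω) t :=
  measurable_invNormSq (measurable_gram_apply lam hA)
    ((measurable_noiseSum θ hA hY).sub measurable_const)

theorem measurable_leverage (lam : ℝ) (hA : ∀ s < t, Measurable (A s)) {x : Ω → Vec d}
    (hx : Measurable x) : Measurable fun ω => invNormSq (gram lam (fun s => A s ω) t) (x ω) :=
  measurable_invNormSq (measurable_gram_apply lam hA) hx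

end Measurability

section History

variable {Ω : Type*} {A : ℕ → Ω → Vec d} {Y : ℕ → Ω → ℝ}

theorem measurable_history_arm {s t : ℕ} (h : s < t) : Measurable[history A Y t] (A s) := by
  have h1 : MeasurableSpace.comap (A s) inferInstance ≤ history A Y t :=
    le_sup_left.trans (le_iSup₂_of_le s (Finset.mem_range.2 h) le_rfl)
  exact (comap_measurable (A s)).mono h1 le_rfl

theorem measurable_history_reward {s t : ℕ} (h : s < t) : Measurable[history A Y t] (Y s) := by
  have h1 : MeasurableSpace.comap (Y s) inferInstance ≤ history A Y t :=
    le_sup_right.trans (le_iSup₂_of_le s (Finset.mem_range.2 h) le_rfl)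
  exact (comap_measurable (Y s)).mono h1 le_rfl

theorem history_le_historyArm (t : ℕ) : history A Y t ≤ historyArm A Y t := le_sup_left

theorem measurable_historyArm_arm (t : ℕ) : Measurable[historyArm A Y t] (A t) :=
  (comap_measurable (A t)).mono le_sup_right le_rfl

variable [mΩ : MeasurableSpace Ω]

theorem history_le (hA : ∀ t, Measurable (A t)) (hY : ∀ t, Measurable (Y t)) (t : ℕ) :
    history A Y t ≤ mΩ :=
  iSup₂_le fun s _ => sup_le (hA s).comap_le (hY s).comap_le

theorem historyArm_le (hA : ∀ t, Measurable (A t)) (hY : ∀ t, Measurable (Y t)) (t : ℕ) :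
    historyArm A Y t ≤ mΩ :=
  sup_le (history_le hA hY t) (hA t).comap_le

theorem IsLinearReward.isCondSubgaussian {P : Measure Ω} {θ : Vec d} {σ : ℝ}
    (h : IsLinearReward P θ σ A Y) (hA : ∀ t, Measurable (A t)) (t : ℕ) :
    IsCondSubgaussian (historyArm A Y t) P (fun ω => Y t ω - θ ⬝ᵥ A t ω) σ where
  measurable := (h.measurable_reward t).sub (measurable_dotProduct measurable_const (hA t))
  integrable_exp := h.integrable_exp t
  condExp_le := h.subgaussian t

end History

/-! ### Self-normalized deviations -/

/-- The supermartingale `exp (‖∑ η_s A_s‖²_{V_t⁻¹} / (2 σ²)) √(det V_0 / det V_t)`. -/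
noncomputable def selfNormExp (lam σ : ℝ) (θ : Vec d) (A : ℕ → Vec d) (Y : ℕ → ℝ) (t : ℕ) : ℝ :=
  Real.exp (invNormSq (gram lam A t) (noiseSum θ A Y t) / (2 * σ ^ 2))
    * (Real.sqrt ((gram lam A t).det / (gram lam A 0).det))⁻¹

theorem selfNormExp_nonneg (lam σ : ℝ) (θ : Vec d) (A : ℕ → Vec d) (Y : ℕ → ℝ) (t : ℕ) :
    0 ≤ selfNormExp lam σ θ A Y t := by
  unfold selfNormExp; positivity

theorem selfNormExp_zero {lam : ℝ} (hlam : 0 < lam) (σ : ℝ) (θ : Vec d) (A : ℕ → Vec d)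
    (Y : ℕ → ℝ) : selfNormExp lam σ θ A Y 0 = 1 := by
  simp [selfNormExp, noiseSum, invNormSq, (gram_det_pos hlam A 0).ne']

theorem measurable_selfNormExp {Ω : Type*} {m : MeasurableSpace Ω} {A : ℕ → Ω → Vec d}
    {Y : ℕ → Ω → ℝ} {t : ℕ} (lam σ : ℝ) (θ : Vec d)
    (hA : ∀ s < t, Measurable (A s)) (hY : ∀ s < t, Measurable (Y s)) :
    Measurable fun ω => selfNormExp lam σ θ (fun s => A s ω) (fun s => Y s ω) t := by
  have h1 := measurable_det (measurable_gram_apply (t := t) lam hA)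
  have h2 := measurable_det (measurable_gram_apply (A := A) (t := 0) lam (m := m) (by simp))
  have h3 := measurable_invNormSq (measurable_gram_apply (t := t) lam hA)
    (measurable_noiseSum θ hA hY)
  unfold selfNormExp
  fun_prop

/-- Outside of the confidence ellipsoid, `‖∑ η_s A_s‖²_{V_t⁻¹}` exceeds its threshold, and the
excess, divided by `2 σ²`, is the logarithm of `δ_t` times the exponential supermartingale. -/
theorem estError_le_of_radius_lt {lam σ D : ℝ} (hlam : 0 < lam) (hσ : 0 < σ) (θ : Vec d)
    (A : ℕ → Vec d) (Y : ℕ → ℝ) (t : ℕ)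
    (hD : Real.log ((gram lam A t).det / (gram lam A 0).det) ≤ D)
    (h : radius lam σ (euclNorm θ) A t < estError lam θ A Y t) :
    estError lam θ A Y t ≤ failureRate t
      * (4 * σ ^ 2 * (1 + D / 2 + Real.log (1 / failureRate t)) + 2 * (lam * euclNorm θ ^ 2))
      * selfNormExp lam σ θ A Y t := by
  have hP := gram_posDef hlam A t
  set G := invNormSq (gram lam A t) (noiseSum θ A Y t) with hG
  have hG0 : 0 ≤ G := invNormSq_nonneg hP _
  set U := estError lam θ A Y t with hU
  have hU0 : 0 ≤ U := estError_nonneg hlam θ A Y t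
  set R := (gram lam A t).det / (gram lam A 0).det with hR
  have hR0 : 0 < R := div_pos (gram_det_pos hlam A t) (gram_det_pos hlam A 0)
  have hR1 : 0 ≤ Real.log R := log_gram_det_ratio_nonneg hlam A t
  set δ := failureRate t with hδ
  have hδ0 : 0 < δ := by rw [hδ, failureRate]; positivity
  have hlδ : 0 ≤ Real.log (1 / δ) := log_inv_failureRate_nonneg t
  have hS0 : 0 ≤ lam * euclNorm θ ^ 2 := by positivity
  have hbias : invNormSq (gram lam A t) (lam • θ) ≤ lam * euclNorm θ ^ 2 := by
    have h1 := invNormSq_gram_le hlam A t (lam • θ)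
    refine h1.trans (le_of_eq ?_)
    rw [euclNorm_sq, euclNorm_sq, smul_dotProduct, dotProduct_smul, smul_eq_mul, smul_eq_mul]
    field_simp
  have hUG : U ≤ 2 * G + 2 * (lam * euclNorm θ ^ 2) := by
    have h1 := invNormSq_sub_le hP (noiseSum θ A Y t) (lam • θ)
    rw [← estError] at h1
    linarith
  have hsqrt : Real.sqrt U ≤ Real.sqrt G + Real.sqrt lam * euclNorm θ := by
    have h1 := sqrt_invNormSq_sub_le hP (noiseSum θ A Y t) (lam • θ)
    rw [← estError] at h1
    refine h1.trans (add_le_add le_rfl ?_)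
    rw [Real.sqrt_le_left (by have := euclNorm_nonneg θ; positivity), mul_pow,
      Real.sq_sqrt hlam.le]
    exact hbias
  have hbig : σ ^ 2 * (Real.log R + 2 * Real.log (1 / δ)) < G := by
    by_contra hcon
    rw [not_lt] at hcon
    have h1 : Real.sqrt G ≤ σ * Real.sqrt (Real.log R + 2 * Real.log (1 / δ)) := by
      rw [Real.sqrt_le_left (by positivity), mul_pow, Real.sq_sqrt (by positivity)]
      exact hcon
    have h2 : U ≤ radius lam σ (euclNorm θ) A t := by
      rw [radius, ← Real.sqrt_le_left (by have := euclNorm_nonneg θ; positivity)]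
      linarith
    linarith
  -- the excess over the threshold, with `e^w = δ M`
  set w := G / (2 * σ ^ 2) - Real.log R / 2 - Real.log (1 / δ) with hw
  have hw0 : 0 < w := by
    have : (Real.log R + 2 * Real.log (1 / δ)) / 2 < G / (2 * σ ^ 2) := by
      rw [div_lt_div_iff₀ (by norm_num) (by positivity)]; nlinarith
    rw [hw]; linarith
  have hMw : Real.exp w = δ * selfNormExp lam σ θ A Y t := by
    rw [hw, Real.exp_sub, Real.exp_sub, Real.exp_log (by positivity), selfNormExp, ← hG, ← hR,
      Real.exp_half, Real.exp_log hR0]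
    field_simp
  have hGw : 2 * G = 4 * σ ^ 2 * (w + Real.log R / 2 + Real.log (1 / δ)) := by
    rw [hw]; field_simp; ring
  have h1 := Real.add_one_le_exp w
  have hexp1 : 1 ≤ Real.exp w := Real.one_le_exp hw0.le
  have hD0 : 0 ≤ D / 2 + Real.log (1 / δ) := by linarith
  calc U ≤ 4 * σ ^ 2 * (w + (D / 2 + Real.log (1 / δ))) + 2 * (lam * euclNorm θ ^ 2) := by
        have : 4 * σ ^ 2 * (w + Real.log R / 2 + Real.log (1 / δ))
            ≤ 4 * σ ^ 2 * (w + (D / 2 + Real.log (1 / δ))) := by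
          gcongr ?_ * ?_; linarith
        linarith
    _ ≤ 4 * σ ^ 2 * (Real.exp w + (D / 2 + Real.log (1 / δ)) * Real.exp w)
        + 2 * (lam * euclNorm θ ^ 2) * Real.exp w := by
        have h2 : D / 2 + Real.log (1 / δ) ≤ (D / 2 + Real.log (1 / δ)) * Real.exp w :=
          le_mul_of_one_le_right hD0 hexp1
        have h3 : 2 * (lam * euclNorm θ ^ 2) ≤ 2 * (lam * euclNorm θ ^ 2) * Real.exp w :=
          le_mul_of_one_le_right (by positivity) hexp1
        gcongr
        linarith
    _ = (4 * σ ^ 2 * (1 + D / 2 + Real.log (1 / δ)) + 2 * (lam * euclNorm θ ^ 2))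
        * Real.exp w := by ring
    _ = _ := by rw [hMw]; ring

section Tail

variable {Ω : Type*} [mΩ : MeasurableSpace Ω] {P : Measure Ω} [IsProbabilityMeasure P]
  {θ : Vec d} {σ : ℝ} {A : ℕ → Ω → Vec d} {Y : ℕ → Ω → ℝ}

/-- The supermartingale property; the quadratic dependence on the new noise variable is handled by
`IsCondSubgaussian.lintegral_exp_quadratic_le`, with equality for Gaussian noise. -/
theorem lintegral_selfNormExp_le {lam : ℝ} (hlam : 0 < lam) (hσ : 0 < σ)
    (hR : IsLinearReward P θ σ A Y) (hA : ∀ t, Measurable (A t)) (t : ℕ) :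
    ∫⁻ ω, ENNReal.ofReal (selfNormExp lam σ θ (fun s => A s ω) (fun s => Y s ω) t) ∂P ≤ 1 := by
  induction t with
  | zero => simp [selfNormExp_zero hlam]
  | succ t ih =>
    refine le_trans ?_ ih
    have hA' : ∀ s < t, Measurable[historyArm A Y t] (A s) := fun s hs =>
      (measurable_history_arm hs).mono (history_le_historyArm t) le_rfl
    have hY' : ∀ s < t, Measurable[historyArm A Y t] (Y s) := fun s hs =>
      (measurable_history_reward hs).mono (history_le_historyArm t) le_rfl
    have hAt := measurable_historyArm_arm (A := A) (Y := Y) t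
    set V : Ω → Matrix (Fin d) (Fin d) ℝ := fun ω => gram lam (fun s => A s ω) t with hV
    have hVm : ∀ i j, Measurable[historyArm A Y t] fun ω => V ω i j := fun i j =>
      measurable_gram_apply lam hA' i j
    have hP : ∀ ω, (V ω).PosDef := fun ω => gram_posDef hlam _ t
    set z : Ω → Vec d := fun ω => noiseSum θ (fun s => A s ω) (fun s => Y s ω) t with hz
    have hzm : Measurable[historyArm A Y t] z := measurable_noiseSum θ hA' hY'
    set v : Ω → ℝ := fun ω => invNormSq (V ω) (A t ω) with hv
    have hvm : Measurable[historyArm A Y t] v := measurable_invNormSq hVm hAt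
    have hv0 : ∀ ω, 0 ≤ v ω := fun ω => invNormSq_nonneg (hP ω) _
    set u : Ω → ℝ := fun ω => A t ω ⬝ᵥ Matrix.mulVec (V ω)⁻¹ (z ω) with hu
    have hum : Measurable[historyArm A Y t] u :=
      measurable_dotProduct hAt (measurable_mulVec (fun i j => measurable_inv_apply hVm i j) hzm)
    set G : Ω → ℝ := fun ω => invNormSq (V ω) (z ω) with hG
    have hGm : Measurable[historyArm A Y t] G := measurable_invNormSq hVm hzm
    set ρ : Ω → ℝ := fun ω => (V ω).det / (gram lam (fun s => A s ω) 0).det with hρ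
    have hρ0 : ∀ ω, 0 < ρ ω := fun ω => div_pos (gram_det_pos hlam _ t) (gram_det_pos hlam _ 0)
    have hρm : Measurable[historyArm A Y t] ρ := (measurable_det hVm).div
      (measurable_det (measurable_gram_apply (A := A) (t := 0) lam (by simp)))
    -- by the rank-one update, the new value is `X exp (b η + c η² / 2)` with `b`, `c` as below;
    -- since `1 - c σ² = 1 / (1 + v)`, the Gaussian bound restores the old determinant factor
    set X : Ω → ENNReal := fun ω => ENNReal.ofReal
      (Real.exp ((G ω - u ω ^ 2 / (1 + v ω)) / (2 * σ ^ 2)) * (Real.sqrt (ρ ω * (1 + v ω)))⁻¹)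
      with hX
    have hXm : Measurable[historyArm A Y t] X := by
      refine Measurable.ennreal_ofReal (Measurable.mul ?_ ?_)
      · exact ((hGm.sub ((hum.pow_const 2).div (hvm.const_add 1))).div_const _).exp
      · exact (hρm.mul (hvm.const_add 1)).sqrt.inv
    have key := (hR.isCondSubgaussian hA t).lintegral_exp_quadratic_le
      (historyArm_le hA hR.measurable_reward t) hXm
      (b := fun ω => u ω / ((1 + v ω) * σ ^ 2)) (c := fun ω => v ω / ((1 + v ω) * σ ^ 2))
      (hum.div ((hvm.const_add 1).mul_const _)) (hvm.div ((hvm.const_add 1).mul_const _))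
      (fun ω => by have := hv0 ω; positivity)
      (fun ω => by
        have := hv0 ω
        rw [div_mul_eq_mul_div, div_lt_one (by positivity)]
        have : 0 < σ ^ 2 := by positivity
        nlinarith)
    refine (le_of_eq ?_).trans (key.trans (le_of_eq ?_))
    · refine lintegral_congr fun ω => ?_
      have hvω := hv0 ω
      rw [hX, ← ENNReal.ofReal_mul (by positivity)]
      congr 1
      have e1 : noiseSum θ (fun s => A s ω) (fun s => Y s ω) (t + 1)
          = z ω + (Y t ω - θ ⬝ᵥ A t ω) • A t ω := by
        rw [noiseSum, Finset.sum_range_succ, ← noiseSum]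
      rw [selfNormExp, gram_det_succ hlam, gram_succ, e1, invNormSq_update (hP ω),
        mul_div_right_comm (gram lam (fun s => A s ω) t).det]
      change Real.exp ((G ω - u ω ^ 2 / (1 + v ω)
        + 2 * (Y t ω - θ ⬝ᵥ A t ω) * u ω / (1 + v ω)
        + (Y t ω - θ ⬝ᵥ A t ω) ^ 2 * v ω / (1 + v ω)) / (2 * σ ^ 2))
        * (Real.sqrt (ρ ω * (1 + v ω)))⁻¹ = _
      rw [mul_right_comm (Real.exp _) _ (Real.exp _), ← Real.exp_add]
      congr 2
      field_simp
      ring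
    · refine lintegral_congr fun ω => ?_
      have hvω := hv0 ω
      rw [hX, ← ENNReal.ofReal_mul (by positivity)]
      congr 1
      rw [selfNormExp]
      change _ = Real.exp (G ω / (2 * σ ^ 2)) * (Real.sqrt (ρ ω))⁻¹
      have e2 : 1 - v ω / ((1 + v ω) * σ ^ 2) * σ ^ 2 = (1 + v ω)⁻¹ := by field_simp; ring
      rw [e2, Real.sqrt_inv, inv_inv, Real.sqrt_mul (hρ0 ω).le]
      have hs : Real.sqrt (1 + v ω) ≠ 0 := by positivity
      have hs' : Real.sqrt (ρ ω) ≠ 0 := by have := hρ0 ω; positivity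
      have e3 : Real.exp (G ω / (2 * σ ^ 2)) = Real.exp ((G ω - u ω ^ 2 / (1 + v ω)) / (2 * σ ^ 2))
          * Real.exp ((u ω / ((1 + v ω) * σ ^ 2)) ^ 2 * σ ^ 2 / (2 * (1 + v ω)⁻¹)) := by
        rw [← Real.exp_add]
        congr 1
        field_simp
        ring
      rw [e3]
      field_simp

/-- The contribution of the rounds in which the estimator is outside of the confidence ellipsoid. -/
theorem integral_estError_outside_le {lam D : ℝ} (hlam : 0 < lam) (hσ : 0 ≤ σ)
    (hR : IsLinearReward P θ σ A Y) (hA : ∀ t, Measurable (A t)) (t : ℕ)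
    (hD : ∀ᵐ ω ∂P, Real.log ((gram lam (fun s => A s ω) t).det
      / (gram lam (fun s => A s ω) 0).det) ≤ D) :
    Integrable (fun ω => if estError lam θ (fun s => A s ω) (fun s => Y s ω) t
        ≤ radius lam σ (euclNorm θ) (fun s => A s ω) t then 0
        else estError lam θ (fun s => A s ω) (fun s => Y s ω) t) P ∧
    ∫ ω, (if estError lam θ (fun s => A s ω) (fun s => Y s ω) t
        ≤ radius lam σ (euclNorm θ) (fun s => A s ω) t then 0
        else estError lam θ (fun s => A s ω) (fun s => Y s ω) t) ∂P
      ≤ failureRate t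
        * (4 * σ ^ 2 * (1 + D / 2 + Real.log (1 / failureRate t)) + 2 * (lam * euclNorm θ ^ 2)) := by
  have hD0 : 0 ≤ D := by
    obtain ⟨ω, hω⟩ := hD.exists
    exact (log_gram_det_ratio_nonneg hlam _ t).trans hω
  have hlδ := log_inv_failureRate_nonneg t
  have hδ0 : 0 < failureRate t := by rw [failureRate]; positivity
  have hUm := measurable_estError lam θ (t := t) (fun s _ => hA s)
    (fun s _ => hR.measurable_reward s)
  have hrm := measurable_radius lam σ (euclNorm θ) (t := t) (fun s _ => hA s)
  set F : Ω → ℝ := fun ω => if estError lam θ (fun s => A s ω) (fun s => Y s ω) t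
        ≤ radius lam σ (euclNorm θ) (fun s => A s ω) t then 0
        else estError lam θ (fun s => A s ω) (fun s => Y s ω) t with hF
  have hFm : Measurable F := Measurable.ite (measurableSet_le hUm hrm) measurable_const hUm
  have hF0 : ∀ ω, 0 ≤ F ω := fun ω => by
    simp only [hF]; split_ifs
    · exact le_rfl
    · exact estError_nonneg hlam _ _ _ _
  rcases hσ.eq_or_lt with h0 | h0
  · -- without noise the error never leaves the ellipsoid; `selfNormExp` would divide by `σ = 0`
    have hη : ∀ s, ∀ᵐ ω ∂P, Y s ω - θ ⬝ᵥ A s ω = 0 := by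
      intro s
      have hsub := hR.isCondSubgaussian hA s
      have h1 := hsub.integral_mul_sq_le (historyArm_le hA hR.measurable_reward s)
        (c := fun _ => 1) measurable_const (by simp) (C := 1) (by simp)
      simp only [one_mul, ← h0] at h1
      have h2 : ∫ ω, (Y s ω - θ ⬝ᵥ A s ω) ^ 2 ∂P = 0 :=
        le_antisymm (by simpa using h1) (integral_nonneg fun ω => sq_nonneg _)
      rw [integral_eq_zero_iff_of_nonneg (fun ω => sq_nonneg _) hsub.integrable_sq] at h2
      filter_upwards [h2] with ω hω
      simpa using hω
    have hF_zero : F =ᵐ[P] fun _ => 0 := by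
      filter_upwards [ae_all_iff.2 hη] with ω hω
      have hn : noiseSum θ (fun s => A s ω) (fun s => Y s ω) t = 0 := by
        simp [noiseSum, hω]
      simp only [hF]
      rw [if_pos]
      have h1 := invNormSq_gram_le hlam (fun s => A s ω) t (-(lam • θ))
      rw [estError, hn, zero_sub]
      refine h1.trans (le_trans (le_of_eq ?_) (mul_sq_le_radius hlam.le hσ (euclNorm_nonneg θ)))
      rw [euclNorm_sq, euclNorm_sq, neg_dotProduct_neg, smul_dotProduct, dotProduct_smul,
        smul_eq_mul, smul_eq_mul]
      field_simp
    refine ⟨(integrable_zero Ω ℝ P).congr hF_zero.symm, ?_⟩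
    rw [integral_congr_ae hF_zero, integral_zero]
    positivity
  · set M : Ω → ℝ := fun ω => selfNormExp lam σ θ (fun s => A s ω) (fun s => Y s ω) t with hM
    have hMm : Measurable M := measurable_selfNormExp lam σ θ (fun s _ => hA s)
      (fun s _ => hR.measurable_reward s)
    have hM0 : ∀ ω, 0 ≤ M ω := fun ω => selfNormExp_nonneg _ _ _ _ _ _
    have hMl := lintegral_selfNormExp_le hlam h0 hR hA t
    have hMi : Integrable M P := by
      refine ⟨hMm.aestronglyMeasurable, ?_⟩
      rw [hasFiniteIntegral_iff_ofReal (Filter.Eventually.of_forall hM0)]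
      exact hMl.trans_lt ENNReal.one_lt_top
    have hM1 : ∫ ω, M ω ∂P ≤ 1 := by
      rw [integral_eq_lintegral_of_nonneg_ae (Filter.Eventually.of_forall hM0)
        hMm.aestronglyMeasurable]
      exact ENNReal.toReal_le_of_le_ofReal zero_le_one (by simpa using hMl)
    set κ := failureRate t
        * (4 * σ ^ 2 * (1 + D / 2 + Real.log (1 / failureRate t)) + 2 * (lam * euclNorm θ ^ 2))
      with hκ
    have hκ0 : 0 ≤ κ := by positivity
    have hFM : ∀ᵐ ω ∂P, F ω ≤ κ * M ω := by
      filter_upwards [hD] with ω hω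
      simp only [hF]
      split_ifs with h
      · exact mul_nonneg hκ0 (hM0 ω)
      · exact estError_le_of_radius_lt hlam h0 θ _ _ t hω (not_le.1 h)
    have hFi : Integrable F P := by
      refine (hMi.const_mul κ).mono' hFm.aestronglyMeasurable ?_
      filter_upwards [hFM] with ω hω
      rwa [Real.norm_of_nonneg (hF0 ω)]
    refine ⟨hFi, (integral_mono_ae hFi (hMi.const_mul κ) hFM).trans ?_⟩
    rw [integral_const_mul]
    exact mul_le_of_le_one_right hκ0 hM1

end Tail

/-! ### Averages over the sampling distribution -/

section Tower

variable {Ω : Type*} {m mΩ : MeasurableSpace Ω} {P : Measure Ω} [IsProbabilityMeasure P]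

/-- The expectation of a function of the past and of the sampled arm is the expectation of its
average over the sampling distribution. -/
theorem integral_sampled_eq (hm : m ≤ mΩ) {arms : Finset (Vec d)} {X : Ω → Vec d}
    (hX : Measurable X) (hmem : ∀ᵐ ω ∂P, X ω ∈ arms) {p : Ω → Vec d → ℝ}
    (hlaw : ∀ a ∈ arms, condExp m P (Set.indicator {ω | X ω = a} fun _ => (1 : ℝ))
      =ᵐ[P] fun ω => p ω a) {φ : Ω → Vec d → ℝ} (hφ : ∀ a ∈ arms, Measurable[m] fun ω => φ ω a)
    {C : ℝ} (hC : ∀ᵐ ω ∂P, ∀ a ∈ arms, |φ ω a| ≤ C) :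
    Integrable (fun ω => ∑ a ∈ arms, p ω a * φ ω a) P ∧
      ∫ ω, φ ω (X ω) ∂P = ∫ ω, ∑ a ∈ arms, p ω a * φ ω a ∂P := by
  classical
  have hset : ∀ a, MeasurableSet {ω | X ω = a} := fun a => hX (measurableSet_singleton a)
  have hind : ∀ a, Integrable (Set.indicator {ω | X ω = a} fun _ => (1 : ℝ)) P := fun a =>
    (integrable_const (1 : ℝ)).indicator (hset a)
  have hCa : ∀ a ∈ arms, ∀ᵐ ω ∂P, ‖φ ω a‖ ≤ C := fun a ha => by
    filter_upwards [hC] with ω hω using hω a ha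
  have hpull : ∀ a ∈ arms,
      condExp m P ((fun ω => φ ω a) * Set.indicator {ω | X ω = a} fun _ => (1 : ℝ))
        =ᵐ[P] fun ω => p ω a * φ ω a := by
    intro a ha
    filter_upwards [condExp_stronglyMeasurable_mul_of_bound hm (hφ a ha).stronglyMeasurable
      (hind a) C (hCa a ha), hlaw a ha] with ω h1 h2
    rw [h1, Pi.mul_apply, h2, mul_comm]
  have hpint : ∀ a ∈ arms, Integrable (fun ω => p ω a * φ ω a) P := fun a ha =>
    integrable_condExp.congr (hpull a ha)
  have hpint' : ∀ a ∈ arms,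
      Integrable ((fun ω => φ ω a) * Set.indicator {ω | X ω = a} fun _ => (1 : ℝ)) P :=
    fun a ha => (hind a).bdd_mul ((hφ a ha).mono hm le_rfl).aestronglyMeasurable (hCa a ha)
  refine ⟨integrable_finsetSum _ hpint, ?_⟩
  have e : (fun ω => φ ω (X ω)) =ᵐ[P] fun ω =>
      ∑ a ∈ arms, ((fun ω => φ ω a) * Set.indicator {ω | X ω = a} fun _ => (1 : ℝ)) ω := by
    filter_upwards [hmem] with ω hω
    rw [Finset.sum_eq_single_of_mem (X ω) hω]
    · simp
    · intro b _ hb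
      have : X ω ≠ b := fun h => hb h.symm
      simp [this]
  rw [integral_congr_ae e, integral_finsetSum _ hpint', integral_finsetSum _ hpint]
  refine Finset.sum_congr rfl fun a ha => ?_
  rw [← integral_condExp hm, integral_congr_ae (hpull a ha)]

end Tower

/-! ### The total squared prediction error -/

/-- Abel summation: increasing weights of the decrements of a sequence with values in `[0, b]`. -/
theorem sum_mul_sub_le {h Φ : ℕ → ℝ} (hh : Monotone h) {b : ℝ} (h0 : 0 ≤ h 0) (hΦ0 : ∀ t, 0 ≤ Φ t)
    (hΦb : ∀ t, Φ t ≤ b) (n : ℕ) :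
    ∑ t ∈ Finset.range (n + 1), h t * (Φ t - Φ (t + 1)) ≤ b * h n := by
  have key : ∑ t ∈ Finset.range (n + 1), h t * (Φ t - Φ (t + 1)) ≤ b * h n - h n * Φ (n + 1) := by
    induction n with
    | zero => simp; nlinarith [hΦb 0]
    | succ n ih =>
      rw [Finset.sum_range_succ]
      have h1 := mul_nonneg (sub_nonneg.2 (hh n.le_succ)) (sub_nonneg.2 (hΦb (n + 1)))
      simp only [Nat.succ_eq_add_one] at h1
      linarith
  have := mul_nonneg (h0.trans (hh (Nat.zero_le n))) (hΦ0 (n + 1))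
  linarith

/-- One step of the truncated error `min U b`, as long as `U ≤ b`. -/
theorem min_estError_succ_le {lam : ℝ} (hlam : 0 < lam) (θ : Vec d) (A : ℕ → Vec d) (Y : ℕ → ℝ)
    (t : ℕ) {b h : ℝ} (hh : 0 ≤ h) :
    h * (if estError lam θ A Y t ≤ b then
        ((θ - ridge lam A Y t) ⬝ᵥ A t) ^ 2 / (1 + invNormSq (gram lam A t) (A t)) else 0)
      ≤ h * (min (estError lam θ A Y t) b - min (estError lam θ A Y (t + 1)) b)
        + (if estError lam θ A Y t ≤ b then h * (-(2 * ((θ - ridge lam A Y t) ⬝ᵥ A t))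
            / (1 + invNormSq (gram lam A t) (A t))) else 0) * (Y t - θ ⬝ᵥ A t)
        + h * (invNormSq (gram lam A t) (A t) / (1 + invNormSq (gram lam A t) (A t)))
          * (Y t - θ ⬝ᵥ A t) ^ 2 := by
  have hv := invNormSq_nonneg (gram_posDef hlam A t) (A t)
  split_ifs with hU
  · obtain ⟨q, hq⟩ : ∃ q, min (estError lam θ A Y (t + 1)) b = q := ⟨_, rfl⟩
    have h1 : q ≤ estError lam θ A Y (t + 1) := hq ▸ min_le_left _ _
    rw [estError_succ hlam] at h1
    rw [hq]
    rw [min_eq_left hU]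
    have h2 := mul_le_mul_of_nonneg_left h1 hh
    refine le_of_sub_nonneg ?_
    refine (sub_nonneg.2 h2).trans (le_of_eq ?_)
    ring
  · rw [min_eq_right (not_le.1 hU).le]
    have h1 : min (estError lam θ A Y (t + 1)) b ≤ b := min_le_right _ _
    have h2 := mul_nonneg hh (sub_nonneg.2 h1)
    have h3 : 0 ≤ h * (invNormSq (gram lam A t) (A t) / (1 + invNormSq (gram lam A t) (A t)))
          * (Y t - θ ⬝ᵥ A t) ^ 2 := by positivity
    rw [mul_zero, zero_mul]
    linarith

section Potential

variable {Ω : Type*} [mΩ : MeasurableSpace Ω] {P : Measure Ω} [IsProbabilityMeasure P]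
  {θ : Vec d} {σ : ℝ} {A : ℕ → Ω → Vec d} {Y : ℕ → Ω → ℝ}

/-- Total squared prediction error of the ridge estimator on the rounds in which its error is at
most `b`, with increasing weights that depend on the past. The truncated error `min U b` serves as
potential, which keeps the weights from being multiplied by the rare large values of `U`. -/
theorem sum_integral_sq_predError_le {lam : ℝ} (hlam : 0 < lam) (hR : IsLinearReward P θ σ A Y)
    (hA : ∀ t, Measurable (A t)) (hA1 : ∀ᵐ ω ∂P, ∀ t, euclNorm (A t ω) ≤ 1) {b D : ℝ} (hb : 0 ≤ b)
    {n : ℕ} (hD : ∀ᵐ ω ∂P, Real.log ((gram lam (fun s => A s ω) (n + 1)).det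
      / (gram lam (fun s => A s ω) 0).det) ≤ D) {H : ℕ → Ω → ℝ}
    (hHm : ∀ t, Measurable[history A Y t] (H t)) (hH0 : ∀ ω, 0 ≤ H 0 ω)
    (hHmono : ∀ ω, Monotone fun t => H t ω) {C : ℝ} (hHC : ∀ᵐ ω ∂P, H n ω ≤ C) :
    (∀ t ≤ n, Integrable (fun ω => H t ω
        * (if estError lam θ (fun s => A s ω) (fun s => Y s ω) t ≤ b then
          ((θ - ridge lam (fun s => A s ω) (fun s => Y s ω) t) ⬝ᵥ A t ω) ^ 2
            / (1 + invNormSq (gram lam (fun s => A s ω) t) (A t ω)) else 0)) P) ∧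
    ∑ t ∈ Finset.range (n + 1), ∫ ω, H t ω
        * (if estError lam θ (fun s => A s ω) (fun s => Y s ω) t ≤ b then
          ((θ - ridge lam (fun s => A s ω) (fun s => Y s ω) t) ⬝ᵥ A t ω) ^ 2
            / (1 + invNormSq (gram lam (fun s => A s ω) t) (A t ω)) else 0) ∂P
      ≤ (b + σ ^ 2 * D) * ∫ ω, H n ω ∂P := by
  set U : ℕ → Ω → ℝ := fun t ω => estError lam θ (fun s => A s ω) (fun s => Y s ω) t with hUdef
  set v : ℕ → Ω → ℝ := fun t ω => invNormSq (gram lam (fun s => A s ω) t) (A t ω) with hvdef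
  set e : ℕ → Ω → ℝ := fun t ω =>
    (θ - ridge lam (fun s => A s ω) (fun s => Y s ω) t) ⬝ᵥ A t ω with hedef
  set η : ℕ → Ω → ℝ := fun t ω => Y t ω - θ ⬝ᵥ A t ω with hηdef
  have hv0 : ∀ t ω, 0 ≤ v t ω := fun t ω => invNormSq_nonneg (gram_posDef hlam _ t) _
  have hU0 : ∀ t ω, 0 ≤ U t ω := fun t ω => estError_nonneg hlam _ _ _ t
  have hH0' : ∀ t ω, 0 ≤ H t ω := fun t ω => (hH0 ω).trans (hHmono ω (Nat.zero_le t))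
  have hv1 : ∀ t ω, v t ω / (1 + v t ω) ≤ 1 := fun t ω => by
    have := hv0 t ω
    rw [div_le_one (by linarith)]; linarith
  have hv1' : ∀ t ω, 0 ≤ v t ω / (1 + v t ω) := fun t ω => by have := hv0 t ω; positivity
  -- measurability with respect to the past and the current arm
  have hA' : ∀ t, ∀ s < t, Measurable[historyArm A Y t] (A s) := fun t s hs =>
    (measurable_history_arm hs).mono (history_le_historyArm t) le_rfl
  have hY' : ∀ t, ∀ s < t, Measurable[historyArm A Y t] (Y s) := fun t s hs =>
    (measurable_history_reward hs).mono (history_le_historyArm t) le_rfl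
  have hAt : ∀ t, Measurable[historyArm A Y t] (A t) := fun t => measurable_historyArm_arm t
  have hUm : ∀ t, Measurable[historyArm A Y t] (U t) := fun t =>
    measurable_estError lam θ (hA' t) (hY' t)
  have hvm : ∀ t, Measurable[historyArm A Y t] (v t) := fun t =>
    measurable_leverage lam (hA' t) (hAt t)
  have hem : ∀ t, Measurable[historyArm A Y t] (e t) := fun t =>
    measurable_dotProduct (measurable_const.sub (measurable_ridge lam (hA' t) (hY' t))) (hAt t)
  have hHm' : ∀ t, Measurable[historyArm A Y t] (H t) := fun t =>
    (hHm t).mono (history_le_historyArm t) le_rfl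
  have hle : ∀ t, historyArm A Y t ≤ mΩ := historyArm_le hA hR.measurable_reward
  set c1 : ℕ → Ω → ℝ := fun t ω =>
    if U t ω ≤ b then H t ω * (-(2 * e t ω) / (1 + v t ω)) else 0 with hc1
  set c2 : ℕ → Ω → ℝ := fun t ω => H t ω * (v t ω / (1 + v t ω)) with hc2
  set T : ℕ → Ω → ℝ := fun t ω =>
    H t ω * (if U t ω ≤ b then e t ω ^ 2 / (1 + v t ω) else 0) with hT
  have hset : ∀ t, MeasurableSet[historyArm A Y t] {ω | U t ω ≤ b} := fun t =>
    measurableSet_le (hUm t) measurable_const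
  have hc1m : ∀ t, Measurable[historyArm A Y t] (c1 t) := fun t =>
    Measurable.ite (hset t) ((hHm' t).mul
      (((hem t).const_mul 2).neg.div ((hvm t).const_add 1))) measurable_const
  have hc2m : ∀ t, Measurable[historyArm A Y t] (c2 t) := fun t =>
    (hHm' t).mul ((hvm t).div ((hvm t).const_add 1))
  have hTm : ∀ t, Measurable[historyArm A Y t] (T t) := fun t =>
    (hHm' t).mul (Measurable.ite (hset t)
      (((hem t).pow_const 2).div ((hvm t).const_add 1)) measurable_const)
  -- bounds
  have hHle : ∀ t ≤ n, ∀ᵐ ω ∂P, H t ω ≤ C := fun t ht => by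
    filter_upwards [hHC] with ω hω using (hHmono ω ht).trans hω
  have hC0 : 0 ≤ C := by
    obtain ⟨ω, hω⟩ := hHC.exists
    exact (hH0' n ω).trans hω
  have hesq : ∀ t, ∀ᵐ ω ∂P, U t ω ≤ b → e t ω ^ 2 ≤ b / lam := fun t => by
    filter_upwards [hA1] with ω hω hUb
    refine (sq_predError_le hlam θ _ _ t (A t ω)).trans ?_
    have h1 := invNormSq_gram_le hlam (fun s => A s ω) t (A t ω)
    have h2 : euclNorm (A t ω) ^ 2 ≤ 1 := by
      have := hω t; have := euclNorm_nonneg (A t ω); nlinarith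
    have h3 : v t ω ≤ 1 / lam := h1.trans (by gcongr)
    calc U t ω * v t ω ≤ b * (1 / lam) := by
          have := hv0 t ω; gcongr
      _ = b / lam := by ring
  have hbl : 0 ≤ b / lam := by positivity
  have hc1b : ∀ t ≤ n, ∀ᵐ ω ∂P, |c1 t ω| ≤ C * (1 + b / lam) := fun t ht => by
    filter_upwards [hHle t ht, hesq t] with ω h1 h2
    simp only [hc1]
    split_ifs with hU
    · have h3 := h2 hU
      have h4 := hH0' t ω
      have h5 := hv0 t ω
      rw [abs_mul, abs_of_nonneg h4, abs_div, abs_neg, abs_of_pos (by linarith : 0 < 1 + v t ω)]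
      gcongr
      rw [div_le_iff₀ (by linarith)]
      have h6 : |2 * e t ω| ≤ 1 + b / lam := by
        rw [abs_le]; constructor <;> nlinarith [sq_nonneg (e t ω + 1), sq_nonneg (e t ω - 1)]
      nlinarith
    · simp; positivity
  have hc2b : ∀ t ≤ n, ∀ᵐ ω ∂P, |c2 t ω| ≤ C := fun t ht => by
    filter_upwards [hHle t ht] with ω h1
    have h4 := hH0' t ω
    rw [hc2, abs_of_nonneg (mul_nonneg h4 (hv1' t ω))]
    exact (mul_le_of_le_one_right h4 (hv1 t ω)).trans h1
  have hTb : ∀ t ≤ n, ∀ᵐ ω ∂P, |T t ω| ≤ C * (b / lam) := fun t ht => by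
    filter_upwards [hHle t ht, hesq t] with ω h1 h2
    have h4 := hH0' t ω
    have h5 := hv0 t ω
    simp only [hT]
    rw [abs_mul, abs_of_nonneg h4]
    gcongr
    split_ifs with hU
    · rw [abs_of_nonneg (by positivity)]
      exact (div_le_self (sq_nonneg _) (by linarith)).trans (h2 hU)
    · simpa using hbl
  have hΦ0 : ∀ t ω, 0 ≤ min (U t ω) b := fun t ω => le_min (hU0 t ω) hb
  have hΦb : ∀ t ω, min (U t ω) b ≤ b := fun t ω => min_le_right _ _
  have hUm' : ∀ t, Measurable (U t) := fun t => (hUm t).mono (hle t) le_rfl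
  have hHm'' : ∀ t, Measurable (H t) := fun t => (hHm' t).mono (hle t) le_rfl
  -- integrability
  have hTi : ∀ t ≤ n, Integrable (T t) P := fun t ht =>
    Integrable.of_bound ((hTm t).mono (hle t) le_rfl).aestronglyMeasurable _ (hTb t ht)
  have hc2i : ∀ t ≤ n, Integrable (c2 t) P := fun t ht =>
    Integrable.of_bound ((hc2m t).mono (hle t) le_rfl).aestronglyMeasurable _ (hc2b t ht)
  have hsub := fun t => hR.isCondSubgaussian hA t
  have hDi : ∀ t ≤ n, Integrable
      (fun ω => H t ω * (min (U t ω) b - min (U (t + 1) ω) b)) P := fun t ht => by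
    refine Integrable.of_bound (C := C * b) ?_ ?_
    · exact ((hHm'' t).mul (((hUm' t).min measurable_const).sub
        ((hUm' (t + 1)).min measurable_const))).aestronglyMeasurable
    · filter_upwards [hHle t ht] with ω h1
      have h4 := hH0' t ω
      rw [Real.norm_eq_abs, abs_mul, abs_of_nonneg h4]
      gcongr
      rw [abs_le]
      constructor <;> linarith [hΦ0 t ω, hΦb t ω, hΦ0 (t + 1) ω, hΦb (t + 1) ω]
  have hc1ηi : ∀ t ≤ n, Integrable (fun ω => c1 t ω * η t ω) P := fun t ht =>
    (hsub t).integrable.bdd_mul ((hc1m t).mono (hle t) le_rfl).aestronglyMeasurable (hc1b t ht)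
  have hc2ηi : ∀ t ≤ n, Integrable (fun ω => c2 t ω * η t ω ^ 2) P := fun t ht =>
    (hsub t).integrable_sq.bdd_mul ((hc2m t).mono (hle t) le_rfl).aestronglyMeasurable (hc2b t ht)
  have hstep : ∀ t ≤ n, ∫ ω, T t ω ∂P
      ≤ ∫ ω, H t ω * (min (U t ω) b - min (U (t + 1) ω) b) ∂P + σ ^ 2 * ∫ ω, c2 t ω ∂P := by
    intro t ht
    have h1 : ∫ ω, T t ω ∂P ≤ ∫ ω, (H t ω * (min (U t ω) b - min (U (t + 1) ω) b)
        + c1 t ω * η t ω + c2 t ω * η t ω ^ 2) ∂P := by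
      refine integral_mono (hTi t ht) (((hDi t ht).add (hc1ηi t ht)).add (hc2ηi t ht)) fun ω => ?_
      exact min_estError_succ_le hlam θ _ _ t (hH0' t ω)
    have i1 := hDi t ht
    have i2 := hc1ηi t ht
    have i3 := hc2ηi t ht
    have i12 : Integrable (fun ω => H t ω * (min (U t ω) b - min (U (t + 1) ω) b)
        + c1 t ω * η t ω) P := i1.add i2
    rw [integral_add i12 i3, integral_add i1 i2,
      (hsub t).integral_mul_eq_zero (hle t) (hc1m t) (hc1b t ht), add_zero] at h1
    have h2 := (hsub t).integral_mul_sq_le (hle t) (hc2m t)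
      (Filter.Eventually.of_forall fun ω => mul_nonneg (hH0' t ω) (hv1' t ω)) (hc2b t ht)
    linarith
  have hHi : Integrable (H n) P := by
    refine Integrable.of_bound (C := C) (hHm'' n).aestronglyMeasurable ?_
    filter_upwards [hHC] with ω h1
    rwa [Real.norm_of_nonneg (hH0' n ω)]
  have hmem : ∀ t ∈ Finset.range (n + 1), t ≤ n := fun t ht =>
    Nat.lt_succ_iff.1 (Finset.mem_range.1 ht)
  refine ⟨hTi, ?_⟩
  calc ∑ t ∈ Finset.range (n + 1), ∫ ω, T t ω ∂P
      ≤ ∑ t ∈ Finset.range (n + 1), (∫ ω, H t ω * (min (U t ω) b - min (U (t + 1) ω) b) ∂P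
          + σ ^ 2 * ∫ ω, c2 t ω ∂P) := Finset.sum_le_sum fun t ht => hstep t (hmem t ht)
    _ = ∫ ω, ∑ t ∈ Finset.range (n + 1), H t ω * (min (U t ω) b - min (U (t + 1) ω) b) ∂P
          + σ ^ 2 * ∫ ω, ∑ t ∈ Finset.range (n + 1), c2 t ω ∂P := by
        rw [Finset.sum_add_distrib, ← Finset.mul_sum,
          integral_finsetSum _ fun t ht => hDi t (hmem t ht),
          integral_finsetSum _ fun t ht => hc2i t (hmem t ht)]
    _ ≤ ∫ ω, b * H n ω ∂P + σ ^ 2 * ∫ ω, D * H n ω ∂P := by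
        refine add_le_add ?_ (mul_le_mul_of_nonneg_left ?_ (sq_nonneg σ))
        · refine integral_mono (integrable_finsetSum _ fun t ht => hDi t (hmem t ht))
            (hHi.const_mul b) fun ω => ?_
          exact sum_mul_sub_le (hHmono ω) (hH0 ω) (fun t => hΦ0 t ω) (fun t => hΦb t ω) n
        · refine integral_mono_ae (integrable_finsetSum _ fun t ht => hc2i t (hmem t ht))
            (hHi.const_mul D) ?_
          filter_upwards [hD] with ω hω
          calc ∑ t ∈ Finset.range (n + 1), c2 t ω
              ≤ ∑ t ∈ Finset.range (n + 1), H n ω * (v t ω / (1 + v t ω)) :=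
                Finset.sum_le_sum fun t ht =>
                  mul_le_mul_of_nonneg_right (hHmono ω (hmem t ht)) (hv1' t ω)
            _ = H n ω * ∑ t ∈ Finset.range (n + 1), v t ω / (1 + v t ω) := by
                rw [Finset.mul_sum]
            _ ≤ H n ω * D := mul_le_mul_of_nonneg_left
                ((sum_div_one_add_le hlam _ (n + 1)).trans hω) (hH0' n ω)
            _ = D * H n ω := mul_comm _ _
    _ = (b + σ ^ 2 * D) * ∫ ω, H n ω ∂P := by
        rw [integral_const_mul, integral_const_mul]; ring

end Potential

/-! ### Gaps -/

section Gap

variable {arms : ℕ → Finset (Vec d)} {θ : Vec d}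

theorem exists_best_arm (hne : ∀ t, (arms t).Nonempty) (θ : Vec d) (t : ℕ) :
    ∃ astar ∈ arms t, (∀ a ∈ arms t, θ ⬝ᵥ a ≤ θ ⬝ᵥ astar) ∧
      ∀ a, gap arms θ t a = θ ⬝ᵥ astar - θ ⬝ᵥ a := by
  obtain ⟨astar, hmem, hmax⟩ := (arms t).exists_max_image (fun a => θ ⬝ᵥ a) (hne t)
  refine ⟨astar, hmem, hmax, fun a => ?_⟩
  have : IsGreatest ((fun a' => θ ⬝ᵥ a') '' (arms t : Set (Vec d))) (θ ⬝ᵥ astar) :=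
    ⟨⟨astar, hmem, rfl⟩, by rintro _ ⟨b, hb, rfl⟩; exact hmax b hb⟩
  rw [gap, this.csSup_eq]

theorem gap_nonneg (hne : ∀ t, (arms t).Nonempty) (t : ℕ) {a : Vec d} (ha : a ∈ arms t) :
    0 ≤ gap arms θ t a := by
  obtain ⟨astar, -, hmax, hgap⟩ := exists_best_arm hne θ t
  rw [hgap]
  exact sub_nonneg.2 (hmax a ha)

theorem finite_positive_gaps (arms : ℕ → Finset (Vec d)) (θ : Vec d) (n : ℕ) :
    {x : ℝ | ∃ t < n, ∃ a ∈ arms t, 0 < gap arms θ t a ∧ x = gap arms θ t a}.Finite := by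
  refine Set.Finite.subset (s := ⋃ t ∈ Finset.range n, gap arms θ t '' (arms t : Set (Vec d)))
    (Set.Finite.biUnion (Finset.finite_toSet _) fun t _ => (Finset.finite_toSet _).image _) ?_
  rintro x ⟨t, ht, a, ha, -, rfl⟩
  exact Set.mem_biUnion (Finset.mem_coe.2 (Finset.mem_range.2 ht)) ⟨a, ha, rfl⟩

theorem minGap_nonneg (arms : ℕ → Finset (Vec d)) (θ : Vec d) (n : ℕ) : 0 ≤ minGap arms θ n :=
  Real.sInf_nonneg (by rintro x ⟨t, -, a, -, h, rfl⟩; exact h.le)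

theorem minGap_pos_and_le {n t : ℕ} (ht : t < n) {a : Vec d} (ha : a ∈ arms t)
    (h : 0 < gap arms θ t a) : 0 < minGap arms θ n ∧ minGap arms θ n ≤ gap arms θ t a := by
  have hmem : gap arms θ t a
      ∈ {x : ℝ | ∃ t < n, ∃ a ∈ arms t, 0 < gap arms θ t a ∧ x = gap arms θ t a} :=
    ⟨t, ht, a, ha, h, rfl⟩
  have hfin := finite_positive_gaps arms θ n
  constructor
  · obtain ⟨s, -, b, -, hb, he⟩ := (Set.nonempty_of_mem hmem).csInf_mem hfin
    rw [minGap, he]; exact hb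
  · exact csInf_le hfin.bddBelow hmem

end Gap

/-! ### The sampling distribution of a round -/

section Sampling

variable {lam σ S αopt αemp Copt csupp : ℝ} {ksupp : ℕ} {design : Finset (Vec d) → Vec d → ℝ}
  {arms : Finset (Vec d)} {A : ℕ → Vec d} {Y : ℕ → ℝ} {t : ℕ} {ahat bsel : Vec d}
  {qopt : Vec d → ℝ}

theorem tilted_nonneg_of_mixture (hlam : 0 < lam) (hαo : 0 < αopt) (hαe : 0 < αemp)
    (hα : αopt + αemp ≤ 1) (hD : IsDesignOracle Copt csupp ksupp design)
    (hq : IsRoundDesign lam σ S design arms A Y t ahat qopt) (hmem : ahat ∈ arms) {a : Vec d}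
    (ha : a ∈ arms) :
    0 ≤ tilted arms (mixture αopt αemp arms qopt ahat) (weight lam σ S A Y t ahat) a := by
  have hq0 : ∀ a ∈ arms, 0 ≤ mixture αopt αemp arms qopt ahat a := fun a ha =>
    (mul_nonneg hαo.le (hq.nonneg a ha)).trans
      (mixture_ge hαo.le hαe.le hα ahat (hq.nonneg a ha)).1
  have hden := tilted_denominator_mem hq0 (sum_mixture hmem (hq.sum_eq_one hD ⟨ahat, hmem⟩))
    (fun a => weight_pos (lam := lam) (σ := σ) (S := S) (A := A) (Y := Y) (t := t) ahat a)
    (fun a => weight_le_one hlam ahat a) hmem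
    ((mixture_ge hαo.le hαe.le hα ahat (hq.nonneg _ hmem)).2 rfl) (weight_self ahat)
  exact (mul_nonneg (hq0 a ha) (weight_pos ahat a).le).trans
    (mul_le_tilted hq0 (fun a => weight_pos ahat a) hαe hden ha)

/-- When there is an underexplored arm, such arms are sampled with probability at least `1/2`. -/
theorem half_le_sum_samplingProb (hlam : 0 < lam) (hαo : 0 < αopt) (hαe : 0 < αemp)
    (hα : αopt + αemp ≤ 1) (hD : IsDesignOracle Copt csupp ksupp design)
    (hq : IsRoundDesign lam σ S design arms A Y t ahat qopt) (hmem : ahat ∈ arms)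
    (hburn : (underexplored arms (gram lam A t)).Nonempty)
    (hb : bsel ∈ underexplored arms (gram lam A t)) :
    1 / 2 ≤ ∑ a ∈ arms, samplingProb lam σ S αopt αemp arms A Y t ahat qopt bsel a
      * (if 1 < invNormSq (gram lam A t) a then 1 else 0) := by
  have hp0 : ∀ a ∈ arms,
      (if a = bsel then 1 / 2 else 0)
        ≤ samplingProb lam σ S αopt αemp arms A Y t ahat qopt bsel a := by
    intro a ha
    have h0 := tilted_nonneg_of_mixture hlam hαo hαe hα hD hq hmem ha
    rw [samplingProb]
    simp only [hburn, if_true]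
    split_ifs <;> linarith
  have h1 : (1 : ℝ) / 2 ≤ samplingProb lam σ S αopt αemp arms A Y t ahat qopt bsel bsel
      * (if 1 < invNormSq (gram lam A t) bsel then 1 else 0) := by
    rw [if_pos hb.2, mul_one]
    simpa using hp0 bsel hb.1
  refine h1.trans (Finset.single_le_sum (f := fun a =>
    samplingProb lam σ S αopt αemp arms A Y t ahat qopt bsel a
      * (if 1 < invNormSq (gram lam A t) a then 1 else 0)) (fun a ha => ?_) hb.1)
  refine mul_nonneg (le_trans ?_ (hp0 a ha)) ?_
  · split_ifs <;> norm_num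
  · split_ifs <;> norm_num

theorem samplingProb_of_explored (h : ¬ (underexplored arms (gram lam A t)).Nonempty) :
    samplingProb lam σ S αopt αemp arms A Y t ahat qopt bsel
      = tilted arms (mixture αopt αemp arms qopt ahat) (weight lam σ S A Y t ahat) := by
  funext a
  simp [samplingProb, h]

theorem invNormSq_le_one_of_explored (h : ¬ (underexplored arms (gram lam A t)).Nonempty)
    {a : Vec d} (ha : a ∈ arms) : invNormSq (gram lam A t) a ≤ 1 := by
  by_contra hcon
  exact h ⟨a, ha, not_le.1 hcon⟩

end Sampling

theorem measurableSet_underexplored {Ω : Type*} {m : MeasurableSpace Ω} {A : ℕ → Ω → Vec d} {t : ℕ}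
    (lam : ℝ) (arms : Finset (Vec d)) (hA : ∀ s < t, Measurable (A s)) :
    MeasurableSet {ω | (underexplored arms (gram lam (fun s => A s ω) t)).Nonempty} := by
  have e : {ω | (underexplored arms (gram lam (fun s => A s ω) t)).Nonempty}
      = ⋃ a ∈ arms, {ω | 1 < invNormSq (gram lam (fun s => A s ω) t) a} := by
    ext ω
    simp [underexplored, Set.Nonempty]
  rw [e]
  exact Finset.measurableSet_biUnion _ fun a _ =>
    measurableSet_lt measurable_const (measurable_leverage lam hA measurable_const)

/-! ### The expected regret of one round -/

section ExpectedRound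

open scoped Classical in
/-- Expected regret of one round, with every summand in terms of the played arm. -/
theorem integral_gap_le {Ω : Type*} [MeasurableSpace Ω] {P : Measure Ω} [IsProbabilityMeasure P]
    {lam σ S σs αopt αemp Copt csupp B : ℝ} {ksupp : ℕ} {design : Finset (Vec d) → Vec d → ℝ}
    {arms : ℕ → Finset (Vec d)} {θ : Vec d} {A : ℕ → Ω → Vec d} {Y : ℕ → Ω → ℝ}
    {ahat : ℕ → Ω → Vec d} {qopt : ℕ → Ω → Vec d → ℝ} {bsel : ℕ → Ω → Vec d}
    (hlam : 0 < lam) (hσ : 0 ≤ σ) (hS : 0 < S) (hσs : 0 ≤ σs) (hαo : 0 < αopt) (hαe : 0 < αemp)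
    (hα : αopt + αemp ≤ 1) (hO : IsDesignOracle Copt csupp ksupp design)
    (hne : ∀ t, (arms t).Nonempty) (hB : ∀ t, ∀ a ∈ arms t, gap arms θ t a ≤ B)
    (hR : IsLinearReward P θ σs A Y)
    (hM : IsLinMED P lam σ S αopt αemp design arms A Y ahat qopt bsel) {Δ : ℝ} (hΔ : 0 < Δ) {t : ℕ}
    (hgap : ∀ a ∈ arms t, 0 < gap arms θ t a → Δ ≤ gap arms θ t a) {L : ℝ} (hL : 1 ≤ L) {β b D : ℝ}
    (hβ : ∀ᵐ ω ∂P, radius lam σ S (fun s => A s ω) t ≤ β)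
    (hb : ∀ᵐ ω ∂P, radius lam σs (euclNorm θ) (fun s => A s ω) t ≤ b)
    (hD : ∀ᵐ ω ∂P, Real.log ((gram lam (fun s => A s ω) t).det
      / (gram lam (fun s => A s ω) 0).det) ≤ D) :
    ∫ ω, gap arms θ t (A t ω) ∂P
      ≤ 2 * B * ∫ ω, (if 1 < invNormSq (gram lam (fun s => A s ω) t) (A t ω) then 1 else 0) ∂P
        + 16 * β * L / (Δ * αemp) * (Real.exp (-L)
          + 2 * ∫ ω, (if (underexplored (arms t) (gram lam (fun s => A s ω) t)).Nonempty then 0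
              else largeNormSq (gram lam (fun s => A s ω) t) (Δ ^ 2 / (16 * β * L)) (A t ω)) ∂P)
        + 8 / Δ * ((|Copt| * d * Real.log d / αopt + 1)
          * ∫ ω, (if (underexplored (arms t) (gram lam (fun s => A s ω) t)).Nonempty then 0
              else if estError lam θ (fun s => A s ω) (fun s => Y s ω) t
                ≤ radius lam σs (euclNorm θ) (fun s => A s ω) t then
              Real.exp (radius lam σs (euclNorm θ) (fun s => A s ω) t
                  / radius lam σ S (fun s => A s ω) t)
                * ((θ - ridge lam (fun s => A s ω) (fun s => Y s ω) t) ⬝ᵥ A t ω) ^ 2 else 0) ∂P)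
        + 16 / Δ * (failureRate t * (4 * σs ^ 2 * (1 + D / 2 + Real.log (1 / failureRate t))
          + 2 * (lam * euclNorm θ ^ 2))) := by
  have hAm := hM.measurable_arm
  have hYm := hR.measurable_reward
  have hle := history_le hAm hYm t
  have hA' : ∀ s < t, Measurable[history A Y t] (A s) := fun s hs => measurable_history_arm hs
  have hY' : ∀ s < t, Measurable[history A Y t] (Y s) := fun s hs => measurable_history_reward hs
  obtain ⟨astar, hstar, hbest, hgap_eq⟩ := exists_best_arm hne θ t
  have hq : ∀ ω, IsRoundDesign lam σ S design (arms t) (fun s => A s ω) (fun s => Y s ω) t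
      (ahat t ω) (qopt t ω) := fun ω => ⟨hM.qopt_nonneg t ω, hM.qopt_design t ω⟩
  set p : Ω → Vec d → ℝ := fun ω a => samplingProb lam σ S αopt αemp (arms t) (fun s => A s ω)
    (fun s => Y s ω) t (ahat t ω) (qopt t ω) (bsel t ω) a with hp
  have hlaw := hM.arm_law t
  set V : Ω → Matrix (Fin d) (Fin d) ℝ := fun ω => gram lam (fun s => A s ω) t with hV
  have hVp : ∀ ω, (V ω).PosDef := fun ω => gram_posDef hlam _ t
  set U : Ω → ℝ := fun ω => estError lam θ (fun s => A s ω) (fun s => Y s ω) t with hU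
  set r : Ω → ℝ := fun ω => radius lam σs (euclNorm θ) (fun s => A s ω) t with hr
  set ρ : Ω → ℝ := fun ω => radius lam σ S (fun s => A s ω) t with hρ
  set th : Ω → Vec d := fun ω => ridge lam (fun s => A s ω) (fun s => Y s ω) t with hth
  set ε := Δ ^ 2 / (16 * β * L) with hε
  set burn : Ω → Prop := fun ω => (underexplored (arms t) (V ω)).Nonempty with hburn
  have hburnm : MeasurableSet[history A Y t] {ω | burn ω} :=
    measurableSet_underexplored lam (arms t) hA'
  have hvm : ∀ a, Measurable[history A Y t] fun ω => invNormSq (V ω) a := fun a =>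
    measurable_leverage lam hA' measurable_const
  have hUm : Measurable[history A Y t] U := measurable_estError lam θ hA' hY'
  have hrm : Measurable[history A Y t] r := measurable_radius lam σs (euclNorm θ) hA'
  have hρm : Measurable[history A Y t] ρ := measurable_radius lam σ S hA'
  have hem : ∀ a, Measurable[history A Y t] fun ω => (θ - th ω) ⬝ᵥ a := fun a =>
    measurable_dotProduct (measurable_const.sub (measurable_ridge lam hA' hY')) measurable_const
  have hρ0 : ∀ ω, lam * S ^ 2 ≤ ρ ω := fun ω => mul_sq_le_radius hlam.le hσ hS.le
  have hlS : 0 < lam * S ^ 2 := by positivity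
  have hβ0 : 0 < β := by
    obtain ⟨ω, hω⟩ := hβ.exists
    exact hlS.trans_le ((hρ0 ω).trans hω)
  have hb0 : 0 ≤ b := by
    obtain ⟨ω, hω⟩ := hb.exists
    exact (radius_nonneg.trans hω)
  have hB0 : 0 ≤ B := (gap_nonneg hne t hstar).trans (hB t astar hstar)
  -- the four functions of the past and of an arm that are averaged over the sampling distribution
  set φ0 : Ω → Vec d → ℝ := fun ω a => if 1 < invNormSq (V ω) a then 1 else 0 with hφ0
  set φ1 : Ω → Vec d → ℝ := fun ω a => if burn ω then 0 else gap arms θ t a with hφ1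
  set φ2 : Ω → Vec d → ℝ := fun ω a => if burn ω then 0 else largeNormSq (V ω) ε a with hφ2
  set φ3 : Ω → Vec d → ℝ := fun ω a => if burn ω then 0 else if U ω ≤ r ω then
    Real.exp (r ω / ρ ω) * ((θ - th ω) ⬝ᵥ a) ^ 2 else 0 with hφ3
  have t0 := integral_sampled_eq hle (hAm t) (hM.arm_mem t) (p := p) hlaw (φ := φ0)
    (fun a _ => Measurable.ite (measurableSet_lt measurable_const (hvm a)) measurable_const
      measurable_const) (C := 1) (Filter.Eventually.of_forall fun ω a _ => by
        simp only [hφ0]; split_ifs <;> simp)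
  have t1 := integral_sampled_eq hle (hAm t) (hM.arm_mem t) (p := p) hlaw (φ := φ1)
    (fun a _ => Measurable.ite hburnm measurable_const measurable_const)
    (C := B) (Filter.Eventually.of_forall fun ω a ha => by
        simp only [hφ1]; split_ifs
        · simpa using hB0
        · rw [abs_of_nonneg (gap_nonneg hne t ha)]; exact hB t a ha)
  have t2 := integral_sampled_eq hle (hAm t) (hM.arm_mem t) (p := p) hlaw (φ := φ2)
    (fun a _ => Measurable.ite hburnm measurable_const
      (Measurable.ite (measurableSet_le measurable_const (hvm a)) (hvm a) measurable_const))
    (C := 1) (Filter.Eventually.of_forall fun ω a ha => by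
        simp only [hφ2]; split_ifs with h
        · simp
        · rw [abs_of_nonneg (largeNormSq_nonneg (hVp ω) ε a), largeNormSq]
          split_ifs
          · exact invNormSq_le_one_of_explored h ha
          · exact zero_le_one)
  have t3 := integral_sampled_eq hle (hAm t) (hM.arm_mem t) (p := p) hlaw (φ := φ3)
    (fun a _ => Measurable.ite hburnm measurable_const
      (Measurable.ite (measurableSet_le hUm hrm)
        ((hrm.div hρm).exp.mul ((hem a).pow_const 2)) measurable_const))
    (C := Real.exp (b / (lam * S ^ 2)) * b) (by
        filter_upwards [hb] with ω hω a ha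
        simp only [hφ3]; split_ifs with h h'
        · simp; positivity
        · have h1 := sq_predError_le hlam θ (fun s => A s ω) (fun s => Y s ω) t a
          have h2 := invNormSq_le_one_of_explored h ha
          have h3 := estError_nonneg hlam θ (fun s => A s ω) (fun s => Y s ω) t
          have h4 : ((θ - th ω) ⬝ᵥ a) ^ 2 ≤ b :=
            h1.trans ((mul_le_of_le_one_right h3 h2).trans (h'.trans hω))
          rw [abs_of_nonneg (by positivity)]
          have h5 : r ω / ρ ω ≤ b / (lam * S ^ 2) :=
            div_le_div₀ hb0 hω hlS (hρ0 ω)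
          gcongr
        · simp; positivity)
  obtain ⟨t0i, t0e⟩ := t0
  obtain ⟨t1i, t1e⟩ := t1
  obtain ⟨t2i, t2e⟩ := t2
  obtain ⟨t3i, t3e⟩ := t3
  have hF := integral_estError_outside_le hlam hσs hR hAm t hD
  -- rounds with underexplored arms
  have hgapm : Measurable fun ω => gap arms θ t (A t ω) := by
    simp only [hgap_eq]
    exact measurable_const.sub (measurable_dotProduct measurable_const (hAm t))
  have hburn_ind : Measurable fun ω => if burn ω then (1 : ℝ) else 0 :=
    Measurable.ite (hle _ hburnm) measurable_const measurable_const
  have hburni : Integrable (fun ω => if burn ω then (1 : ℝ) else 0) P :=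
    Integrable.of_bound hburn_ind.aestronglyMeasurable 1
      (Filter.Eventually.of_forall fun ω => by split_ifs <;> simp)
  have hburn_le : ∫ ω, (if burn ω then (1 : ℝ) else 0) ∂P ≤ 2 * ∫ ω, φ0 ω (A t ω) ∂P := by
    rw [t0e, ← integral_const_mul]
    refine integral_mono hburni (t0i.const_mul 2) fun ω => ?_
    simp only
    split_ifs with h
    · have := half_le_sum_samplingProb hlam hαo hαe hα hO (hq ω) (hM.ahat_mem t ω) h
        (hM.bsel_mem t ω h)
      simp only [hp, hφ0]
      linarith
    · refine mul_nonneg zero_le_two (Finset.sum_nonneg fun a ha => mul_nonneg ?_ ?_)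
      · simp only [hp]
        rw [samplingProb_of_explored h]
        exact tilted_nonneg_of_mixture hlam hαo hαe hα hO (hq ω) (hM.ahat_mem t ω) ha
      · simp only [hφ0]; split_ifs <;> norm_num
  have hφ1i : Integrable (fun ω => φ1 ω (A t ω)) P := by
    refine Integrable.of_bound (C := B)
      (Measurable.ite (hle _ hburnm) measurable_const hgapm).aestronglyMeasurable ?_
    filter_upwards [hM.arm_mem t] with ω hω
    simp only [hφ1]; split_ifs
    · simpa using hB0
    · rw [Real.norm_of_nonneg (gap_nonneg hne t hω)]; exact hB t _ hω
  have hgapi : Integrable (fun ω => gap arms θ t (A t ω)) P := by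
    refine Integrable.of_bound (C := B) hgapm.aestronglyMeasurable ?_
    filter_upwards [hM.arm_mem t] with ω hω
    rw [Real.norm_of_nonneg (gap_nonneg hne t hω)]; exact hB t _ hω
  have hsplit : ∫ ω, gap arms θ t (A t ω) ∂P
      ≤ B * ∫ ω, (if burn ω then (1 : ℝ) else 0) ∂P + ∫ ω, φ1 ω (A t ω) ∂P := by
    rw [← integral_const_mul, ← integral_add (hburni.const_mul B) hφ1i]
    refine integral_mono_ae hgapi ((hburni.const_mul B).add hφ1i) ?_
    filter_upwards [hM.arm_mem t] with ω hω
    have hBω := hB t _ hω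
    simp only [hφ1]
    split_ifs <;> linarith
  -- rounds without underexplored arms
  have hround : ∫ ω, ∑ a ∈ arms t, p ω a * φ1 ω a ∂P
      ≤ ∫ ω, (16 * β * L / (Δ * αemp) * (Real.exp (-L) + 2 * ∑ a ∈ arms t, p ω a * φ2 ω a)
        + 8 / Δ * ((|Copt| * d * Real.log d / αopt + 1) * ∑ a ∈ arms t, p ω a * φ3 ω a)
        + 16 / Δ * (if U ω ≤ r ω then 0 else U ω)) ∂P := by
    refine integral_mono_ae t1i (((((integrable_const _).add (t2i.const_mul 2)).const_mul _).add
      ((t3i.const_mul _).const_mul _)).add (hF.1.const_mul _)) ?_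
    filter_upwards [hβ] with ω hω
    by_cases h : burn ω
    · simp only [hφ1, hφ2, hφ3, h, if_true, mul_zero, Finset.sum_const_zero, add_zero]
      have hU0 : 0 ≤ U ω := estError_nonneg hlam _ _ _ _
      have : 0 ≤ (if U ω ≤ r ω then 0 else U ω) := by split_ifs <;> simp [hU0]
      positivity
    · simp only [hφ1, hφ2, hφ3, h, if_false, hgap_eq]
      refine round_regret_le hlam hσ hS hαo hαe hα hO (hq ω) (hM.ahat_mem t ω) (hM.ahat_max t ω)
        (fun a ha => invNormSq_le_one_of_explored h ha) hstar hbest hΔ ?_ hL hω (r ω)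
        (samplingProb_of_explored h)
      intro a ha hpos
      rw [← hgap_eq] at hpos ⊢
      exact hgap a ha hpos
  have i2 : Integrable (fun ω => 16 * β * L / (Δ * αemp)
      * (Real.exp (-L) + 2 * ∑ a ∈ arms t, p ω a * φ2 ω a)) P :=
    ((integrable_const _).add (t2i.const_mul 2)).const_mul _
  have i3 : Integrable (fun ω => 8 / Δ * ((|Copt| * d * Real.log d / αopt + 1)
      * ∑ a ∈ arms t, p ω a * φ3 ω a)) P := (t3i.const_mul _).const_mul _
  have i4 : Integrable (fun ω => 16 / Δ * (if U ω ≤ r ω then 0 else U ω)) P := hF.1.const_mul _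
  have i23 : Integrable (fun ω => 16 * β * L / (Δ * αemp)
      * (Real.exp (-L) + 2 * ∑ a ∈ arms t, p ω a * φ2 ω a)
      + 8 / Δ * ((|Copt| * d * Real.log d / αopt + 1) * ∑ a ∈ arms t, p ω a * φ3 ω a)) P :=
    i2.add i3
  rw [integral_add i23 i4, integral_add i2 i3, integral_const_mul, integral_const_mul,
    integral_const_mul, integral_const_mul, integral_add (integrable_const _) (t2i.const_mul 2),
    integral_const_mul, integral_const, probReal_univ, one_smul, ← t1e, ← t2e, ← t3e] at hround
  have hF2 := mul_le_mul_of_nonneg_left hF.2 (show 0 ≤ 16 / Δ by positivity)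
  have hB2 := mul_le_mul_of_nonneg_left hburn_le hB0
  have e0 : B * (2 * ∫ ω, φ0 ω (A t ω) ∂P) = 2 * B * ∫ ω, φ0 ω (A t ω) ∂P := by ring
  change _ ≤ 2 * B * ∫ ω, φ0 ω (A t ω) ∂P
    + 16 * β * L / (Δ * αemp) * (Real.exp (-L) + 2 * ∫ ω, φ2 ω (A t ω) ∂P)
    + 8 / Δ * ((|Copt| * d * Real.log d / αopt + 1) * ∫ ω, φ3 ω (A t ω) ∂P) + _
  linarith

end ExpectedRound

/-! ### Deterministic bounds on the confidence radii -/

section RadiusBounds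

variable {lam : ℝ} {A : ℕ → Vec d} {n : ℕ}

theorem log_gram_det_ratio_le_of_norm_le_one (hlam : 0 < lam) (hd : 0 < d)
    (hA : ∀ s, euclNorm (A s) ≤ 1) {t : ℕ} (ht : t ≤ n) :
    Real.log ((gram lam A t).det / (gram lam A 0).det) ≤ d * Real.log (1 + n / lam) := by
  refine log_gram_det_ratio_le hlam A hd t (Nat.cast_nonneg n) ?_
  calc ∑ s ∈ Finset.range t, euclNorm (A s) ^ 2 ≤ ∑ s ∈ Finset.range t, (1 : ℝ) :=
        Finset.sum_le_sum fun s _ => by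
          have := hA s; have := euclNorm_nonneg (A s); nlinarith
    _ = t := by simp
    _ ≤ n := by exact_mod_cast ht

theorem log_inv_failureRate_le {t : ℕ} (ht : t < n) :
    Real.log (1 / failureRate t) ≤ Real.log n := by
  rw [failureRate, one_div_one_div]
  exact Real.log_le_log (by positivity) (by exact_mod_cast ht)

theorem radius_le (hlam : 0 < lam) (hd : 0 < d) (hA : ∀ s, euclNorm (A s) ≤ 1) {t : ℕ} (ht : t < n)
    (σ S : ℝ) :
    radius lam σ S A t
      ≤ 2 * (σ ^ 2 * (d * Real.log (1 + n / lam) + 2 * Real.log n) + lam * S ^ 2) := by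
  have h1 := log_gram_det_ratio_le_of_norm_le_one hlam hd hA ht.le
  have h2 := log_inv_failureRate_le ht
  have h3 := log_gram_det_ratio_nonneg hlam A t
  have h4 := log_inv_failureRate_nonneg t
  rw [radius]
  set x := Real.log ((gram lam A t).det / (gram lam A 0).det) + 2 * Real.log (1 / failureRate t)
    with hx
  have hx0 : 0 ≤ x := by positivity
  have e1 : (σ * Real.sqrt x) ^ 2 = σ ^ 2 * x := by rw [mul_pow, Real.sq_sqrt hx0]
  have e2 : (Real.sqrt lam * S) ^ 2 = lam * S ^ 2 := by rw [mul_pow, Real.sq_sqrt hlam.le]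
  have h5 := mul_le_mul_of_nonneg_left
    (show x ≤ d * Real.log (1 + n / lam) + 2 * Real.log n by linarith) (sq_nonneg σ)
  nlinarith [sq_nonneg (σ * Real.sqrt x - Real.sqrt lam * S)]

end RadiusBounds

/-! ### Sums over the rounds -/

section Sums

variable {Ω : Type*} [MeasurableSpace Ω] {P : Measure Ω} [IsProbabilityMeasure P]
  {A : ℕ → Ω → Vec d}

theorem sum_integral_large_potential_le {lam : ℝ} (hlam : 0 < lam) (hd : 0 < d)
    (hA : ∀ t, Measurable (A t)) (hA1 : ∀ᵐ ω ∂P, ∀ t, euclNorm (A t ω) ≤ 1) {ε : ℝ} (hε : 0 < ε)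
    (hε1 : ε ≤ 1) (n : ℕ) :
    (∀ t, Integrable (fun ω => if ε ≤ invNormSq (gram lam (fun s => A s ω) t) (A t ω)
        then min 1 (invNormSq (gram lam (fun s => A s ω) t) (A t ω)) else 0) P) ∧
    ∑ t ∈ Finset.range n, ∫ ω, (if ε ≤ invNormSq (gram lam (fun s => A s ω) t) (A t ω)
        then min 1 (invNormSq (gram lam (fun s => A s ω) t) (A t ω)) else 0) ∂P
      ≤ 4 * d * Real.log (1 + 4 * d / (ε * lam)) := by
  have hint : ∀ t, Integrable (fun ω => if ε ≤ invNormSq (gram lam (fun s => A s ω) t) (A t ω)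
        then min 1 (invNormSq (gram lam (fun s => A s ω) t) (A t ω)) else 0) P := by
    intro t
    have hv := measurable_leverage (t := t) lam (fun s _ => hA s) (hA t)
    refine Integrable.of_bound (C := 1) (Measurable.ite (measurableSet_le measurable_const hv)
      (measurable_const.min hv) measurable_const).aestronglyMeasurable
      (Filter.Eventually.of_forall fun ω => ?_)
    have h0 := invNormSq_nonneg (gram_posDef hlam (fun s => A s ω) t) (A t ω)
    split_ifs
    · rw [Real.norm_of_nonneg (le_min zero_le_one h0)]; exact min_le_left _ _
    · simp
  refine ⟨hint, ?_⟩
  rw [← integral_finsetSum _ fun t _ => hint t]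
  calc _ ≤ ∫ ω, 4 * d * Real.log (1 + 4 * d / (ε * lam)) ∂P := by
        refine integral_mono_ae (integrable_finsetSum _ fun t _ => hint t) (integrable_const _) ?_
        filter_upwards [hA1] with ω hω
        exact sum_large_potential_le hlam (fun s => A s ω) hd hω hε hε1 n
    _ = _ := by simp

/-- `max_{s ≤ t} exp (β*_s / β_s)`. It increases with `t` and, since `V_t` is determined by the first
`t` rounds, it depends on the past only; `Hmax` of the whole run does not. -/
noncomputable def runningH (lam σ S σs : ℝ) (θ : Vec d) (A : ℕ → Vec d) (t : ℕ) : ℝ :=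
  partialSups (fun s => Real.exp (radius lam σs (euclNorm θ) A s / radius lam σ S A s)) t

theorem le_runningH (lam σ S σs : ℝ) (θ : Vec d) (A : ℕ → Vec d) (t : ℕ) :
    Real.exp (radius lam σs (euclNorm θ) A t / radius lam σ S A t)
      ≤ runningH lam σ S σs θ A t :=
  le_partialSups (fun s => Real.exp (radius lam σs (euclNorm θ) A s / radius lam σ S A s)) t

theorem runningH_le_Hmax (lam σ S σs : ℝ) (θ : Vec d) (A : ℕ → Vec d) (n : ℕ) :
    runningH lam σ S σs θ A n ≤ Hmax lam σ S σs θ (n + 1) A := by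
  refine partialSups_le _ _ _ fun s hs => ?_
  exact le_ciSup (f := fun t : Fin (n + 1) =>
    Real.exp (radius lam σs (euclNorm θ) A t / radius lam σ S A t))
    (Set.finite_range _).bddAbove ⟨s, Nat.lt_succ_of_le hs⟩

theorem one_le_Hmax (lam σ S σs : ℝ) (θ : Vec d) (A : ℕ → Vec d) (n : ℕ) :
    1 ≤ Hmax lam σ S σs θ (n + 1) A :=
  (Real.one_le_exp (div_nonneg radius_nonneg radius_nonneg)).trans
    ((le_runningH lam σ S σs θ A n).trans (runningH_le_Hmax lam σ S σs θ A n))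

theorem Hmax_le {lam σ S σs b : ℝ} (hlam : 0 < lam) (hσ : 0 ≤ σ) (hS : 0 < S) (θ : Vec d)
    (A : ℕ → Vec d) (n : ℕ) (hb : ∀ t ≤ n, radius lam σs (euclNorm θ) A t ≤ b) :
    Hmax lam σ S σs θ (n + 1) A ≤ Real.exp (b / (lam * S ^ 2)) := by
  refine ciSup_le fun t => Real.exp_le_exp.2 ?_
  have h := hb t (Nat.lt_succ_iff.1 t.2)
  exact div_le_div₀ (radius_nonneg.trans h) h (by positivity) (mul_sq_le_radius hlam.le hσ hS.le)

theorem measurable_runningH {Ω : Type*} {m : MeasurableSpace Ω} {A : ℕ → Ω → Vec d} (lam σ S σs : ℝ)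
    (θ : Vec d) {t : ℕ} (hA : ∀ s < t, Measurable (A s)) :
    Measurable fun ω => runningH lam σ S σs θ (fun s => A s ω) t := by
  have hterm : ∀ s ≤ t, Measurable fun ω => Real.exp (radius lam σs (euclNorm θ) (fun s => A s ω) s
      / radius lam σ S (fun s => A s ω) s) := fun s hs =>
    ((measurable_radius lam σs _ fun r hr => hA r (hr.trans_le hs)).div
      (measurable_radius lam σ S fun r hr => hA r (hr.trans_le hs))).exp
  have key : ∀ s ≤ t, Measurable fun ω => runningH lam σ S σs θ (fun s => A s ω) s := by
    intro s
    induction s with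
    | zero => intro h; simpa [runningH] using hterm 0 h
    | succ s ih =>
      intro h
      simp only [runningH, partialSups_add_one]
      exact (ih (by omega)).sup (hterm (s + 1) h)
  exact key t le_rfl

theorem integrable_Hmax {lam σ S σs b : ℝ} (hlam : 0 < lam) (hσ : 0 ≤ σ) (hS : 0 < S) (θ : Vec d)
    (n : ℕ) (hA : ∀ t, Measurable (A t))
    (hb : ∀ᵐ ω ∂P, ∀ t ≤ n, radius lam σs (euclNorm θ) (fun s => A s ω) t ≤ b) :
    Integrable (fun ω => Hmax lam σ S σs θ (n + 1) (fun s => A s ω)) P := by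
  have hm : Measurable fun ω => Hmax lam σ S σs θ (n + 1) (fun s => A s ω) := by
    unfold Hmax
    exact Measurable.iSup fun t => ((measurable_radius lam σs _ fun s _ => hA s).div
      (measurable_radius lam σ S fun s _ => hA s)).exp
  refine Integrable.of_bound (C := Real.exp (b / (lam * S ^ 2))) hm.aestronglyMeasurable ?_
  filter_upwards [hb] with ω hω
  rw [Real.norm_of_nonneg (zero_le_one.trans (one_le_Hmax _ _ _ _ _ _ _))]
  exact Hmax_le hlam hσ hS θ _ n hω

theorem sum_failureRate_le (n : ℕ) :
    ∑ t ∈ Finset.range n, failureRate t ≤ 1 + Real.log n := by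
  refine le_trans (le_of_eq ?_) (harmonic_le_one_add_log n)
  simp [failureRate, harmonic]

end Sums

/-! ### The expected regret -/

/-- The expected regret, before the deterministic quantities are simplified. -/
theorem integral_regret_le {Ω : Type*} [MeasurableSpace Ω] {P : Measure Ω} [IsProbabilityMeasure P]
    {lam σ S σs αopt αemp Copt csupp B : ℝ} {ksupp : ℕ} {design : Finset (Vec d) → Vec d → ℝ}
    {arms : ℕ → Finset (Vec d)} {θ : Vec d} {A : ℕ → Ω → Vec d} {Y : ℕ → Ω → ℝ}
    {ahat : ℕ → Ω → Vec d} {qopt : ℕ → Ω → Vec d → ℝ} {bsel : ℕ → Ω → Vec d} (hd : 0 < d)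
    (hlam : 0 < lam) (hσ : 0 ≤ σ) (hS : 0 < S) (hσs : 0 ≤ σs) (hαo : 0 < αopt) (hαe : 0 < αemp)
    (hα : αopt + αemp ≤ 1) (hO : IsDesignOracle Copt csupp ksupp design)
    (hne : ∀ t, (arms t).Nonempty) (hnorm : ∀ t, ∀ a ∈ arms t, euclNorm a ≤ 1)
    (hB : ∀ t, ∀ a ∈ arms t, gap arms θ t a ≤ B)
    (hR : IsLinearReward P θ σs A Y)
    (hM : IsLinMED P lam σ S αopt αemp design arms A Y ahat qopt bsel) {n : ℕ} {Δ : ℝ} (hΔ : 0 < Δ)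
    (hgap : ∀ t < n + 1, ∀ a ∈ arms t, 0 < gap arms θ t a → Δ ≤ gap arms θ t a) {L : ℝ}
    (hL : 1 ≤ L) {β b D ε : ℝ} (hD : D = d * Real.log (1 + ((n + 1 : ℕ) : ℝ) / lam))
    (hβ : β = 2 * (σ ^ 2 * (D + 2 * Real.log ((n + 1 : ℕ) : ℝ)) + lam * S ^ 2))
    (hb : b = 2 * (σs ^ 2 * (D + 2 * Real.log ((n + 1 : ℕ) : ℝ)) + lam * euclNorm θ ^ 2))
    (hε : ε = min 1 (Δ ^ 2 / (16 * β * L))) :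
    ∫ ω, regret arms θ (n + 1) (fun t => A t ω) ∂P
      ≤ 2 * B * (4 * d * Real.log (1 + 4 * d / lam))
        + 16 * β * L / (Δ * αemp) * (((n + 1 : ℕ) : ℝ) * Real.exp (-L)
          + 2 * (4 * d * Real.log (1 + 4 * d / (ε * lam))))
        + 8 / Δ * ((|Copt| * d * Real.log d / αopt + 1)
          * (2 * ((b + σs ^ 2 * D) * ∫ ω, Hmax lam σ S σs θ (n + 1) (fun t => A t ω) ∂P)))
        + 16 / Δ * ((1 + Real.log ((n + 1 : ℕ) : ℝ))
          * (4 * σs ^ 2 * (1 + D / 2 + Real.log ((n + 1 : ℕ) : ℝ))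
            + 2 * (lam * euclNorm θ ^ 2))) := by
  classical
  have hAm := hM.measurable_arm
  have hYm := hR.measurable_reward
  have hmem : ∀ᵐ ω ∂P, ∀ t, A t ω ∈ arms t := ae_all_iff.2 hM.arm_mem
  have hA1 : ∀ᵐ ω ∂P, ∀ t, euclNorm (A t ω) ≤ 1 := by
    filter_upwards [hmem] with ω hω t using hnorm t _ (hω t)
  have hlog0 : 0 ≤ Real.log ((n + 1 : ℕ) : ℝ) := Real.log_natCast_nonneg _
  have hD0 : 0 ≤ D := by
    rw [hD]
    exact mul_nonneg (Nat.cast_nonneg _) (Real.log_nonneg (by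
      have : 0 ≤ ((n + 1 : ℕ) : ℝ) / lam := by positivity
      linarith))
  have hDb : ∀ᵐ ω ∂P, ∀ t ≤ n + 1, Real.log ((gram lam (fun s => A s ω) t).det
      / (gram lam (fun s => A s ω) 0).det) ≤ D := by
    filter_upwards [hA1] with ω hω t ht
    rw [hD]
    exact log_gram_det_ratio_le_of_norm_le_one hlam hd hω ht
  have hβb : ∀ᵐ ω ∂P, ∀ t < n + 1, radius lam σ S (fun s => A s ω) t ≤ β := by
    filter_upwards [hA1] with ω hω t ht
    rw [hβ, hD]
    exact radius_le hlam hd hω ht σ S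
  have hbb : ∀ᵐ ω ∂P, ∀ t < n + 1, radius lam σs (euclNorm θ) (fun s => A s ω) t ≤ b := by
    filter_upwards [hA1] with ω hω t ht
    rw [hb, hD]
    exact radius_le hlam hd hω ht σs (euclNorm θ)
  have hβ0 : 0 < β := by rw [hβ]; positivity
  have hb0 : 0 ≤ b := by rw [hb]; positivity
  have hB0 : 0 ≤ B := by
    obtain ⟨a, ha⟩ := hne 0
    exact (gap_nonneg hne 0 ha).trans (hB 0 a ha)
  have hL0 : 0 < L := by linarith
  have hε0 : 0 < ε := by rw [hε]; exact lt_min one_pos (by positivity)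
  have hε1 : ε ≤ 1 := by rw [hε]; exact min_le_left _ _
  have hlogd : 0 ≤ Real.log d := Real.log_natCast_nonneg d
  -- sums of the four kinds of terms
  obtain ⟨p1i, p1⟩ := sum_integral_large_potential_le (P := P) hlam hd hAm hA1 one_pos le_rfl (n + 1)
  obtain ⟨pεi, pε⟩ := sum_integral_large_potential_le (P := P) hlam hd hAm hA1 hε0 hε1 (n + 1)
  have s1 : ∀ t, ∫ ω, (if 1 < invNormSq (gram lam (fun s => A s ω) t) (A t ω) then (1 : ℝ) else 0) ∂P
      ≤ ∫ ω, (if 1 ≤ invNormSq (gram lam (fun s => A s ω) t) (A t ω)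
        then min 1 (invNormSq (gram lam (fun s => A s ω) t) (A t ω)) else 0) ∂P := by
    intro t
    refine integral_mono_of_nonneg (Filter.Eventually.of_forall fun ω => ?_) (p1i t)
      (Filter.Eventually.of_forall fun ω => ?_)
    · simp only [Pi.zero_apply]; split_ifs <;> norm_num
    · have h0 := invNormSq_nonneg (gram_posDef hlam (fun s => A s ω) t) (A t ω)
      simp only
      by_cases h : 1 < invNormSq (gram lam (fun s => A s ω) t) (A t ω)
      · rw [if_pos h, if_pos h.le, min_eq_left h.le]
      · rw [if_neg h]
        split_ifs
        · exact le_min zero_le_one h0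
        · exact le_rfl
  have s2 : ∀ t, ∫ ω, (if (underexplored (arms t) (gram lam (fun s => A s ω) t)).Nonempty then 0
        else largeNormSq (gram lam (fun s => A s ω) t) (Δ ^ 2 / (16 * β * L)) (A t ω)) ∂P
      ≤ ∫ ω, (if ε ≤ invNormSq (gram lam (fun s => A s ω) t) (A t ω)
        then min 1 (invNormSq (gram lam (fun s => A s ω) t) (A t ω)) else 0) ∂P := by
    intro t
    refine integral_mono_of_nonneg (Filter.Eventually.of_forall fun ω => ?_) (pεi t) ?_
    · simp only [Pi.zero_apply]
      split_ifs
      · exact le_rfl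
      · exact largeNormSq_nonneg (gram_posDef hlam _ t) _ _
    · filter_upwards [hmem] with ω hω
      have h0 := invNormSq_nonneg (gram_posDef hlam (fun s => A s ω) t) (A t ω)
      have hrhs : 0 ≤ (if ε ≤ invNormSq (gram lam (fun s => A s ω) t) (A t ω)
          then min 1 (invNormSq (gram lam (fun s => A s ω) t) (A t ω)) else 0) := by
        split_ifs
        · exact le_min zero_le_one h0
        · exact le_rfl
      by_cases h : (underexplored (arms t) (gram lam (fun s => A s ω) t)).Nonempty
      · rw [if_pos h]; exact hrhs
      · rw [if_neg h, largeNormSq]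
        by_cases h2 : Δ ^ 2 / (16 * β * L) ≤ invNormSq (gram lam (fun s => A s ω) t) (A t ω)
        · have h3 : ε ≤ invNormSq (gram lam (fun s => A s ω) t) (A t ω) := by
            rw [hε]; exact (min_le_right _ _).trans h2
          rw [if_pos h2, if_pos h3, min_eq_right (invNormSq_le_one_of_explored h (hω t))]
        · rw [if_neg h2]; exact hrhs
  have hmaxb : ∀ᵐ ω ∂P, ∀ t ≤ n, radius lam σs (euclNorm θ) (fun s => A s ω) t ≤ b := by
    filter_upwards [hbb] with ω hω t ht using hω t (Nat.lt_succ_of_le ht)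
  obtain ⟨pHi, pH⟩ := sum_integral_sq_predError_le (P := P) (n := n) hlam hR hAm hA1 hb0
    (D := D) (by filter_upwards [hDb] with ω hω using hω (n + 1) le_rfl)
    (H := fun t ω => runningH lam σ S σs θ (fun s => A s ω) t)
    (fun t => measurable_runningH lam σ S σs θ fun s hs => measurable_history_arm hs)
    (fun ω => (Real.exp_pos _).le.trans (le_runningH lam σ S σs θ (fun s => A s ω) 0))
    (fun ω => (partialSups _).monotone) (C := Real.exp (b / (lam * S ^ 2)))
    (by
      filter_upwards [hmaxb] with ω hω
      exact (runningH_le_Hmax _ _ _ _ _ _ _).trans (Hmax_le hlam hσ hS θ _ n hω))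
  have s3 : ∀ t ≤ n, ∫ ω, (if (underexplored (arms t) (gram lam (fun s => A s ω) t)).Nonempty then 0
              else if estError lam θ (fun s => A s ω) (fun s => Y s ω) t
                ≤ radius lam σs (euclNorm θ) (fun s => A s ω) t then
              Real.exp (radius lam σs (euclNorm θ) (fun s => A s ω) t
                  / radius lam σ S (fun s => A s ω) t)
                * ((θ - ridge lam (fun s => A s ω) (fun s => Y s ω) t) ⬝ᵥ A t ω) ^ 2 else 0) ∂P
      ≤ 2 * ∫ ω, runningH lam σ S σs θ (fun s => A s ω) t
        * (if estError lam θ (fun s => A s ω) (fun s => Y s ω) t ≤ b then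
          ((θ - ridge lam (fun s => A s ω) (fun s => Y s ω) t) ⬝ᵥ A t ω) ^ 2
            / (1 + invNormSq (gram lam (fun s => A s ω) t) (A t ω)) else 0) ∂P := by
    intro t ht
    rw [← integral_const_mul]
    refine integral_mono_of_nonneg (Filter.Eventually.of_forall fun ω => ?_)
      ((pHi t ht).const_mul 2) ?_
    · simp only [Pi.zero_apply]
      split_ifs
      · exact le_rfl
      · positivity
      · exact le_rfl
    · filter_upwards [hmem, hmaxb] with ω hω hbω
      have h0 := invNormSq_nonneg (gram_posDef hlam (fun s => A s ω) t) (A t ω)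
      have hH := le_runningH lam σ S σs θ (fun s => A s ω) t
      have hH0 := (Real.exp_pos (radius lam σs (euclNorm θ) (fun s => A s ω) t
        / radius lam σ S (fun s => A s ω) t)).le
      have hrhs : 0 ≤ 2 * (runningH lam σ S σs θ (fun s => A s ω) t
        * (if estError lam θ (fun s => A s ω) (fun s => Y s ω) t ≤ b then
          ((θ - ridge lam (fun s => A s ω) (fun s => Y s ω) t) ⬝ᵥ A t ω) ^ 2
            / (1 + invNormSq (gram lam (fun s => A s ω) t) (A t ω)) else 0)) := by
        refine mul_nonneg zero_le_two (mul_nonneg (hH0.trans hH) ?_)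
        split_ifs
        · positivity
        · exact le_rfl
      by_cases h : (underexplored (arms t) (gram lam (fun s => A s ω) t)).Nonempty
      · rw [if_pos h]; exact hrhs
      rw [if_neg h]
      by_cases h2 : estError lam θ (fun s => A s ω) (fun s => Y s ω) t
          ≤ radius lam σs (euclNorm θ) (fun s => A s ω) t
      · rw [if_pos h2]
        simp only [h2.trans (hbω t ht), if_true]
        have h3 := invNormSq_le_one_of_explored h (hω t)
        have h4 : ((θ - ridge lam (fun s => A s ω) (fun s => Y s ω) t) ⬝ᵥ A t ω) ^ 2
            ≤ 2 * (((θ - ridge lam (fun s => A s ω) (fun s => Y s ω) t) ⬝ᵥ A t ω) ^ 2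
              / (1 + invNormSq (gram lam (fun s => A s ω) t) (A t ω))) := by
          rw [mul_div_assoc', le_div_iff₀ (by linarith)]
          nlinarith [sq_nonneg ((θ - ridge lam (fun s => A s ω) (fun s => Y s ω) t) ⬝ᵥ A t ω)]
        calc _ ≤ runningH lam σ S σs θ (fun s => A s ω) t
              * (2 * (((θ - ridge lam (fun s => A s ω) (fun s => Y s ω) t) ⬝ᵥ A t ω) ^ 2
              / (1 + invNormSq (gram lam (fun s => A s ω) t) (A t ω)))) :=
              mul_le_mul hH h4 (sq_nonneg _) (hH0.trans hH)
          _ = _ := by ring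
      · rw [if_neg h2]; exact hrhs
  have hHint := integrable_Hmax (P := P) (σs := σs) hlam hσ hS θ n hAm hmaxb
  have hHle : ∫ ω, runningH lam σ S σs θ (fun s => A s ω) n ∂P
      ≤ ∫ ω, Hmax lam σ S σs θ (n + 1) (fun t => A t ω) ∂P :=
    integral_mono_of_nonneg (Filter.Eventually.of_forall fun ω =>
      (Real.exp_pos _).le.trans (le_runningH lam σ S σs θ (fun s => A s ω) n)) hHint
      (Filter.Eventually.of_forall fun ω => runningH_le_Hmax _ _ _ _ _ _ _)
  -- one round
  have hround : ∀ t ∈ Finset.range (n + 1), ∫ ω, gap arms θ t (A t ω) ∂P ≤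
      2 * B * ∫ ω, (if 1 ≤ invNormSq (gram lam (fun s => A s ω) t) (A t ω)
        then min 1 (invNormSq (gram lam (fun s => A s ω) t) (A t ω)) else 0) ∂P
      + 16 * β * L / (Δ * αemp) * (Real.exp (-L)
        + 2 * ∫ ω, (if ε ≤ invNormSq (gram lam (fun s => A s ω) t) (A t ω)
          then min 1 (invNormSq (gram lam (fun s => A s ω) t) (A t ω)) else 0) ∂P)
      + 8 / Δ * ((|Copt| * d * Real.log d / αopt + 1)
        * (2 * ∫ ω, runningH lam σ S σs θ (fun s => A s ω) t
        * (if estError lam θ (fun s => A s ω) (fun s => Y s ω) t ≤ b then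
          ((θ - ridge lam (fun s => A s ω) (fun s => Y s ω) t) ⬝ᵥ A t ω) ^ 2
            / (1 + invNormSq (gram lam (fun s => A s ω) t) (A t ω)) else 0) ∂P))
      + 16 / Δ * (failureRate t * (4 * σs ^ 2 * (1 + D / 2 + Real.log ((n + 1 : ℕ) : ℝ))
          + 2 * (lam * euclNorm θ ^ 2))) := by
    intro t ht
    have htn := Finset.mem_range.1 ht
    refine (integral_gap_le hlam hσ hS hσs hαo hαe hα hO hne hB hR hM hΔ (hgap t htn) hL
      (by filter_upwards [hβb] with ω hω using hω t htn)
      (by filter_upwards [hbb] with ω hω using hω t htn) (D := D)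
      (by filter_upwards [hDb] with ω hω using hω t htn.le)).trans ?_
    have hδ0 : 0 < failureRate t := by rw [failureRate]; positivity
    have h1 := s1 t
    have h2 := s2 t
    have h3 := s3 t (Nat.lt_succ_iff.1 htn)
    have h4 := log_inv_failureRate_le htn
    gcongr
  have hgapi : ∀ t, Integrable (fun ω => gap arms θ t (A t ω)) P := by
    intro t
    refine Integrable.of_bound (C := B) ?_ ?_
    · exact (measurable_const.sub
        (measurable_dotProduct measurable_const (hAm t))).aestronglyMeasurable
    · filter_upwards [hM.arm_mem t] with ω hω
      rw [Real.norm_of_nonneg (gap_nonneg hne t hω)]; exact hB t _ hω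
  simp only [regret]
  rw [integral_finsetSum _ fun t _ => hgapi t]
  refine (Finset.sum_le_sum hround).trans ?_
  simp only [Finset.sum_add_distrib, ← Finset.mul_sum, ← Finset.sum_mul, Finset.sum_const,
    Finset.card_range, nsmul_eq_mul]
  have hδ := sum_failureRate_le (n + 1)
  have hpH := pH.trans (mul_le_mul_of_nonneg_left hHle (show 0 ≤ b + σs ^ 2 * D by positivity))
  rw [one_mul] at p1
  gcongr

/-! ### Simplification of the bound -/

section Arithmetic

variable {n : ℕ} {lam Δ σ S σs Ss : ℝ}

/-- The argument of the hidden logarithm. -/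
noncomputable def hiddenScale (d : ℕ) (lam Δ σ S σs Ss : ℝ) : ℝ :=
  3 + d + 1 / lam + 1 / Δ + σ + S + σs + Ss

theorem hiddenScale_bounds (hd : 2 ≤ d) (hlam : 0 < lam) (hΔ : 0 ≤ Δ) (hσ : 0 ≤ σ) (hS : 0 ≤ S)
    (hσs : 0 ≤ σs) (hSs : 0 ≤ Ss) :
    let X := hiddenScale d lam Δ σ S σs Ss
    5 ≤ X ∧ (d : ℝ) ≤ X ∧ 1 / lam ≤ X ∧ 1 / Δ ≤ X ∧ σ ≤ X ∧ S ≤ X ∧ 1 + 1 / lam ≤ X := by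
  have hd' : (2 : ℝ) ≤ d := by exact_mod_cast hd
  have h1 : 0 ≤ 1 / lam := by positivity
  have h2 : 0 ≤ 1 / Δ := by positivity
  simp only [hiddenScale]
  refine ⟨?_, ?_, ?_, ?_, ?_, ?_, ?_⟩ <;> linarith

theorem one_le_log_of_five_le {X : ℝ} (h : 5 ≤ X) : 1 ≤ Real.log X := by
  rw [Real.le_log_iff_exp_le (by linarith)]
  linarith [Real.exp_one_lt_d9]

theorem one_le_hiddenLog (hd : 2 ≤ d) (hlam : 0 < lam) (hΔ : 0 ≤ Δ) (hσ : 0 ≤ σ) (hS : 0 ≤ S)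
    (hσs : 0 ≤ σs) (hSs : 0 ≤ Ss) : 1 ≤ hiddenLog d lam Δ σ S σs Ss :=
  one_le_log_of_five_le (hiddenScale_bounds hd hlam hΔ hσ hS hσs hSs).1

theorem mainTerm_nonneg (hlam : 0 < lam) (hΔ : 0 ≤ Δ) {H : ℝ} (hH : 0 ≤ H) :
    0 ≤ mainTerm d n lam Δ σ S σs Ss H := by
  have h1 : 0 ≤ Real.log n := Real.log_natCast_nonneg n
  have h2 : 0 ≤ max (Real.log (Real.log n)) 0 := le_max_right _ _
  unfold mainTerm
  positivity

theorem log_one_add_div_le {X l : ℝ} (hn : 0 < n) (hlam : 0 < lam) (hX : 5 ≤ X)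
    (hX' : 1 + 1 / lam ≤ X) (hl : l = Real.log n) (hl1 : 1 ≤ l) :
    Real.log (1 + n / lam) ≤ 2 * (Real.log X * l) := by
  have hn' : (1 : ℝ) ≤ n := by exact_mod_cast hn
  have h1 : 1 + n / lam ≤ n * X := by
    have : (n : ℝ) / lam = n * (1 / lam) := by ring
    rw [this]; nlinarith
  have h2 : 0 < 1 + n / lam := by positivity
  have h3 := Real.log_le_log h2 h1
  rw [Real.log_mul (by positivity) (by linarith), ← hl] at h3
  have h4 := one_le_log_of_five_le hX
  nlinarith

theorem log_one_add_four_mul_div_le {X : ℝ} (hlam : 0 < lam) (hX : 5 ≤ X) (hdX : (d : ℝ) ≤ X)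
    (hlX : 1 / lam ≤ X) : Real.log (1 + 4 * d / lam) ≤ 3 * Real.log X := by
  have h1 : 1 + 4 * d / lam ≤ X ^ 3 := by
    have e : 4 * (d : ℝ) / lam = 4 * (d * (1 / lam)) := by ring
    have h2 : (d : ℝ) * (1 / lam) ≤ X * X :=
      mul_le_mul hdX hlX (by positivity) (by linarith)
    rw [e]; nlinarith [mul_nonneg (show 0 ≤ X by linarith) (show 0 ≤ X by linarith)]
  have h3 := Real.log_le_log (by positivity) h1
  rwa [Real.log_pow] at h3

/-- The number of rounds enters the potential of the rounds with `v_t ≥ ε` only through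
`log l = log log n`, as `1 / ε` is at most polynomial in `X` and `l`. -/
theorem log_peeling_le {X l β ε D : ℝ} (hlam : 0 < lam) (hΔ : 0 < Δ) (hX : 5 ≤ X)
    (hdX : (d : ℝ) ≤ X) (hlX : 1 / lam ≤ X) (hΔX : 1 / Δ ≤ X) (hσ0 : 0 ≤ σ) (hσX : σ ≤ X)
    (hS0 : 0 ≤ S) (hSX : S ≤ X) (hl1 : 1 ≤ l) (hll : 1 ≤ Real.log l) (hβ0 : 0 < β)
    (hD0 : 0 ≤ D) (hD : D ≤ 4 * d * (Real.log X * l))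
    (hβ : β = 2 * (σ ^ 2 * D + lam * S ^ 2))
    (hε : ε = min 1 (Δ ^ 2 / (16 * β * l))) :
    Real.log (1 + 4 * d / (ε * lam)) ≤ 15 * (Real.log X * Real.log l) := by
  have hX0 : 0 < X := by linarith
  have hl0 : 0 < l := by linarith
  have hΛX : Real.log X ≤ X := (Real.log_le_sub_one_of_pos hX0).trans (by linarith)
  have hΛ1 := one_le_log_of_five_le hX
  have hε0 : 0 < ε := by rw [hε]; exact lt_min one_pos (by positivity)
  have hεinv : 1 / ε ≤ 1 + 16 * β * l / Δ ^ 2 := by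
    rw [hε]
    have h2 : 0 ≤ 16 * β * l / Δ ^ 2 := by positivity
    rcases min_choice 1 (Δ ^ 2 / (16 * β * l)) with h | h
    · rw [h]; linarith
    · rw [h, one_div_div]; linarith
  have hβl : β / lam ≤ 10 * X ^ 5 * l := by
    have e : β / lam = 2 * (σ ^ 2 * D * (1 / lam) + S ^ 2) := by rw [hβ]; field_simp
    have hD' : D ≤ 4 * X * (X * l) := hD.trans (by gcongr)
    have h1 : σ ^ 2 * D * (1 / lam) ≤ X ^ 2 * (4 * X * (X * l)) * X := by gcongr
    have h2 : S ^ 2 ≤ X ^ 2 := by gcongr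
    have h3 : X ^ 2 ≤ X ^ 5 * l := by
      calc X ^ 2 = X ^ 2 * 1 * 1 := by ring
        _ ≤ X ^ 2 * X ^ 3 * l := by gcongr; exact one_le_pow₀ (by linarith)
        _ = X ^ 5 * l := by ring
    rw [e]
    nlinarith
  have hmain : 1 + 4 * d / (ε * lam) ≤ X ^ 13 * l ^ 2 := by
    have e : 4 * (d : ℝ) / (ε * lam) = 4 * d * (1 / ε) * (1 / lam) := by field_simp
    have e2 : (16 * β * l / Δ ^ 2) * (1 / lam) = 16 * (β / lam) * l * (1 / Δ) ^ 2 := by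
      field_simp
    have h1 : 4 * (d : ℝ) / (ε * lam)
        ≤ 4 * X * (X + 16 * (10 * X ^ 5 * l) * l * X ^ 2) := by
      calc 4 * (d : ℝ) / (ε * lam) = 4 * d * (1 / ε) * (1 / lam) := e
        _ ≤ 4 * d * (1 + 16 * β * l / Δ ^ 2) * (1 / lam) := by gcongr
        _ = 4 * d * (1 / lam + 16 * (β / lam) * l * (1 / Δ) ^ 2) := by rw [← e2]; ring
        _ ≤ _ := by gcongr
    have hl2 : 1 ≤ l ^ 2 := one_le_pow₀ hl1
    have h2 : X ^ 2 ≤ X ^ 8 * l ^ 2 := by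
      calc X ^ 2 = X ^ 2 * 1 * 1 := by ring
        _ ≤ X ^ 2 * X ^ 6 * l ^ 2 := by gcongr; exact one_le_pow₀ (by linarith)
        _ = _ := by ring
    have h3 : 1 ≤ X ^ 8 * l ^ 2 := by
      have : 1 ≤ X ^ 8 := one_le_pow₀ (by linarith)
      nlinarith
    have h4 : (3125 : ℝ) ≤ X ^ 5 := by
      calc (3125 : ℝ) = 5 ^ 5 := by norm_num
        _ ≤ X ^ 5 := by gcongr
    have h5 : X ^ 13 * l ^ 2 = X ^ 5 * (X ^ 8 * l ^ 2) := by ring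
    have h6 : 3125 * (X ^ 8 * l ^ 2) ≤ X ^ 5 * (X ^ 8 * l ^ 2) := by gcongr
    have e3 : 4 * X * (X + 16 * (10 * X ^ 5 * l) * l * X ^ 2)
        = 4 * X ^ 2 + 640 * (X ^ 8 * l ^ 2) := by ring
    rw [h5]
    linarith
  have h7 := Real.log_le_log (by positivity) hmain
  rw [Real.log_mul (by positivity) (by positivity), Real.log_pow, Real.log_pow] at h7
  push_cast at h7
  nlinarith

/-- The contribution of the empirical gaps. -/
theorem visible_term_le {l ll β αemp Λ Q L x : ℝ} (hl : 0 ≤ l) (hΔ : 0 < Δ)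
    (hα : 0 < αemp) (hβ0 : 0 ≤ β) (hβ : β ≤ 8 * (Λ * Q)) (h1 : 1 ≤ x * (Λ * ll)) (hL : L ≤ 15 * (Λ * ll))
    (hx : 0 ≤ x) :
    16 * β * l / (Δ * αemp) * (1 + 2 * (4 * x * L))
      ≤ 15488 / αemp * (Λ ^ 2 * (x * l / Δ * (Q * ll))) := by
  have h2 : 16 * β * l / (Δ * αemp) ≤ 16 * (8 * (Λ * Q)) * l / (Δ * αemp) := by gcongr
  have h3 : 1 + 2 * (4 * x * L) ≤ 121 * (x * (Λ * ll)) := by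
    have := mul_le_mul_of_nonneg_left hL hx
    linarith
  calc _ ≤ 16 * β * l / (Δ * αemp) * (121 * (x * (Λ * ll))) := ?_
    _ ≤ 16 * (8 * (Λ * Q)) * l / (Δ * αemp) * (121 * (x * (Λ * ll))) :=
      mul_le_mul_of_nonneg_right h2 (by linarith)
    _ = _ := by ring
  exact mul_le_mul_of_nonneg_left h3 (by positivity)

/-- The contribution of the estimation errors inside the confidence ellipsoid. -/
theorem explored_term_le {l b αopt C D Λ H x y : ℝ} (hl : 1 ≤ l) (hΛ : 1 ≤ Λ) (hΔ : 0 < Δ)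
    (hα : 0 < αopt) (hC : 0 ≤ C) (hlam : 0 ≤ lam) (hH : 0 ≤ H) (hx : 1 ≤ x) (hy : y ≤ Λ)
    (hb : b ≤ 8 * (Λ * (σs ^ 2 * x * l + lam * Ss ^ 2))) (hD : D ≤ 2 * (x * (Λ * l)))
    (hbD : 0 ≤ b + σs ^ 2 * D) :
    8 / Δ * ((C * x * y / αopt + 1) * (2 * ((b + σs ^ 2 * D) * H)))
      ≤ 160 * (C / αopt + 1)
        * (Λ ^ 2 * (x * l / Δ * ((σs ^ 2 * x * l + lam * Ss ^ 2) * H))) := by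
  have hx0 : 0 < x := by linarith
  have h1 : C * x * y / αopt + 1 ≤ x * Λ * (C / αopt + 1) := by
    have h2 : C * x * y / αopt ≤ x * Λ * (C / αopt) := by
      calc C * x * y / αopt ≤ C * x * Λ / αopt := by gcongr
        _ = _ := by ring
    have h3 : 1 ≤ x * Λ := one_le_mul_of_one_le_of_one_le hx hΛ
    linarith
  have h4 : b + σs ^ 2 * D ≤ 10 * (Λ * (σs ^ 2 * x * l + lam * Ss ^ 2)) := by
    have h5 : σs ^ 2 * D ≤ σs ^ 2 * (2 * (x * (Λ * l))) := by gcongr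
    have h6 : 0 ≤ Λ * (lam * Ss ^ 2) := by positivity
    linarith
  have h7 : 0 ≤ C / αopt + 1 := by positivity
  have hQ : 0 ≤ σs ^ 2 * x * l + lam * Ss ^ 2 := by positivity
  generalize σs ^ 2 * x * l + lam * Ss ^ 2 = Q at *
  calc _ ≤ 8 / Δ * ((x * Λ * (C / αopt + 1)) * (2 * ((10 * (Λ * Q)) * H))) := by gcongr
    _ = 160 * (C / αopt + 1) * (Λ ^ 2 * (x * 1 / Δ * (Q * H))) := by ring
    _ ≤ _ := by gcongr

/-- The contribution of the estimation errors outside of the confidence ellipsoid. -/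
theorem outside_term_le {l D Λ H x : ℝ} (hl : 1 ≤ l) (hΛ : 1 ≤ Λ) (hΔ : 0 < Δ) (hlam : 0 ≤ lam)
    (hH : 1 ≤ H) (hx : 1 ≤ x) (hD : D ≤ 2 * (x * (Λ * l))) (hD0 : 0 ≤ D)
    (hxl : 2 * l ≤ x * (Λ * l)) :
    16 / Δ * ((1 + l) * (4 * σs ^ 2 * (1 + D / 2 + l) + 2 * (lam * Ss ^ 2)))
      ≤ 384 * (Λ ^ 2 * (x * l / Δ * ((σs ^ 2 * x * l + lam * Ss ^ 2) * H))) := by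
  have h1 : 1 + D / 2 + l ≤ 2 * (x * (Λ * l)) := by linarith
  have h2 : 4 * σs ^ 2 * (1 + D / 2 + l) + 2 * (lam * Ss ^ 2)
      ≤ 8 * (Λ * (σs ^ 2 * x * l + lam * Ss ^ 2)) := by
    have h5 : 4 * σs ^ 2 * (1 + D / 2 + l) ≤ 4 * σs ^ 2 * (2 * (x * (Λ * l))) := by gcongr
    have h6 : lam * Ss ^ 2 ≤ Λ * (lam * Ss ^ 2) := le_mul_of_one_le_left (by positivity) hΛ
    have h7 : 0 ≤ lam * Ss ^ 2 := by positivity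
    linarith
  have hQ : 0 ≤ σs ^ 2 * x * l + lam * Ss ^ 2 := by positivity
  generalize σs ^ 2 * x * l + lam * Ss ^ 2 = Q at *
  have h3 : 1 + l ≤ 2 * l := by linarith
  have h4 : Λ ≤ Λ ^ 2 := le_self_pow₀ hΛ two_ne_zero
  calc _ ≤ 16 / Δ * ((2 * l) * (8 * (Λ * Q))) := by gcongr
    _ = 256 * (Λ * (1 * l / Δ * (Q * 1))) := by ring
    _ ≤ 384 * (Λ ^ 2 * (x * l / Δ * (Q * H))) := by
        gcongr
        norm_num

theorem sum_terms_le {t1 t2 t3 t4 c c' v w Λ B x Q : ℝ} (hc : 0 ≤ c) (hc' : 0 ≤ c')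
    (hu : 0 ≤ Λ ^ 2 * (B * x)) (hv : 0 ≤ Λ ^ 2 * (Q * v)) (hw : 0 ≤ Λ ^ 2 * (Q * w))
    (h1 : t1 ≤ 24 * (Λ ^ 2 * (B * x))) (h2 : t2 ≤ c * (Λ ^ 2 * (Q * v)))
    (h3 : t3 ≤ c' * (Λ ^ 2 * (Q * w))) (h4 : t4 ≤ 384 * (Λ ^ 2 * (Q * w))) :
    t1 + t2 + t3 + t4 ≤ (408 + c + c') * Λ ^ 2 * (Q * (v + w) + B * x) := by
  have e : (408 + c + c') * Λ ^ 2 * (Q * (v + w) + B * x)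
      = (408 + c + c') * (Λ ^ 2 * (B * x)) + (408 + c + c') * (Λ ^ 2 * (Q * v))
        + (408 + c + c') * (Λ ^ 2 * (Q * w)) := by ring
  have m1 : 24 * (Λ ^ 2 * (B * x)) ≤ (408 + c + c') * (Λ ^ 2 * (B * x)) :=
    mul_le_mul_of_nonneg_right (by linarith) hu
  have m2 : c * (Λ ^ 2 * (Q * v)) ≤ (408 + c + c') * (Λ ^ 2 * (Q * v)) :=
    mul_le_mul_of_nonneg_right (by linarith) hv
  have m3 : (c' + 384) * (Λ ^ 2 * (Q * w)) ≤ (408 + c + c') * (Λ ^ 2 * (Q * w)) :=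
    mul_le_mul_of_nonneg_right (by linarith) hw
  linarith

/-- Collecting the four contributions to the expected regret for `n ≥ 16`, where
`log log n ≥ 1`. -/
theorem regret_bound_le_mainTerm {αopt αemp C B H D β b ε : ℝ} (hd : 2 ≤ d) (hlam : 0 < lam)
    (hΔ : 0 < Δ) (hσ : 0 < σ) (hS : 0 < S) (hσs : 0 ≤ σs) (hSs : 0 ≤ Ss) (hαo : 0 < αopt)
    (hαe : 0 < αemp) (hC : 0 ≤ C) (hB : 0 ≤ B) (hH : 1 ≤ H) (hn : 16 ≤ n)
    (hD : D = d * Real.log (1 + n / lam))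
    (hβ : β = 2 * (σ ^ 2 * (D + 2 * Real.log n) + lam * S ^ 2))
    (hb : b = 2 * (σs ^ 2 * (D + 2 * Real.log n) + lam * Ss ^ 2))
    (hε : ε = min 1 (Δ ^ 2 / (16 * β * Real.log n))) :
    2 * B * (4 * d * Real.log (1 + 4 * d / lam))
        + 16 * β * Real.log n / (Δ * αemp) * (n * Real.exp (-Real.log n)
          + 2 * (4 * d * Real.log (1 + 4 * d / (ε * lam))))
        + 8 / Δ * ((C * d * Real.log d / αopt + 1) * (2 * ((b + σs ^ 2 * D) * H)))
        + 16 / Δ * ((1 + Real.log n)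
          * (4 * σs ^ 2 * (1 + D / 2 + Real.log n) + 2 * (lam * Ss ^ 2)))
      ≤ (408 + 15488 / αemp + 160 * (C / αopt + 1)) * hiddenLog d lam Δ σ S σs Ss ^ 2
        * (mainTerm d n lam Δ σ S σs Ss H + B * d) := by
  obtain ⟨hX, hdX, hlX, hΔX, hσX, hSX, hX'⟩ :=
    hiddenScale_bounds hd hlam hΔ.le hσ.le hS.le hσs hSs
  have hΛdef : hiddenLog d lam Δ σ S σs Ss = Real.log (hiddenScale d lam Δ σ S σs Ss) := rfl
  rw [hΛdef]
  clear hΛdef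
  generalize hiddenScale d lam Δ σ S σs Ss = X at *
  have hd2 : (2 : ℝ) ≤ d := by exact_mod_cast hd
  have hn16 : (16 : ℝ) ≤ n := by exact_mod_cast hn
  obtain ⟨l, hl⟩ : ∃ l, l = Real.log n := ⟨_, rfl⟩
  rw [← hl] at hβ hb hε
  have hΛ1 : 1 ≤ Real.log X := one_le_log_of_five_le hX
  have he := Real.exp_one_lt_d9
  have hl_e : Real.exp 1 ≤ l := by
    have h1 : Real.log 16 = 4 * Real.log 2 := by
      rw [show (16 : ℝ) = 2 ^ 4 by norm_num, Real.log_pow]; norm_num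
    have h2 : Real.log 16 ≤ l := hl ▸ Real.log_le_log (by norm_num) hn16
    linarith [Real.log_two_gt_d9]
  have hl1 : 1 ≤ l := by linarith [Real.add_one_le_exp 1]
  have hll : 1 ≤ Real.log l := by
    rw [Real.le_log_iff_exp_le (by linarith)]; exact hl_e
  have hmax : max (Real.log l) 0 = Real.log l := max_eq_left (by linarith)
  have hlogd : Real.log d ≤ Real.log X := Real.log_le_log (by linarith) hdX
  have hlogn := log_one_add_div_le (lam := lam) (by omega : 0 < n) hlam hX hX' hl hl1
  have hfirst := log_one_add_four_mul_div_le hlam hX hdX hlX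
  have hexp : (n : ℝ) * Real.exp (-Real.log n) = 1 := by
    rw [Real.exp_neg, Real.exp_log (by linarith)]
    exact mul_inv_cancel₀ (by linarith)
  have hmain : mainTerm d n lam Δ σ S σs Ss H
      = d * l / Δ * ((σ ^ 2 * d * l + lam * S ^ 2) * Real.log l
        + (σs ^ 2 * d * l + lam * Ss ^ 2) * H) := by
    rw [mainTerm, ← hl, hmax]; ring
  rw [hmain, hexp, ← hl]
  have hD1 : D ≤ 2 * (d * (Real.log X * l)) := by
    rw [hD]
    calc (d : ℝ) * Real.log (1 + n / lam) ≤ d * (2 * (Real.log X * l)) := by gcongr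
      _ = _ := by ring
  have hD0 : 0 ≤ D := by
    rw [hD]
    refine mul_nonneg (by positivity) (Real.log_nonneg ?_)
    have : 0 ≤ (n : ℝ) / lam := by positivity
    linarith
  have hdΛl : 2 * l ≤ d * (Real.log X * l) := by
    calc 2 * l = 2 * (1 * l) := by ring
      _ ≤ d * (Real.log X * l) := by gcongr
  have hD2 : D + 2 * l ≤ 4 * d * (Real.log X * l) := by linarith
  have hrad : ∀ x y : ℝ, 2 * (x ^ 2 * (D + 2 * l) + lam * y ^ 2)
      ≤ 8 * (Real.log X * (x ^ 2 * d * l + lam * y ^ 2)) := by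
    intro x y
    have h1 : x ^ 2 * (D + 2 * l) ≤ x ^ 2 * (4 * d * (Real.log X * l)) := by gcongr
    have h2 : lam * y ^ 2 ≤ Real.log X * (lam * y ^ 2) := le_mul_of_one_le_left (by positivity) hΛ1
    have h3 : 0 ≤ lam * y ^ 2 := by positivity
    linarith
  have hβ1 : β ≤ 8 * (Real.log X * (σ ^ 2 * d * l + lam * S ^ 2)) := by rw [hβ]; exact hrad σ S
  have hb1 : b ≤ 8 * (Real.log X * (σs ^ 2 * d * l + lam * Ss ^ 2)) := by rw [hb]; exact hrad σs Ss
  have hβ0 : 0 < β := by rw [hβ]; positivity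
  have hpeel := log_peeling_le hlam hΔ hX hdX hlX hΔX hσ.le hσX hS.le hSX hl1 hll hβ0
    (by positivity) hD2 hβ hε
  generalize Real.log X = Λ at *
  have hΛ2 : Λ ≤ Λ ^ 2 := le_self_pow₀ hΛ1 two_ne_zero
  -- underexplored rounds
  have T1 : 2 * B * (4 * d * Real.log (1 + 4 * d / lam)) ≤ 24 * (Λ ^ 2 * (B * d)) := by
    calc _ ≤ 2 * B * (4 * d * (3 * Λ)) := by gcongr
      _ = 24 * (Λ * (B * d)) := by ring
      _ ≤ _ := by gcongr
  have hone : 1 ≤ d * (Λ * Real.log l) :=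
    one_le_mul_of_one_le_of_one_le (by linarith) (one_le_mul_of_one_le_of_one_le hΛ1 hll)
  have hloglog : 0 ≤ Real.log l := zero_le_one.trans hll
  have hd0 : (0 : ℝ) ≤ d := by positivity
  have hl0 : 0 ≤ l := zero_le_one.trans hl1
  have hH0 : 0 ≤ H := zero_le_one.trans hH
  have hd1 : (1 : ℝ) ≤ d := one_le_two.trans hd2
  have hbD : 0 ≤ b + σs ^ 2 * D := by rw [hb]; positivity
  exact sum_terms_le (by positivity) (by positivity) (by positivity) (by positivity)
    (by positivity) T1 (visible_term_le hl0 hΔ hαe hβ0.le hβ1 hone hpeel hd0)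
    (explored_term_le hl1 hΛ1 hΔ hαo hC hlam.le hH0 hd1 hlogd hb1 hD1 hbD)
    (outside_term_le hl1 hΛ1 hΔ hlam.le hH hd1 hD1 hD0 hdΛl)

end Arithmetic

end LinMED

open LinMED MeasureTheory in
theorem theorem1 (αopt αemp Copt : ℝ) (hαopt : 0 < αopt) (hαemp : 0 < αemp)
    (hα : αopt + αemp ≤ 1) :
    ∃ K : ℝ, ∃ k : ℕ,
      ∀ (d : ℕ), 2 ≤ d →
      ∀ (csupp : ℝ) (ksupp : ℕ) (design : Finset (Vec d) → Vec d → ℝ),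
        IsDesignOracle Copt csupp ksupp design →
      ∀ (arms : ℕ → Finset (Vec d)) (θ : Vec d) (B : ℝ),
        (∀ t, (arms t).Nonempty) →
        (∀ t, ∀ a ∈ arms t, euclNorm a ≤ 1) →
        (∀ t, ∀ a ∈ arms t, gap arms θ t a ≤ B) →
      ∀ (lam σ S σs : ℝ), 0 < lam → 0 < σ → 0 < S → 0 ≤ σs →
      ∀ (Ω : Type*) [MeasurableSpace Ω] (P : Measure Ω) [IsProbabilityMeasure P]
        (A : ℕ → Ω → Vec d) (Y : ℕ → Ω → ℝ) (ahat : ℕ → Ω → Vec d)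
        (qopt : ℕ → Ω → Vec d → ℝ) (bsel : ℕ → Ω → Vec d),
        IsLinearReward P θ σs A Y →
        IsLinMED P lam σ S αopt αemp design arms A Y ahat qopt bsel →
      ∀ n : ℕ, 1 ≤ n →
        ∫ ω, regret arms θ n (fun t => A t ω) ∂P ≤
          K * hiddenLog d lam (minGap arms θ n) σ S σs (euclNorm θ) ^ k *
            (mainTerm d n lam (minGap arms θ n) σ S σs (euclNorm θ)
                (∫ ω, Hmax lam σ S σs θ n (fun t => A t ω) ∂P)
              + B * d) := by
  -- `Copt` is not assumed to be nonnegative, hence the absolute value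
  refine ⟨408 + 15488 / αemp + 160 * (|Copt| / αopt + 1), 2, ?_⟩
  intro d hd csupp ksupp design hO arms θ B hne hnorm hB lam σ S σs hlam hσ hS hσs Ω _ P _ A Y ahat
    qopt bsel hR hM n hn
  obtain ⟨m, rfl⟩ : ∃ m, n = m + 1 := ⟨n - 1, by omega⟩
  have hmem : ∀ᵐ ω ∂P, ∀ t, A t ω ∈ arms t := ae_all_iff.2 hM.arm_mem
  have hB0 : 0 ≤ B := by
    obtain ⟨a, ha⟩ := hne 0
    exact (gap_nonneg hne 0 ha).trans (hB 0 a ha)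
  have hd2 : (2 : ℝ) ≤ d := by exact_mod_cast hd
  have hΔ0 := minGap_nonneg arms θ (m + 1)
  have hΛ := one_le_hiddenLog hd hlam hΔ0 hσ.le hS.le hσs (euclNorm_nonneg θ)
  have hK : 408 ≤ 408 + 15488 / αemp + 160 * (|Copt| / αopt + 1) := by
    have : 0 ≤ 15488 / αemp + 160 * (|Copt| / αopt + 1) := by positivity
    linarith
  have hH0 : 0 ≤ ∫ ω, Hmax lam σ S σs θ (m + 1) (fun t => A t ω) ∂P :=
    integral_nonneg fun ω => zero_le_one.trans (one_le_Hmax _ _ _ _ _ _ _)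
  have hmain := mainTerm_nonneg (d := d) (n := m + 1) (σ := σ) (S := S) (σs := σs)
    (Ss := euclNorm θ) hlam hΔ0 hH0
  have hsmall : ∀ c : ℝ, 0 ≤ c → c ≤ 15 * B → c ≤
      (408 + 15488 / αemp + 160 * (|Copt| / αopt + 1))
        * hiddenLog d lam (minGap arms θ (m + 1)) σ S σs (euclNorm θ) ^ 2 *
        (mainTerm d (m + 1) lam (minGap arms θ (m + 1)) σ S σs (euclNorm θ)
          (∫ ω, Hmax lam σ S σs θ (m + 1) (fun t => A t ω) ∂P) + B * d) := by
    intro c hc0 hc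
    have h1 : 1 ≤ hiddenLog d lam (minGap arms θ (m + 1)) σ S σs (euclNorm θ) ^ 2 :=
      one_le_pow₀ hΛ
    calc c ≤ 408 * 1 * (0 + B * 1) := by linarith
      _ ≤ _ := by gcongr; linarith
  by_cases hpos : ∃ t < m + 1, ∃ a ∈ arms t, 0 < gap arms θ t a
  swap
  · -- without positive gaps there is no regret
    push Not at hpos
    have hzero : ∫ ω, regret arms θ (m + 1) (fun t => A t ω) ∂P = 0 := by
      rw [← integral_zero Ω ℝ (μ := P)]
      refine integral_congr_ae ?_
      filter_upwards [hmem] with ω hω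
      exact Finset.sum_eq_zero fun t ht =>
        le_antisymm (hpos t (Finset.mem_range.1 ht) _ (hω t)) (gap_nonneg hne t (hω t))
    rw [hzero]
    exact hsmall 0 le_rfl (by linarith)
  obtain ⟨t₀, ht₀, a₀, ha₀, hgap₀⟩ := hpos
  have hΔ := (minGap_pos_and_le ht₀ ha₀ hgap₀).1
  rcases lt_or_ge (m + 1) 16 with hm | hm
  · -- `log log n` may be small or negative here, but there are at most 15 rounds
    have hreg0 : ∀ᵐ ω ∂P, 0 ≤ regret arms θ (m + 1) (fun t => A t ω) := by
      filter_upwards [hmem] with ω hω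
      exact Finset.sum_nonneg fun t _ => gap_nonneg hne t (hω t)
    refine hsmall _ (integral_nonneg_of_ae hreg0) ?_
    calc ∫ ω, regret arms θ (m + 1) (fun t => A t ω) ∂P ≤ ∫ ω, 15 * B ∂P := by
          refine integral_mono_of_nonneg hreg0 (integrable_const _) ?_
          filter_upwards [hmem] with ω hω
          calc regret arms θ (m + 1) (fun t => A t ω)
              ≤ ∑ t ∈ Finset.range (m + 1), B := Finset.sum_le_sum fun t _ => hB t _ (hω t)
            _ = ((m + 1 : ℕ) : ℝ) * B := by simp
            _ ≤ 15 * B := by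
                gcongr
                exact_mod_cast Nat.lt_succ_iff.1 hm
      _ = 15 * B := by simp
  · have hA1 : ∀ᵐ ω ∂P, ∀ t, euclNorm (A t ω) ≤ 1 := by
      filter_upwards [hmem] with ω hω t using hnorm t _ (hω t)
    have hd0 : 0 < d := by omega
    have hn16 : (16 : ℝ) ≤ ((m + 1 : ℕ) : ℝ) := by exact_mod_cast hm
    have hlog1 : 1 ≤ Real.log ((m + 1 : ℕ) : ℝ) := one_le_log_of_five_le (by linarith)
    have hHi := integrable_Hmax (P := P) (σs := σs) hlam hσ.le hS θ m hM.measurable_arm (by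
      filter_upwards [hA1] with ω hω t ht
      exact radius_le hlam hd0 hω (Nat.lt_succ_of_le ht) σs (euclNorm θ))
    have hH1 : 1 ≤ ∫ ω, Hmax lam σ S σs θ (m + 1) (fun t => A t ω) ∂P := by
      calc (1 : ℝ) = ∫ _, 1 ∂P := by simp
        _ ≤ _ := integral_mono (integrable_const _) hHi fun ω => one_le_Hmax _ _ _ _ _ _ _
    refine (integral_regret_le hd0 hlam hσ.le hS hσs hαopt hαemp hα hO hne hnorm hB hR hM hΔ
      (fun t ht a ha h => (minGap_pos_and_le ht ha h).2) hlog1 rfl rfl rfl rfl).trans ?_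
    exact regret_bound_le_mainTerm hd hlam hΔ hσ hS hσs (euclNorm_nonneg θ) hαopt hαemp
      (abs_nonneg Copt) hB0 hH1 hm rfl rfl rfl rfl
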